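/- **Conventions.** Let $n\in\mathbb N$, $m\in\mathbb R$, $\langle\xi\rangle=(1+|\xi|^2)^{1/2}$ for $\xi\in\mathbb R^n$; all nets are indexed by $\varepsilon\in(0,1]$. * $\Pi_{lsc}$ is the set of logarithmic slow scale nets: real nets $(\omega_\varepsilon)$ such that there are $\eta\in(0,1]$, $c>0$ with $\omega_\varepsilon\ge c$ for $\varepsilon\in(0,\eta]$, and there is $\eta\in(0,1]$ such that for every real $p\ge 0$ there is $c_p>0$ with $|\omega_\varepsilon|^p\le c_p\log(1/\varepsilon)$ for $\varepsilon\in(0,\eta]$. * $S^m$ is the set of $a\in C^\infty(\mathbb R^n\times\mathbb R^n;\mathbb C)$ with $q^{(m)}_{\alpha,\beta}(a):=\sup_{(x,\xi)}|\partial_\xi^\alpha\partial_x^\beta a(x,\xi)|\langle\xi\rangle^{-m+|\alpha|}<\infty$ for all multi-indices $\alpha,\beta$. $S^m_{lsc}$ is the set of nets $(a_\varepsilon)$ in $S^m$ such that for all $\alpha,\beta$ there is $(\omega_\varepsilon)\in\Pi_{lsc}$ with $q^{(m)}_{\alpha,\beta}(a_\varepsilon)=O(\omega_\varepsilon)$ as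 $\varepsilon\to0$. Put $S^{-\infty}_{lsc}=\bigcap_{k\in\mathbb R}S^k_{lsc}$. * For a symbol $a$ and a Schwartz function $u$ let $a(x,D)u(x)=(2\pi)^{-n}\int e^{ix\cdot\xi}a(x,\xi)\hat u(\xi)\,d\xi$ with $\hat u(\xi)=\int e^{-iy\cdot\xi}u(y)\,dy$. For symbols $a,b$ we denote by $a\# b$ the symbol of the product of the operators: $a(x,D)\,(b(x,D)u)=(a\# b)(x,D)u$ for all Schwartz functions $u$. **Theorem.** Let $(a_\varepsilon)\in S^m_{lsc}$ be logarithmic slow scale elliptic, i.e. there are $(r_\varepsilon),(s_\varepsilon)\in\Pi_{lsc}$ and $\eta\in(0,1]$ with $$|a_\varepsilon(x,\xi)|\ \ge\ \frac1{s_\varepsilon}\langle\xi\rangle^m\qquad\text{for all }x,\xi\in\mathbb R^n,\ |\xi|\ge r_\varepsilon,\ \varepsilon\in(0,\eta].$$ Then there is $(p_\varepsilon)\in S^{-m}_{lsc}$ such that the net $(p_\varepsilon\# a_\varepsilon)$ exists in $S^0_{lsc}$ and equals $1$ modulo $S^{-\infty}_{lsc}$, i.e. there are $(\rho_\varepsilon)\in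 S^{-\infty}_{lsc}$ and $\eta'\in(0,1]$ with $$p_\varepsilon\# a_\varepsilon=1+\rho_\varepsilon\qquad\text{for all }\varepsilon\in(0,\eta'].$$ -/

import Mathlib

open scoped ContDiff SchwartzMap

noncomputable section

/-- The parameter set `(0,1]` of all nets. -/
abbrev EpsIndex : Type := Set.Ioc (0 : ℝ) 1

/-- Euclidean space `ℝⁿ`. -/
abbrev RSpace (n : ℕ) : Type := EuclideanSpace ℝ (Fin n)

/-- Nets `(a_ε)` of complex functions `a_ε (x, ξ)` on phase space `ℝⁿ × ℝⁿ`. -/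
abbrev SymbolNet (n : ℕ) : Type := EpsIndex → RSpace n × RSpace n → ℂ

/-- `w` is a logarithmic slow scale net: it is bounded below by a positive constant for small `ε`,
and every power of it is `O(log (1/ε))`, on an interval that does not depend on the power. -/
def IsLscNet (w : EpsIndex → ℝ) : Prop :=
  (∃ η : EpsIndex, ∃ c : ℝ, 0 < c ∧ ∀ ε : EpsIndex, ε ≤ η → c ≤ w ε) ∧
  (∃ η : EpsIndex, ∀ p : ℝ, 0 ≤ p → ∃ c : ℝ, 0 < c ∧
    ∀ ε : EpsIndex, ε ≤ η → |w ε| ^ p ≤ c * Real.log (1 / (ε : ℝ)))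

/-- The Japanese bracket `⟨ξ⟩ = (1 + |ξ|²)^{1/2}`. -/
def bracket {n : ℕ} (ξ : RSpace n) : ℝ := Real.sqrt (1 + ‖ξ‖ ^ 2)

/-- The partial derivative `∂_{x_j}` of a function of `(x, ξ)`. -/
def partialX {n : ℕ} (j : Fin n) (a : RSpace n × RSpace n → ℂ) : RSpace n × RSpace n → ℂ :=
  fun z => fderiv ℝ a z (EuclideanSpace.single j 1, 0)

/-- The partial derivative `∂_{ξ_j}` of a function of `(x, ξ)`. -/
def partialXi {n : ℕ} (j : Fin n) (a : RSpace n × RSpace n → ℂ) : RSpace n × RSpace n → ℂ :=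
  fun z => fderiv ℝ a z (0, EuclideanSpace.single j 1)

/-- The mixed derivative `∂_{ξ_{i₁}} ⋯ ∂_{ξ_{i_k}} ∂_{x_{j₁}} ⋯ ∂_{x_{j_l}} a` for lists of
coordinate indices `I = [i₁, …, i_k]`, `J = [j₁, …, j_l]`. For smooth `a` the order inside the lists
is irrelevant, so that these are exactly the derivatives `∂_ξ^α ∂_x^β a` for multi-indices `α`, `β`
with `|α| = k` and `|β| = l`. -/
def mixedDeriv {n : ℕ} (I J : List (Fin n)) (a : RSpace n × RSpace n → ℂ) :
    RSpace n × RSpace n → ℂ :=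
  I.foldr partialXi (J.foldr partialX a)

/-- The global symbol class `S^m = S^m_{1,0}(ℝⁿ × ℝⁿ)`. -/
def IsSymbol {n : ℕ} (m : ℝ) (a : RSpace n × RSpace n → ℂ) : Prop :=
  ContDiff ℝ ∞ a ∧ ∀ I J : List (Fin n), ∃ C : ℝ, ∀ x ξ : RSpace n,
    ‖mixedDeriv I J a (x, ξ)‖ ≤ C * bracket ξ ^ (m - (I.length : ℝ))

/-- The set `S^m_{lsc}` of moderate logarithmic slow scale symbols of order `m`: nets in `S^m`
each of whose seminorms `sup |∂_ξ^α ∂_x^β a_ε| ⟨ξ⟩^{-m+|α|}` is `O(w_ε)` as `ε → 0` for some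
logarithmic slow scale net `w` (which may depend on `α`, `β`). -/
def IsLscSymbol {n : ℕ} (m : ℝ) (a : SymbolNet n) : Prop :=
  (∀ ε : EpsIndex, IsSymbol m (a ε)) ∧
  ∀ I J : List (Fin n), ∃ w : EpsIndex → ℝ, IsLscNet w ∧ ∃ C : ℝ, 0 < C ∧ ∃ η : EpsIndex,
    ∀ ε : EpsIndex, ε ≤ η → ∀ x ξ : RSpace n,
      ‖mixedDeriv I J (a ε) (x, ξ)‖ ≤ C * w ε * bracket ξ ^ (m - (I.length : ℝ))

/-- The set `S^{-∞}_{lsc}`, the intersection of all the `S^m_{lsc}`. -/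
def IsLscSmoothing {n : ℕ} (a : SymbolNet n) : Prop :=
  ∀ m : ℝ, IsLscSymbol m a

/-- Logarithmic slow scale ellipticity of order `m`. -/
def IsLscElliptic {n : ℕ} (m : ℝ) (a : SymbolNet n) : Prop :=
  ∃ r : EpsIndex → ℝ, IsLscNet r ∧ ∃ s : EpsIndex → ℝ, IsLscNet s ∧ ∃ η : EpsIndex,
    ∀ ε : EpsIndex, ε ≤ η → ∀ x ξ : RSpace n, r ε ≤ ‖ξ‖ →
      (1 / s ε) * bracket ξ ^ m ≤ ‖a ε (x, ξ)‖

/-- The Fourier transform `û(ξ) = ∫ e^{-i y·ξ} u(y) dy`. -/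
def fourierHat {n : ℕ} (u : RSpace n → ℂ) (ξ : RSpace n) : ℂ :=
  ∫ y : RSpace n, Complex.exp (-(Complex.I * ((inner ℝ y ξ : ℝ) : ℂ))) * u y

/-- The pseudodifferential operator `a(x,D)`, the standard (left) quantization
`a(x,D) u (x) = (2π)^{-n} ∫ e^{i x·ξ} a(x,ξ) û(ξ) dξ`. -/
def pseudoOp {n : ℕ} (a : RSpace n × RSpace n → ℂ) (u : RSpace n → ℂ) (x : RSpace n) : ℂ :=
  (((2 * Real.pi) ^ n : ℝ) : ℂ)⁻¹ *
    ∫ ξ : RSpace n, Complex.exp (Complex.I * ((inner ℝ x ξ : ℝ) : ℂ)) * a (x, ξ) * fourierHat u ξ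

/-- `c = a # b`: the function `c` is the symbol of the product of operators, that is
`a(x,D) (b(x,D) u) = c(x,D) u` for all Schwartz functions `u`. (If `b` is a symbol, then `b(x,D) u`
is again a Schwartz function, and a symbol `c` is uniquely determined by its operator.) -/
def IsSharp {n : ℕ} (a b c : RSpace n × RSpace n → ℂ) : Prop :=
  ∀ u : 𝓢(RSpace n, ℂ), ∀ x : RSpace n,
    pseudoOp a (pseudoOp b (fun y => u y)) x = pseudoOp c (fun y => u y) x

/-- Equality of nets modulo `S^{-∞}_{lsc}`: for small `ε` (nets are considered as `ε → 0`) they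
differ by a net in `S^{-∞}_{lsc}`. -/
def EqModLscSmoothing {n : ℕ} (a b : SymbolNet n) : Prop :=
  ∃ r : SymbolNet n, IsLscSmoothing r ∧ ∃ η : EpsIndex, ∀ ε : EpsIndex, ε ≤ η →
    ∀ z : RSpace n × RSpace n, a ε z = b ε z + r ε z

end

/-!
An elliptic symbol `a` is inverted by `q = conj a / (|a|² + φ)`, where `φ` is a cut-off to the
frequencies at which `a` may vanish, up to an error `1 - q a` that vanishes at high frequencies
(`exists_approx_inv`). As `q # a - q a` has order `-1`, so has `1 - q # a`, and iteration improves
the error: with `e₀ = 1` and `e_{k+1} = e_k - (e_k q) # a` the symbol `e_k` has order `-k`, and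
`1 - (∑_{k < N} e_k q) # a = e_N`. An asymptotic sum `p` of the `e_k q` (`exists_asymptotic_sum`)
then has `1 - p # a` of every order (`exists_parametrix`). What has to be watched in all this is
that every seminorm of every symbol obtained is bounded by a polynomial in finitely many seminorms
of `a`, the radius `r_ε` and the constant `s_ε`: polynomials in logarithmic slow scale nets are
again of logarithmic slow scale. This is organized by `SymB N m A f`, which says that the constant
`A` bounds the seminorms of order at most `N` of `f` as a symbol of order `m`, by `Moderate`, the
nets all of whose powers are `O(log (1/ε))`, and by `NetSymb`, the nets of symbols with moderate
bounds.

The product symbol is constructed without oscillatory integrals. With the operator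
`(1 - Δ_x) ^ K` moved to `a`, the integral formula
`(2π) ^ (-n) ∫∫ exp (-i y·η) ⟨η⟩ ^ (-2K) p (x, ξ + η) ((1 - Δ_x) ^ K a) (x + y, ξ) dη dy`
of `p # a` converges as an iterated integral when `K` is large, because the inner integral, a
Fourier transform of a smooth integrable amplitude, decays in `y` (`exists_fourierHat_decay`). This
is `sharp K p a`.

* `isSharp_sharp`: it is the symbol of the product of the operators. For `p` of very negative order,
  this is Fubini's theorem (`pseudoOp_comp_of_neg`). In general `⟨ζ⟩ ^ (-2M)` is moved from the
  Fourier transform of `a(x,D) u`, which is smooth, to `p`, and the powers of `1 - Δ_x` are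
  redistributed through integration by parts (`sharp_eq_bil_zero`).
* `sharp_eq_of_le`: it does not depend on `K`, so that `K` may be chosen as large as an estimate
  needs.
* `sharp_one`: `1 # a = a`, by the Fourier inversion formula and the uniqueness of symbols.
* `exists_symB_sharp_sub`: `p # a - p a` has one order less than `p a`. Indeed, by `sharp_one` it
  is given by the same integral with `p (x, ξ + η) - p (x, ξ)` in place of `p (x, ξ + η)`; this
  amplitude is `O(⟨ξ⟩ ^ (m - 1))`, with polynomial growth in `η` that the weight absorbs. The
  derivatives follow from the Leibniz rule for the bilinear form `bil`.
-/

open scoped ContDiff SchwartzMap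
open Filter Topology MeasureTheory

noncomputable section

/-! ### The Japanese bracket -/

variable {n : ℕ}

lemma bracket_sq (ξ : RSpace n) : bracket ξ ^ 2 = 1 + ‖ξ‖ ^ 2 :=
  Real.sq_sqrt (by positivity)

lemma one_le_bracket (ξ : RSpace n) : 1 ≤ bracket ξ :=
  Real.one_le_sqrt.2 (by nlinarith [sq_nonneg ‖ξ‖])

lemma bracket_pos (ξ : RSpace n) : 0 < bracket ξ :=
  zero_lt_one.trans_le (one_le_bracket ξ)

lemma norm_le_bracket (ξ : RSpace n) : ‖ξ‖ ≤ bracket ξ :=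
  Real.le_sqrt_of_sq_le (by linarith)

lemma bracket_le_one_add_norm (ξ : RSpace n) : bracket ξ ≤ 1 + ‖ξ‖ :=
  Real.sqrt_le_iff.2 ⟨by positivity, by nlinarith [norm_nonneg ξ]⟩

lemma bracket_neg (ξ : RSpace n) : bracket (-ξ) = bracket ξ := by simp [bracket]

lemma bracket_rpow_pos (ξ : RSpace n) (s : ℝ) : 0 < bracket ξ ^ s :=
  Real.rpow_pos_of_pos (bracket_pos ξ) s

lemma bracket_rpow_le {s t : ℝ} (h : s ≤ t) (ξ : RSpace n) : bracket ξ ^ s ≤ bracket ξ ^ t :=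
  Real.rpow_le_rpow_of_exponent_le (one_le_bracket ξ) h

lemma bracket_rpow_add (ξ : RSpace n) (s t : ℝ) :
    bracket ξ ^ (s + t) = bracket ξ ^ s * bracket ξ ^ t :=
  Real.rpow_add (bracket_pos ξ) s t

lemma bracket_add_le (ξ η : RSpace n) : bracket (ξ + η) ≤ 2 * bracket ξ * bracket η := by
  have h2 := norm_add_le ξ η
  have h4 := bracket_pos ξ
  have h5 := bracket_pos η
  refine (sq_le_sq₀ (bracket_pos _).le (by positivity)).1 ?_
  rw [mul_pow, mul_pow, bracket_sq, bracket_sq, bracket_sq]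
  have h3 : ‖ξ + η‖ ^ 2 ≤ (‖ξ‖ + ‖η‖) ^ 2 := by gcongr
  nlinarith [sq_nonneg (‖ξ‖ - ‖η‖), mul_nonneg (sq_nonneg ‖ξ‖) (sq_nonneg ‖η‖), sq_nonneg ‖ξ‖,
    sq_nonneg ‖η‖]

/-- Peetre's inequality. -/
lemma bracket_add_rpow_le (s : ℝ) (ξ η : RSpace n) :
    bracket (ξ + η) ^ s ≤ 2 ^ |s| * bracket ξ ^ s * bracket η ^ |s| := by
  have hξ := bracket_pos ξ
  have hη := bracket_pos η
  rcases le_or_gt 0 s with hs | hs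
  · rw [abs_of_nonneg hs, ← Real.mul_rpow (by norm_num) hξ.le,
      ← Real.mul_rpow (by positivity) hη.le]
    exact Real.rpow_le_rpow (bracket_pos _).le (bracket_add_le ξ η) hs
  · rw [abs_of_neg hs]
    have h := bracket_add_le (ξ + η) (-η)
    rw [add_neg_cancel_right, bracket_neg] at h
    have h3 := Real.rpow_le_rpow hξ.le h (neg_nonneg.2 hs.le)
    have hp := bracket_pos (ξ + η)
    rw [Real.mul_rpow (by positivity) hη.le, Real.mul_rpow (by norm_num) hp.le] at h3
    have e1 : bracket (ξ + η) ^ (-s) * bracket (ξ + η) ^ s = 1 := by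
      rw [← Real.rpow_add hp]; simp
    have e2 : bracket ξ ^ (-s) * bracket ξ ^ s = 1 := by
      rw [← Real.rpow_add hξ]; simp
    have p1 := bracket_rpow_pos (ξ + η) s
    have p2 := bracket_rpow_pos ξ s
    calc bracket (ξ + η) ^ s = bracket ξ ^ (-s) * (bracket ξ ^ s * bracket (ξ + η) ^ s) := by
          rw [← mul_assoc, e2, one_mul]
      _ ≤ (2 ^ (-s) * bracket (ξ + η) ^ (-s) * bracket η ^ (-s)) *
          (bracket ξ ^ s * bracket (ξ + η) ^ s) := by gcongr
      _ = 2 ^ (-s) * bracket ξ ^ s * bracket η ^ (-s) *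
          (bracket (ξ + η) ^ (-s) * bracket (ξ + η) ^ s) := by ring
      _ = _ := by rw [e1, mul_one]

/-! ### Partial derivatives on phase space -/

/-- Phase space `ℝⁿ × ℝⁿ` with points `(x, ξ)`. -/
abbrev Phase (n : ℕ) : Type := RSpace n × RSpace n

/-- The derivative of a function on phase space in the direction `v`. -/
def dirD (v : Phase n) (f : Phase n → ℂ) : Phase n → ℂ := fun z => fderiv ℝ f z v

/-- The direction of the coordinate `x_j`. -/
abbrev dirX (j : Fin n) : Phase n := (EuclideanSpace.single j 1, 0)

/-- The direction of the coordinate `ξ_j`. -/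
abbrev dirXi (j : Fin n) : Phase n := (0, EuclideanSpace.single j 1)

lemma partialX_eq (j : Fin n) (f : Phase n → ℂ) : partialX j f = dirD (dirX j) f := rfl

lemma partialXi_eq (j : Fin n) (f : Phase n → ℂ) : partialXi j f = dirD (dirXi j) f := rfl

variable {f g : Phase n → ℂ}

lemma smooth_dirD (v : Phase n) (hf : ContDiff ℝ ∞ f) : ContDiff ℝ ∞ (dirD v f) :=
  (hf.fderiv_right (m := ∞) (by simp)).clm_apply contDiff_const

lemma smooth_partialX (j : Fin n) (hf : ContDiff ℝ ∞ f) : ContDiff ℝ ∞ (partialX j f) :=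
  smooth_dirD _ hf

lemma smooth_partialXi (j : Fin n) (hf : ContDiff ℝ ∞ f) : ContDiff ℝ ∞ (partialXi j f) :=
  smooth_dirD _ hf

lemma smooth_differentiable (hf : ContDiff ℝ ∞ f) : Differentiable ℝ f :=
  hf.differentiable (by simp)

lemma dirD_add (v : Phase n) (hf : Differentiable ℝ f) (hg : Differentiable ℝ g) :
    dirD v (fun z => f z + g z) = fun z => dirD v f z + dirD v g z := by
  funext z; simp only [dirD]; rw [fderiv_fun_add (hf z) (hg z)]; rfl

lemma dirD_mul (v : Phase n) (hf : Differentiable ℝ f) (hg : Differentiable ℝ g) :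
    dirD v (fun z => f z * g z) = fun z => dirD v f z * g z + f z * dirD v g z := by
  funext z; simp only [dirD]; rw [fderiv_fun_mul (hf z) (hg z)]; simp; ring

lemma dirD_const_mul (v : Phase n) (c : ℂ) (hf : Differentiable ℝ f) :
    dirD v (fun z => c * f z) = fun z => c * dirD v f z := by
  funext z; simp only [dirD]; rw [fderiv_const_mul (hf z)]; simp

lemma dirD_neg (v : Phase n) : dirD v (fun z => -f z) = fun z => -dirD v f z := by
  funext z; simp only [dirD]; rw [fderiv_fun_neg]; rfl

lemma dirD_sub (v : Phase n) (hf : Differentiable ℝ f) (hg : Differentiable ℝ g) :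
    dirD v (fun z => f z - g z) = fun z => dirD v f z - dirD v g z := by
  funext z; simp only [dirD]; rw [fderiv_fun_sub (hf z) (hg z)]; rfl

lemma dirD_const (v : Phase n) (c : ℂ) : dirD v (fun _ => c) = fun _ => 0 := by
  funext z; simp [dirD]

lemma dirD_sum (v : Phase n) {ι : Type*} (s : Finset ι) {F : ι → Phase n → ℂ}
    (hF : ∀ i ∈ s, Differentiable ℝ (F i)) :
    dirD v (fun z => ∑ i ∈ s, F i z) = fun z => ∑ i ∈ s, dirD v (F i) z := by
  funext z; simp only [dirD]
  rw [fderiv_fun_sum fun i hi => hF i hi z]; simp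

lemma dirD_comp_add_right (v w : Phase n) :
    dirD v (fun z => f (z + w)) = fun z => dirD v f (z + w) := by
  funext z; simp only [dirD]; rw [fderiv_comp_add_right]

lemma dirD_conj (v : Phase n) (hf : Differentiable ℝ f) :
    dirD v (fun z => (starRingEnd ℂ) (f z)) = fun z => (starRingEnd ℂ) (dirD v f z) := by
  funext z
  have := (Complex.conjCLE.toContinuousLinearMap.hasFDerivAt.comp z (hf z).hasFDerivAt).fderiv
  simp only [dirD]
  change fderiv ℝ (⇑Complex.conjCLE.toContinuousLinearMap ∘ f) z v = _
  rw [this]; rfl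

lemma dirD_comm (v w : Phase n) (hf : ContDiff ℝ ∞ f) :
    dirD v (dirD w f) = dirD w (dirD v f) := by
  have h2 : ∀ v w z, dirD v (dirD w f) z = fderiv ℝ (fderiv ℝ f) z v w := by
    intro v w z
    have hd : DifferentiableAt ℝ (fderiv ℝ f) z :=
      ((hf.fderiv_right (m := ∞) (by simp)).differentiable (by simp)) z
    change fderiv ℝ (fun z => fderiv ℝ f z w) z v = _
    rw [fderiv_clm_apply hd (differentiableAt_const w)]
    simp
  funext z
  rw [h2, h2]
  exact (hf.contDiffAt.isSymmSndFDerivAt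
    (by simpa using WithTop.coe_le_coe.2 (le_top : (2 : ℕ∞) ≤ ⊤))) v w

lemma dirD_inv (v : Phase n) (hf : Differentiable ℝ f) (h0 : ∀ z, f z ≠ 0) :
    dirD v (fun z => (f z)⁻¹) = fun z => -((f z)⁻¹ * (f z)⁻¹) * dirD v f z := by
  have hd : Differentiable ℝ fun z => (f z)⁻¹ := fun z => (hf z).inv (h0 z)
  have h1 := dirD_mul v hd hf
  have h2 : (fun z => (f z)⁻¹ * f z) = fun _ => (1 : ℂ) := by
    funext z; exact inv_mul_cancel₀ (h0 z)
  rw [h2, dirD_const] at h1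
  funext z
  have h3 := congrFun h1 z
  have h4 := h0 z
  field_simp
  field_simp at h3
  linear_combination -h3

lemma phase_eq_sum (v : Phase n) :
    v = ∑ j, v.1 j • dirX j + ∑ j, v.2 j • dirXi j := by
  have h : ∀ x : RSpace n, ∑ j, x j • EuclideanSpace.single j (1 : ℝ) = x := by
    intro x
    have := (EuclideanSpace.basisFun (Fin n) ℝ).sum_repr x
    simpa using this
  ext1
  · simp [Prod.fst_sum, h]
  · simp [Prod.snd_sum, h]

lemma fderiv_eq_sum (f : Phase n → ℂ) (z : Phase n) :
    fderiv ℝ f z =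
      ∑ j, ((EuclideanSpace.proj j ∘L ContinuousLinearMap.fst ℝ (RSpace n) (RSpace n)) :
        Phase n →L[ℝ] ℝ).smulRight (partialX j f z) +
      ∑ j, ((EuclideanSpace.proj j ∘L ContinuousLinearMap.snd ℝ (RSpace n) (RSpace n)) :
        Phase n →L[ℝ] ℝ).smulRight (partialXi j f z) := by
  refine ContinuousLinearMap.ext fun v => ?_
  conv_lhs => rw [phase_eq_sum v]
  simp only [map_add, map_sum, map_smul, partialX, partialXi]
  simp

lemma norm_fderiv_le (f : Phase n → ℂ) (z : Phase n) :
    ‖fderiv ℝ f z‖ ≤ ∑ j, ‖partialX j f z‖ + ∑ j, ‖partialXi j f z‖ := by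
  refine ContinuousLinearMap.opNorm_le_bound _ (by positivity) fun v => ?_
  conv_lhs => rw [phase_eq_sum v]
  simp only [map_add, map_sum, map_smul]
  refine (norm_add_le _ _).trans ?_
  rw [add_mul, Finset.sum_mul, Finset.sum_mul]
  refine add_le_add ((norm_sum_le _ _).trans ?_) ((norm_sum_le _ _).trans ?_)
  · refine Finset.sum_le_sum fun j _ => ?_
    rw [norm_smul, mul_comm]
    exact mul_le_mul_of_nonneg_left ((PiLp.norm_apply_le v.1 j).trans
      (norm_fst_le v)) (norm_nonneg _)
  · refine Finset.sum_le_sum fun j _ => ?_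
    rw [norm_smul, mul_comm]
    exact mul_le_mul_of_nonneg_left ((PiLp.norm_apply_le v.2 j).trans
      (norm_snd_le v)) (norm_nonneg _)

/-- Smoothness of the partial derivatives suffices: `fderiv` is a combination of them. -/
lemma contDiff_succ_of_partials {k : ℕ} (hf : Differentiable ℝ f)
    (hx : ∀ j, ContDiff ℝ k (partialX j f)) (hξ : ∀ j, ContDiff ℝ k (partialXi j f)) :
    ContDiff ℝ (k + 1 : ℕ) f := by
  have : ((k + 1 : ℕ) : WithTop ℕ∞) = (k : WithTop ℕ∞) + 1 := by push_cast; rfl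
  rw [this, contDiff_succ_iff_fderiv]
  refine ⟨hf, by simp, ?_⟩
  have h : fderiv ℝ f = fun z => _ := funext (fderiv_eq_sum f)
  rw [h]
  refine ContDiff.add (ContDiff.sum fun j _ => ?_) (ContDiff.sum fun j _ => ?_)
  · exact contDiff_const.smulRight (hx j)
  · exact contDiff_const.smulRight (hξ j)

/-! ### Symbol estimates -/

/-- `SymAt N m A f z`: at the point `z`, all derivatives of `f` of total order at most `N` satisfy
the estimates of a symbol of order `m` with the constant `A`. The definition is recursive in `N`:
a derivative in `x` keeps the order `m`, and a derivative in `ξ` lowers it by one. -/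
def SymAt : ℕ → ℝ → ℝ → (Phase n → ℂ) → Phase n → Prop
  | 0, m, A, f, z => ‖f z‖ ≤ A * bracket z.2 ^ m
  | N + 1, m, A, f, z => ‖f z‖ ≤ A * bracket z.2 ^ m ∧
      (∀ j, SymAt N m A (partialX j f) z) ∧ ∀ j, SymAt N (m - 1) A (partialXi j f) z

/-- The estimates `SymAt` at all points of phase space, with the same constant: `A` bounds the
seminorms of order at most `N` of the symbol `f` of order `m`. -/
def SymB (N : ℕ) (m A : ℝ) (f : Phase n → ℂ) : Prop := ∀ z, SymAt N m A f z

lemma SymAt.bound {N : ℕ} {m A : ℝ} {z : Phase n} (h : SymAt N m A f z) :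
    ‖f z‖ ≤ A * bracket z.2 ^ m := by
  cases N with
  | zero => exact h
  | succ N => exact h.1

lemma SymAt.nonneg {N : ℕ} {m A : ℝ} {z : Phase n} (h : SymAt N m A f z) : 0 ≤ A := by
  have h1 := (norm_nonneg _).trans h.bound
  exact nonneg_of_mul_nonneg_left h1 (bracket_rpow_pos _ _)

lemma SymB.nonneg {N : ℕ} {m A : ℝ} (h : SymB N m A f) : 0 ≤ A := (h 0).nonneg

lemma SymB.bound {N : ℕ} {m A : ℝ} (h : SymB N m A f) (z : Phase n) :
    ‖f z‖ ≤ A * bracket z.2 ^ m := (h z).bound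

lemma symB_succ {N : ℕ} {m A : ℝ} :
    SymB (N + 1) m A f ↔ (∀ z, ‖f z‖ ≤ A * bracket z.2 ^ m) ∧
      (∀ j, SymB N m A (partialX j f)) ∧ ∀ j, SymB N (m - 1) A (partialXi j f) :=
  ⟨fun h => ⟨fun z => (h z).1, fun j z => (h z).2.1 j, fun j z => (h z).2.2 j⟩,
    fun h z => ⟨h.1 z, fun j => h.2.1 j z, fun j => h.2.2 j z⟩⟩

lemma SymAt.mono {N : ℕ} {m m' A A' : ℝ} {z : Phase n} (h : SymAt N m A f z) (hA : A ≤ A')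
    (hm : m ≤ m') : SymAt N m' A' f z := by
  have key : ∀ {m m' : ℝ} {f : Phase n → ℂ}, m ≤ m' → ‖f z‖ ≤ A * bracket z.2 ^ m →
      ‖f z‖ ≤ A' * bracket z.2 ^ m' := by
    intro m m' f hm h'
    exact h'.trans (mul_le_mul hA (bracket_rpow_le hm _) (bracket_rpow_pos _ _).le
      (h.nonneg.trans hA))
  induction N generalizing m m' f with
  | zero => exact key hm h
  | succ N ih =>
    exact ⟨key hm h.1, fun j => ih (h.2.1 j) hm, fun j => ih (h.2.2 j) (by linarith)⟩

lemma SymB.mono {N : ℕ} {m m' A A' : ℝ} (h : SymB N m A f) (hA : A ≤ A') (hm : m ≤ m') :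
    SymB N m' A' f := fun z => (h z).mono hA hm

lemma SymAt.of_succ {N : ℕ} {m A : ℝ} {z : Phase n} (h : SymAt (N + 1) m A f z) :
    SymAt N m A f z := by
  induction N generalizing m f with
  | zero => exact h.1
  | succ N ih => exact ⟨h.1, fun j => ih (h.2.1 j), fun j => ih (h.2.2 j)⟩

lemma SymAt.of_le {N N' : ℕ} {m A : ℝ} {z : Phase n} (h : SymAt N' m A f z) (hN : N ≤ N') :
    SymAt N m A f z := by
  induction N', hN using Nat.le_induction with
  | base => exact h
  | succ k _ ih => exact ih h.of_succ

lemma SymB.of_le {N N' : ℕ} {m A : ℝ} (h : SymB N' m A f) (hN : N ≤ N') :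
    SymB N m A f := fun z => (h z).of_le hN

/-- The estimates at a point depend only on the germ of the function there. -/
lemma SymAt.congr {N : ℕ} {m A : ℝ} {z : Phase n} (h : SymAt N m A f z) (hfg : f =ᶠ[𝓝 z] g) :
    SymAt N m A g z := by
  have hd : ∀ (v : Phase n) {f g : Phase n → ℂ}, f =ᶠ[𝓝 z] g → dirD v f =ᶠ[𝓝 z] dirD v g :=
    fun v f g h => h.fderiv.mono fun w hw => congrArg (fun T : Phase n →L[ℝ] ℂ => T v) hw
  induction N generalizing m f g with
  | zero => have := h.bound; rwa [hfg.eq_of_nhds] at this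
  | succ N ih =>
    refine ⟨?_, fun j => ih (h.2.1 j) (hd _ hfg), fun j => ih (h.2.2 j) (hd _ hfg)⟩
    have := h.bound; rwa [hfg.eq_of_nhds] at this

lemma SymAt.add {N : ℕ} {m A B : ℝ} {z : Phase n} (hf : SymAt N m A f z) (hg : SymAt N m B g z)
    (sf : ContDiff ℝ ∞ f) (sg : ContDiff ℝ ∞ g) : SymAt N m (A + B) (fun z => f z + g z) z := by
  have key : ∀ {m : ℝ} {f g : Phase n → ℂ}, ‖f z‖ ≤ A * bracket z.2 ^ m →
      ‖g z‖ ≤ B * bracket z.2 ^ m → ‖f z + g z‖ ≤ (A + B) * bracket z.2 ^ m := by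
    intro m f g h1 h2
    rw [add_mul]; exact (norm_add_le _ _).trans (add_le_add h1 h2)
  induction N generalizing m f g with
  | zero => exact key hf hg
  | succ N ih =>
    refine ⟨key hf.1 hg.1, fun j => ?_, fun j => ?_⟩
    · rw [partialX_eq, dirD_add _ (smooth_differentiable sf) (smooth_differentiable sg)]
      exact ih (hf.2.1 j) (hg.2.1 j) (smooth_dirD _ sf) (smooth_dirD _ sg)
    · rw [partialXi_eq, dirD_add _ (smooth_differentiable sf) (smooth_differentiable sg)]
      exact ih (hf.2.2 j) (hg.2.2 j) (smooth_dirD _ sf) (smooth_dirD _ sg)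

lemma SymAt.neg {N : ℕ} {m A : ℝ} {z : Phase n} (hf : SymAt N m A f z) :
    SymAt N m A (fun z => -f z) z := by
  induction N generalizing m f with
  | zero => simpa [SymAt] using hf
  | succ N ih =>
    refine ⟨by simpa using hf.1, fun j => ?_, fun j => ?_⟩
    · rw [partialX_eq, dirD_neg]; exact ih (hf.2.1 j)
    · rw [partialXi_eq, dirD_neg]; exact ih (hf.2.2 j)

lemma SymAt.conj {N : ℕ} {m A : ℝ} {z : Phase n} (hf : SymAt N m A f z) (sf : ContDiff ℝ ∞ f) :
    SymAt N m A (fun z => (starRingEnd ℂ) (f z)) z := by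
  induction N generalizing m f with
  | zero => simpa [SymAt] using hf
  | succ N ih =>
    refine ⟨by simpa using hf.1, fun j => ?_, fun j => ?_⟩
    · rw [partialX_eq, dirD_conj _ (smooth_differentiable sf)]
      exact ih (hf.2.1 j) (smooth_dirD _ sf)
    · rw [partialXi_eq, dirD_conj _ (smooth_differentiable sf)]
      exact ih (hf.2.2 j) (smooth_dirD _ sf)

lemma symAt_zero (N : ℕ) (m : ℝ) {A : ℝ} (hA : 0 ≤ A) (z : Phase n) :
    SymAt N m A (fun _ => 0) z := by
  induction N generalizing m with
  | zero => simpa [SymAt] using mul_nonneg hA (bracket_rpow_pos _ _).le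
  | succ N ih =>
    refine ⟨by simpa using mul_nonneg hA (bracket_rpow_pos _ _).le, fun j => ?_, fun j => ?_⟩
    · rw [partialX_eq, dirD_const]; exact ih _
    · rw [partialXi_eq, dirD_const]; exact ih _

lemma symAt_const (N : ℕ) (c : ℂ) (z : Phase n) : SymAt N 0 ‖c‖ (fun _ => c) z := by
  cases N with
  | zero => simp [SymAt]
  | succ N =>
    refine ⟨by simp, fun j => ?_, fun j => ?_⟩
    · rw [partialX_eq, dirD_const]; exact symAt_zero _ _ (norm_nonneg _) _
    · rw [partialXi_eq, dirD_const]; exact symAt_zero _ _ (norm_nonneg _) _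

lemma SymAt.mul {N : ℕ} {m₁ m₂ A B : ℝ} {z : Phase n} (hf : SymAt N m₁ A f z)
    (hg : SymAt N m₂ B g z) (sf : ContDiff ℝ ∞ f) (sg : ContDiff ℝ ∞ g) :
    SymAt N (m₁ + m₂) (2 ^ N * (A * B)) (fun z => f z * g z) z := by
  have hA := hf.nonneg
  have hB := hg.nonneg
  have key : ∀ {m₁ m₂ : ℝ} {f g : Phase n → ℂ} (N : ℕ), ‖f z‖ ≤ A * bracket z.2 ^ m₁ →
      ‖g z‖ ≤ B * bracket z.2 ^ m₂ →
      ‖f z * g z‖ ≤ (2 ^ N * (A * B)) * bracket z.2 ^ (m₁ + m₂) := by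
    intro m₁ m₂ f g N h1 h2
    have h3 := bracket_rpow_pos z.2 m₁
    have h4 := bracket_rpow_pos z.2 m₂
    calc ‖f z * g z‖ ≤ (A * bracket z.2 ^ m₁) * (B * bracket z.2 ^ m₂) := by
          rw [norm_mul]; gcongr
      _ = 1 * (A * B) * bracket z.2 ^ (m₁ + m₂) := by rw [bracket_rpow_add]; ring
      _ ≤ _ := by
        have := bracket_rpow_pos z.2 (m₁ + m₂)
        gcongr
        exact one_le_pow₀ one_le_two
  induction N generalizing m₁ m₂ f g with
  | zero => exact key 0 hf hg
  | succ N ih =>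
    have e : (2 : ℝ) ^ (N + 1) * (A * B) = 2 ^ N * (A * B) + 2 ^ N * (A * B) := by ring
    refine ⟨key _ hf.1 hg.1, fun j => ?_, fun j => ?_⟩
    · rw [partialX_eq, dirD_mul _ (smooth_differentiable sf) (smooth_differentiable sg), e]
      exact (ih (hf.2.1 j) hg.of_succ (smooth_dirD _ sf) sg).add
        (ih hf.of_succ (hg.2.1 j) sf (smooth_dirD _ sg))
        ((smooth_dirD _ sf).mul sg) (sf.mul (smooth_dirD _ sg))
    · rw [partialXi_eq, dirD_mul _ (smooth_differentiable sf) (smooth_differentiable sg), e]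
      have h1 := ih (hf.2.2 j) hg.of_succ (smooth_dirD _ sf) sg
      have h2 := ih hf.of_succ (hg.2.2 j) sf (smooth_dirD _ sg)
      refine (h1.mono le_rfl (by linarith)).add (h2.mono le_rfl (by linarith))
        ((smooth_dirD _ sf).mul sg) (sf.mul (smooth_dirD _ sg))

lemma SymAt.const_mul {N : ℕ} {m A : ℝ} {z : Phase n} (hf : SymAt N m A f z) (c : ℂ)
    (sf : ContDiff ℝ ∞ f) : SymAt N m (‖c‖ * A) (fun z => c * f z) z := by
  have key : ∀ {m : ℝ} {f : Phase n → ℂ}, ‖f z‖ ≤ A * bracket z.2 ^ m →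
      ‖c * f z‖ ≤ (‖c‖ * A) * bracket z.2 ^ m := by
    intro m f h
    rw [norm_mul, mul_assoc]; gcongr
  induction N generalizing m f with
  | zero => exact key hf
  | succ N ih =>
    refine ⟨key hf.1, fun j => ?_, fun j => ?_⟩
    · rw [partialX_eq, dirD_const_mul _ _ (smooth_differentiable sf)]
      exact ih (hf.2.1 j) (smooth_dirD _ sf)
    · rw [partialXi_eq, dirD_const_mul _ _ (smooth_differentiable sf)]
      exact ih (hf.2.2 j) (smooth_dirD _ sf)

/-- The reciprocal of an elliptic symbol is a symbol. The seminorms are bounded by a polynomial in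
the seminorms of `f` and the inverse `s` of the ellipticity constant; this follows by induction from
`∂(1/f) = -(1/f) (1/f) ∂f`. -/
lemma symB_inv (N : ℕ) : ∃ C : ℝ, 1 ≤ C ∧ ∃ k : ℕ, ∀ {m A s : ℝ} {f : Phase n → ℂ},
    1 ≤ A → 1 ≤ s → ContDiff ℝ ∞ f → SymB N m A f → (∀ z, bracket z.2 ^ m ≤ s * ‖f z‖) →
    SymB N (-m) (C * (s * A) ^ k) (fun z => (f z)⁻¹) := by
  have key : ∀ {m A s : ℝ} {f : Phase n → ℂ}, 1 ≤ A → 1 ≤ s →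
      (∀ z, bracket z.2 ^ m ≤ s * ‖f z‖) → ∀ (C : ℝ) (k : ℕ), 1 ≤ C → 1 ≤ k →
      ∀ z, (f z) ≠ 0 ∧ ‖(f z)⁻¹‖ ≤ (C * (s * A) ^ k) * bracket z.2 ^ (-m) := by
    intro m A s f hA hs he C k hC hk z
    have hb := bracket_rpow_pos z.2 m
    have hpos : 0 < ‖f z‖ := by
      by_contra hc
      have : ‖f z‖ = 0 := le_antisymm (not_lt.1 hc) (norm_nonneg _)
      have h1 := he z
      rw [this, mul_zero] at h1
      linarith
    refine ⟨norm_pos_iff.1 hpos, ?_⟩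
    have h1 : s ≤ C * (s * A) ^ k := by
      have hsA : 1 ≤ s * A := one_le_mul_of_one_le_of_one_le hs hA
      calc s ≤ s * A := le_mul_of_one_le_right (by linarith) hA
        _ = 1 * (s * A) ^ 1 := by ring
        _ ≤ C * (s * A) ^ k := by gcongr
    rw [norm_inv, Real.rpow_neg (bracket_pos _).le, ← div_eq_mul_inv, inv_eq_one_div,
      div_le_div_iff₀ hpos hb, one_mul]
    exact (he z).trans (by gcongr)
  suffices h : ∃ C : ℝ, 1 ≤ C ∧ ∃ k : ℕ, 1 ≤ k ∧ ∀ {m A s : ℝ} {f : Phase n → ℂ},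
    1 ≤ A → 1 ≤ s → ContDiff ℝ ∞ f → SymB N m A f → (∀ z, bracket z.2 ^ m ≤ s * ‖f z‖) →
    SymB N (-m) (C * (s * A) ^ k) (fun z => (f z)⁻¹) by
    obtain ⟨C, hC, k, -, h⟩ := h
    exact ⟨C, hC, k, h⟩
  induction N with
  | zero =>
    refine ⟨1, le_rfl, 1, le_rfl, ?_⟩
    intro m A s f hA hs _ _ he z
    exact (key hA hs he 1 1 le_rfl le_rfl z).2
  | succ N ih =>
    obtain ⟨C, hC, k, hk, ih⟩ := ih
    have hC' : 1 ≤ 2 ^ N * (2 ^ N * (C * C)) :=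
      one_le_mul_of_one_le_of_one_le (one_le_pow₀ one_le_two)
        (one_le_mul_of_one_le_of_one_le (one_le_pow₀ one_le_two)
          (one_le_mul_of_one_le_of_one_le hC hC))
    refine ⟨2 ^ N * (2 ^ N * (C * C)), hC', 2 * k + 1, by omega, ?_⟩
    intro m A s f hA hs sf hf he
    have h0 : ∀ z, f z ≠ 0 := fun z => (key hA hs he 1 1 le_rfl le_rfl z).1
    have si : ContDiff ℝ ∞ fun z => (f z)⁻¹ := sf.inv h0
    have hi := ih hA hs sf (hf.of_le N.le_succ) he
    have hsA : 1 ≤ s * A := one_le_mul_of_one_le_of_one_le hs hA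
    rw [symB_succ] at hf ⊢
    have hle : 2 ^ N * (2 ^ N * ((C * (s * A) ^ k) * (C * (s * A) ^ k)) * A) ≤
        2 ^ N * (2 ^ N * (C * C)) * (s * A) ^ (2 * k + 1) := by
      have e : 2 ^ N * (2 ^ N * (C * C)) * (s * A) ^ (2 * k + 1) =
        2 ^ N * (2 ^ N * ((C * (s * A) ^ k) * (C * (s * A) ^ k)) * (s * A)) := by ring
      rw [e]
      have : A ≤ s * A := le_mul_of_one_le_left (by linarith) hs
      gcongr
    refine ⟨fun z => (key hA hs he _ _ hC' (by omega) z).2, fun j z => ?_, fun j z => ?_⟩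
    · rw [partialX_eq, dirD_inv _ (smooth_differentiable sf) h0]
      exact (((hi z).mul (hi z) si si).neg.mul (hf.2.1 j z) (si.mul si).neg
        (smooth_dirD _ sf)).mono hle (by linarith)
    · rw [partialXi_eq, dirD_inv _ (smooth_differentiable sf) h0]
      exact (((hi z).mul (hi z) si si).neg.mul (hf.2.2 j z) (si.mul si).neg
        (smooth_dirD _ sf)).mono hle (by linarith)

/-- By Peetre's inequality, the translate of a symbol by `ξ₀` is `O(⟨ξ₀⟩ ^ m)` as a symbol of an
order `s ≥ 0` that does not depend on `ξ₀`. -/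
lemma SymB.translate {N : ℕ} {m s A : ℝ} (hf : SymB N m A f) (hs : |m| + 2 * N ≤ s)
    (ξ₀ : RSpace n) :
    SymB N s (2 ^ (|m| + N) * A * bracket ξ₀ ^ m) (fun z => f (z + (0, ξ₀))) := by
  have hA := hf.nonneg
  have key : ∀ {N : ℕ} {m s : ℝ} {f : Phase n → ℂ}, (∀ z, ‖f z‖ ≤ A * bracket z.2 ^ m) →
      |m| + 2 * N ≤ s → ∀ z : Phase n, ‖f (z + (0, ξ₀))‖ ≤
        2 ^ (|m| + N) * A * bracket ξ₀ ^ m * bracket z.2 ^ s := by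
    intro N m s f h hs z
    have h1 := h (z + (0, ξ₀))
    have h2 := bracket_add_rpow_le m ξ₀ z.2
    have h3 : (z + (0, ξ₀)).2 = ξ₀ + z.2 := by simp [add_comm]
    rw [h3] at h1
    have h4 := bracket_rpow_pos ξ₀ m
    have h5 := bracket_rpow_pos z.2 |m|
    calc ‖f (z + (0, ξ₀))‖ ≤ A * (2 ^ |m| * bracket ξ₀ ^ m * bracket z.2 ^ |m|) :=
          h1.trans (by gcongr)
      _ = 2 ^ |m| * A * bracket ξ₀ ^ m * bracket z.2 ^ |m| := by ring
      _ ≤ _ := by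
        have hN : (0 : ℝ) ≤ N := N.cast_nonneg
        gcongr
        · exact one_le_two
        · linarith
        · exact one_le_bracket _
        · linarith
  induction N generalizing m s f with
  | zero => exact key (fun z => hf z) hs
  | succ N ih =>
    rw [symB_succ] at hf ⊢
    have hN : (0 : ℝ) ≤ N := N.cast_nonneg
    push_cast at hs
    refine ⟨fun z => ?_, fun j => ?_, fun j => ?_⟩
    · have := key (N := N + 1) hf.1 (by push_cast; exact hs) z
      simpa using this
    · rw [partialX_eq, dirD_comp_add_right]
      refine (ih (s := s) (hf.2.1 j) (by linarith)).mono ?_ le_rfl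
      have := bracket_rpow_pos ξ₀ m
      gcongr
      · exact one_le_two
      · linarith
    · rw [partialXi_eq, dirD_comp_add_right]
      have hm : |m - 1| ≤ |m| + 1 := by
        have := abs_sub m 1; simpa using this
      refine (ih (s := s - 1) (hf.2.2 j) (by linarith)).mono ?_ le_rfl
      have h1 := bracket_rpow_le (show m - 1 ≤ m by linarith) ξ₀
      have h2 : (2 : ℝ) ^ (|m - 1| + N) ≤ 2 ^ (|m| + (N + 1 : ℕ)) :=
        Real.rpow_le_rpow_of_exponent_le one_le_two (by push_cast; linarith)
      have := bracket_rpow_pos ξ₀ (m - 1)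
      exact mul_le_mul (mul_le_mul_of_nonneg_right h2 hA) h1 this.le (by positivity)

/-! ### Symbols and iterated derivatives -/

lemma smooth_foldr_partialX (J : List (Fin n)) (hf : ContDiff ℝ ∞ f) :
    ContDiff ℝ ∞ (J.foldr partialX f) := by
  induction J with
  | nil => exact hf
  | cons j J ih => exact smooth_partialX j ih

/-- Derivatives in `x` commute with derivatives in `ξ`. -/
lemma foldr_partialX_partialXi (i : Fin n) (J : List (Fin n)) (hf : ContDiff ℝ ∞ f) :
    J.foldr partialX (partialXi i f) = partialXi i (J.foldr partialX f) := by
  induction J with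
  | nil => rfl
  | cons j J ih =>
    rw [List.foldr_cons, ih, List.foldr_cons]
    exact dirD_comm _ _ (smooth_foldr_partialX J hf)

lemma mixedDeriv_partialXi (I J : List (Fin n)) (i : Fin n) (hf : ContDiff ℝ ∞ f) :
    mixedDeriv I J (partialXi i f) = mixedDeriv (I ++ [i]) J f := by
  simp [mixedDeriv, foldr_partialX_partialXi i J hf]

lemma mixedDeriv_partialX (I J : List (Fin n)) (j : Fin n) :
    mixedDeriv I J (partialX j f) = mixedDeriv I (J ++ [j]) f := by
  simp [mixedDeriv]

/-- The recursive estimates contain those of the mixed derivatives. -/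
lemma SymAt.mixedDeriv_le {N : ℕ} {m A : ℝ} {z : Phase n} (h : SymAt N m A f z)
    (I J : List (Fin n)) (hN : I.length + J.length ≤ N) :
    ‖mixedDeriv I J f z‖ ≤ A * bracket z.2 ^ (m - (I.length : ℝ)) := by
  induction N generalizing m f I J with
  | zero =>
    obtain ⟨h1, h2⟩ : I = [] ∧ J = [] := by
      constructor <;> exact List.length_eq_zero_iff.1 (by omega)
    subst h1 h2
    simpa [mixedDeriv] using h.bound
  | succ N ih =>
    rcases J.eq_nil_or_concat with hJ | ⟨J', j, hJ⟩
    · subst hJ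
      rcases I.eq_nil_or_concat with hI | ⟨I', i, hI⟩
      · subst hI
        simpa [mixedDeriv] using h.bound
      · subst hI
        have e : mixedDeriv (I' ++ [i]) [] f = mixedDeriv I' [] (partialXi i f) := by
          simp [mixedDeriv]
        simp only [List.concat_eq_append] at hN ⊢
        rw [e]
        have := ih (h.2.2 i) I' [] (by simp at hN ⊢; omega)
        refine this.trans (le_of_eq ?_)
        congr 2; simp; ring
    · subst hJ
      simp only [List.concat_eq_append] at hN ⊢
      rw [← mixedDeriv_partialX]
      exact ih (h.2.1 j) I J' (by simp at hN ⊢; omega)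

/-- Conversely, since the partial derivatives of a smooth function commute, the estimates of the
mixed derivatives give the recursive ones. -/
lemma symAt_of_mixedDeriv_le {N : ℕ} {m A : ℝ} {z : Phase n} (hf : ContDiff ℝ ∞ f)
    (h : ∀ I J : List (Fin n), I.length + J.length ≤ N →
      ‖mixedDeriv I J f z‖ ≤ A * bracket z.2 ^ (m - (I.length : ℝ))) : SymAt N m A f z := by
  have h0 : ‖f z‖ ≤ A * bracket z.2 ^ m := by
    simpa [mixedDeriv] using h [] [] (by simp)
  induction N generalizing m f with
  | zero => exact h0
  | succ N ih =>
    have hX : ∀ j, ∀ I J : List (Fin n), I.length + J.length ≤ N →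
        ‖mixedDeriv I J (partialX j f) z‖ ≤ A * bracket z.2 ^ (m - (I.length : ℝ)) := by
      intro j I J hIJ
      rw [mixedDeriv_partialX]
      exact h I (J ++ [j]) (by simp; omega)
    have hXi : ∀ j, ∀ I J : List (Fin n), I.length + J.length ≤ N →
        ‖mixedDeriv I J (partialXi j f) z‖ ≤ A * bracket z.2 ^ (m - 1 - (I.length : ℝ)) := by
      intro j I J hIJ
      rw [mixedDeriv_partialXi _ _ _ hf]
      refine (h (I ++ [j]) J (by simp; omega)).trans (le_of_eq ?_)
      congr 2; simp; ring
    refine ⟨h0, fun j => ih (smooth_partialX j hf) (hX j) ?_,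
      fun j => ih (smooth_partialXi j hf) (hXi j) ?_⟩
    · simpa [mixedDeriv] using hX j [] [] (by simp)
    · simpa [mixedDeriv] using hXi j [] [] (by simp)

/-- The symbol class `S^m`, in terms of the recursive estimates `SymB`. -/
def Symb (m : ℝ) (f : Phase n → ℂ) : Prop := ContDiff ℝ ∞ f ∧ ∀ N, ∃ A, SymB N m A f

lemma finite_lists_length_le (n N : ℕ) :
    {p : List (Fin n) × List (Fin n) | p.1.length + p.2.length ≤ N}.Finite := by
  refine ((List.finite_length_le (Fin n) N).prod (List.finite_length_le (Fin n) N)).subset ?_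
  rintro ⟨I, J⟩ h
  simp only [Set.mem_ofPred_eq] at h
  exact ⟨by simp only [Set.mem_ofPred_eq]; omega, by simp only [Set.mem_ofPred_eq]; omega⟩

lemma isSymbol_iff_symb {m : ℝ} : IsSymbol m f ↔ Symb m f := by
  constructor
  · rintro ⟨hs, h⟩
    refine ⟨hs, fun N => ?_⟩
    choose C hC using h
    refine ⟨∑ p ∈ (finite_lists_length_le n N).toFinset, |C p.1 p.2|, fun z => ?_⟩
    refine symAt_of_mixedDeriv_le hs fun I J hIJ => (hC I J z.1 z.2).trans ?_
    have := bracket_rpow_pos z.2 (m - (I.length : ℝ))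
    gcongr
    refine (le_abs_self _).trans (Finset.single_le_sum
      (f := fun p : List (Fin n) × List (Fin n) => |C p.1 p.2|) (fun _ _ => abs_nonneg _)
      (a := (I, J)) ?_)
    simpa using hIJ
  · rintro ⟨hs, h⟩
    refine ⟨hs, fun I J => ?_⟩
    obtain ⟨A, hA⟩ := h (I.length + J.length)
    exact ⟨A, fun x ξ => (hA (x, ξ)).mixedDeriv_le I J le_rfl⟩

namespace Symb

variable {m m₁ m₂ : ℝ}

lemma differentiable (hf : Symb m f) : Differentiable ℝ f := smooth_differentiable hf.1

lemma continuous (hf : Symb m f) : Continuous f := hf.1.continuous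

lemma mono (hf : Symb m₁ f) (h : m₁ ≤ m₂) : Symb m₂ f :=
  ⟨hf.1, fun N => let ⟨A, hA⟩ := hf.2 N; ⟨A, hA.mono le_rfl h⟩⟩

lemma add (hf : Symb m f) (hg : Symb m g) : Symb m (fun z => f z + g z) :=
  ⟨hf.1.add hg.1, fun N => let ⟨A, hA⟩ := hf.2 N; let ⟨B, hB⟩ := hg.2 N
    ⟨A + B, fun z => (hA z).add (hB z) hf.1 hg.1⟩⟩

lemma neg (hf : Symb m f) : Symb m (fun z => -f z) :=
  ⟨hf.1.neg, fun N => let ⟨A, hA⟩ := hf.2 N; ⟨A, fun z => (hA z).neg⟩⟩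

lemma sub (hf : Symb m f) (hg : Symb m g) : Symb m (fun z => f z - g z) := by
  simpa only [sub_eq_add_neg] using hf.add hg.neg

lemma const (c : ℂ) : Symb 0 (fun _ : Phase n => c) :=
  ⟨contDiff_const, fun N => ⟨‖c‖, symAt_const N c⟩⟩

lemma zero (m : ℝ) : Symb m (fun _ : Phase n => 0) :=
  ⟨contDiff_const, fun N => ⟨0, symAt_zero N m le_rfl⟩⟩

lemma mul (hf : Symb m₁ f) (hg : Symb m₂ g) : Symb (m₁ + m₂) (fun z => f z * g z) :=
  ⟨hf.1.mul hg.1, fun N => let ⟨_, hA⟩ := hf.2 N; let ⟨_, hB⟩ := hg.2 N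
    ⟨_, fun z => (hA z).mul (hB z) hf.1 hg.1⟩⟩

lemma const_mul (c : ℂ) (hf : Symb m f) : Symb m (fun z => c * f z) :=
  ⟨contDiff_const.mul hf.1, fun N => let ⟨_, hA⟩ := hf.2 N; ⟨_, fun z => (hA z).const_mul c hf.1⟩⟩

lemma sum {ι : Type*} (s : Finset ι) {F : ι → Phase n → ℂ} (hF : ∀ i ∈ s, Symb m (F i)) :
    Symb m (fun z => ∑ i ∈ s, F i z) := by
  classical
  induction s using Finset.induction_on with
  | empty => simpa using zero m
  | insert a s ha ih =>
    simp only [Finset.sum_insert ha]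
    exact (hF a (by simp)).add (ih fun i hi => hF i (by simp [hi]))

lemma partialX (j : Fin n) (hf : Symb m f) : Symb m (partialX j f) :=
  ⟨smooth_partialX j hf.1, fun N => let ⟨A, hA⟩ := hf.2 (N + 1); ⟨A, (symB_succ.1 hA).2.1 j⟩⟩

lemma partialXi (j : Fin n) (hf : Symb m f) : Symb (m - 1) (partialXi j f) :=
  ⟨smooth_partialXi j hf.1, fun N => let ⟨A, hA⟩ := hf.2 (N + 1); ⟨A, (symB_succ.1 hA).2.2 j⟩⟩

/-- Translation in `ξ` preserves the order. In contrast to `SymB.translate` the bounds depend on the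
translation. -/
lemma translate (hf : Symb m f) (ξ₀ : RSpace n) : Symb m (fun z => f (z + (0, ξ₀))) := by
  refine ⟨hf.1.comp (contDiff_id.add contDiff_const), fun N => ?_⟩
  obtain ⟨A, hA⟩ := hf.2 N
  have hA0 := hA.nonneg
  refine ⟨2 ^ (|m| + N) * A * bracket ξ₀ ^ (|m| + N), ?_⟩
  have key : ∀ {N : ℕ} {m : ℝ} {f : Phase n → ℂ}, (∀ z, ‖f z‖ ≤ A * bracket z.2 ^ m) →
      ∀ z : Phase n, ‖f (z + (0, ξ₀))‖ ≤
        2 ^ (|m| + N) * A * bracket ξ₀ ^ (|m| + N) * bracket z.2 ^ m := by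
    intro N m f h z
    have h1 := h (z + (0, ξ₀))
    have h2 := bracket_add_rpow_le m z.2 ξ₀
    rw [Prod.snd_add] at h1
    have h4 := bracket_rpow_pos z.2 m
    have h5 := bracket_rpow_pos ξ₀ |m|
    have hN : (0 : ℝ) ≤ N := N.cast_nonneg
    calc ‖f (z + (0, ξ₀))‖ ≤ A * (2 ^ |m| * bracket z.2 ^ m * bracket ξ₀ ^ |m|) :=
          h1.trans (by gcongr)
      _ = 2 ^ |m| * A * bracket ξ₀ ^ |m| * bracket z.2 ^ m := by ring
      _ ≤ _ := by
        gcongr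
        · exact one_le_two
        · linarith
        · exact one_le_bracket _
        · linarith
  have hc : ∀ {m m' : ℝ} {N N' : ℕ}, |m| + N ≤ |m'| + N' →
      2 ^ (|m| + N) * A * bracket ξ₀ ^ (|m| + N) ≤
        2 ^ (|m'| + N') * A * bracket ξ₀ ^ (|m'| + N') := by
    intro m m' N N' h
    have h1 := bracket_rpow_pos ξ₀ (|m| + N)
    have h2 := bracket_rpow_le h ξ₀
    gcongr
    exact one_le_two
  have h' := hA
  clear hA hf
  induction N generalizing m f with
  | zero => exact key (fun z => h' z)
  | succ N ih =>
    rw [symB_succ] at h' ⊢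
    refine ⟨fun z => key h'.1 z, fun j => ?_, fun j => ?_⟩
    · rw [partialX_eq, dirD_comp_add_right]
      exact (ih (h'.2.1 j)).mono (hc (by push_cast; linarith)) le_rfl
    · rw [partialXi_eq, dirD_comp_add_right]
      have hm : |m - 1| ≤ |m| + 1 := by
        have := abs_sub m 1; simpa using this
      exact (ih (h'.2.2 j)).mono (hc (by push_cast; linarith)) le_rfl

end Symb

/-! ### Fourier transforms in the fibre variable -/

lemma integrable_bracket_rpow {s : ℝ} (hs : s < -(n : ℝ)) :
    Integrable fun η : RSpace n => bracket η ^ s := by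
  have h := integrable_rpow_neg_one_add_norm_sq (μ := (volume : Measure (RSpace n))) (r := -s)
    (by simpa using (by linarith : (n : ℝ) < -s))
  refine h.congr (Eventually.of_forall fun η => ?_)
  simp only [bracket, Real.sqrt_eq_rpow]
  rw [← Real.rpow_mul (by positivity)]
  congr 1; ring

lemma bracket_decay_integrable (n : ℕ) :
    Integrable fun η : RSpace n => bracket η ^ (-((n : ℝ) + 1)) :=
  integrable_bracket_rpow (by linarith)

lemma norm_exp_I_inner (x ξ : RSpace n) :
    ‖Complex.exp (Complex.I * ((inner ℝ x ξ : ℝ) : ℂ))‖ = 1 := by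
  rw [mul_comm]; exact Complex.norm_exp_ofReal_mul_I _

lemma norm_exp_neg_I_inner (x ξ : RSpace n) :
    ‖Complex.exp (-(Complex.I * ((inner ℝ x ξ : ℝ) : ℂ)))‖ = 1 := by
  have := norm_exp_I_inner (-x) ξ
  simpa using this

/-- A continuous function on phase space that is bounded by `A ⟨ξ⟩ ^ m` with `m < -n` is integrable
in `ξ`. -/
lemma integrable_slice {m A : ℝ} (hf : Continuous f) (hm : m < -(n : ℝ))
    (hb : ∀ z : Phase n, ‖f z‖ ≤ A * bracket z.2 ^ m) (x : RSpace n) :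
    Integrable fun η => f (x, η) :=
  ((integrable_bracket_rpow hm).const_mul A).mono'
    (hf.comp (by fun_prop)).aestronglyMeasurable
    (Eventually.of_forall fun η => hb (x, η))

lemma Symb.integrable {m : ℝ} (hf : Symb m f) (hm : m < -(n : ℝ)) (x : RSpace n) :
    Integrable fun η => f (x, η) :=
  let ⟨_, hA⟩ := hf.2 0
  integrable_slice hf.continuous hm (fun z => hA z) x

lemma integrable_exp_mul {u : RSpace n → ℂ} (hu : Integrable u) (y : RSpace n) :
    Integrable fun η => Complex.exp (-(Complex.I * ((inner ℝ η y : ℝ) : ℂ))) * u η := by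
  refine hu.bdd_mul (c := 1) ?_ (Eventually.of_forall fun η => (norm_exp_neg_I_inner η y).le)
  exact (by fun_prop : Continuous fun η : RSpace n =>
    Complex.exp (-(Complex.I * ((inner ℝ η y : ℝ) : ℂ)))).aestronglyMeasurable

lemma norm_fourierHat_le {u : RSpace n → ℂ} {b : RSpace n → ℝ} (hb : Integrable b)
    (h : ∀ η, ‖u η‖ ≤ b η) (y : RSpace n) : ‖fourierHat u y‖ ≤ ∫ η, b η := by
  refine norm_integral_le_of_norm_le hb (Eventually.of_forall fun η => ?_)
  rw [norm_mul, norm_exp_neg_I_inner, one_mul]; exact h η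

lemma continuous_fourierHat {u : RSpace n → ℂ} (hu : Integrable u) :
    Continuous (fourierHat u) := by
  refine continuous_of_dominated (F := fun y η =>
    Complex.exp (-(Complex.I * ((inner ℝ η y : ℝ) : ℂ))) * u η) (bound := fun η => ‖u η‖)
    (fun y => (integrable_exp_mul hu y).aestronglyMeasurable) ?_ hu.norm ?_
  · intro y
    refine Eventually.of_forall fun η => ?_
    rw [norm_mul, norm_exp_neg_I_inner, one_mul]
  · exact Eventually.of_forall fun η => by fun_prop

lemma fourierHat_add {u v : RSpace n → ℂ} (hu : Integrable u) (hv : Integrable v) (y : RSpace n) :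
    fourierHat (fun η => u η + v η) y = fourierHat u y + fourierHat v y := by
  simp only [fourierHat, mul_add]
  exact integral_add (integrable_exp_mul hu y) (integrable_exp_mul hv y)

lemma fourierHat_const_mul (c : ℂ) (u : RSpace n → ℂ) (y : RSpace n) :
    fourierHat (fun η => c * u η) y = c * fourierHat u y := by
  simp only [fourierHat]
  rw [← integral_const_mul]
  congr 1; funext η; ring

lemma fourierHat_neg (u : RSpace n → ℂ) (y : RSpace n) :
    fourierHat (fun η => - u η) y = - fourierHat u y := by
  simpa using fourierHat_const_mul (-1) u y

lemma fourierHat_sub {u v : RSpace n → ℂ} (hu : Integrable u) (hv : Integrable v) (y : RSpace n) :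
    fourierHat (fun η => u η - v η) y = fourierHat u y - fourierHat v y := by
  simp only [sub_eq_add_neg]
  exact (fourierHat_add hu hv.neg y).trans (by rw [← fourierHat_neg]; rfl)

lemma fourierHat_sum {ι : Type*} (s : Finset ι) {u : ι → RSpace n → ℂ}
    (hu : ∀ i ∈ s, Integrable (u i)) (y : RSpace n) :
    fourierHat (fun η => ∑ i ∈ s, u i η) y = ∑ i ∈ s, fourierHat (u i) y := by
  simp only [fourierHat, Finset.mul_sum]
  exact integral_finsetSum _ fun i hi => integrable_exp_mul (hu i hi) y

lemma fderiv_slice_snd (hf : Differentiable ℝ f) (x η v : RSpace n) :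
    fderiv ℝ (fun η => f (x, η)) η v = fderiv ℝ f (x, η) (0, v) := by
  have h1 : HasFDerivAt (fun η : RSpace n => ((x, η) : Phase n))
      (ContinuousLinearMap.inr ℝ (RSpace n) (RSpace n)) η := hasFDerivAt_prodMk_right x η
  have := ((hf (x, η)).hasFDerivAt.comp η h1).fderiv
  change fderiv ℝ (f ∘ fun η => (x, η)) η v = _
  rw [this]; rfl

lemma fderiv_slice_fst (hf : Differentiable ℝ f) (x ξ y v : RSpace n) :
    fderiv ℝ (fun y => f (x + y, ξ)) y v = fderiv ℝ f (x + y, ξ) (v, 0) := by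
  have h1 : HasFDerivAt (fun y : RSpace n => ((x + y, ξ) : Phase n))
      (ContinuousLinearMap.inl ℝ (RSpace n) (RSpace n)) y := by
    exact ((hasFDerivAt_id (𝕜 := ℝ) y).const_add x).prodMk (hasFDerivAt_const ξ y)
  have := ((hf (x + y, ξ)).hasFDerivAt.comp y h1).fderiv
  change fderiv ℝ (f ∘ fun y => (x + y, ξ)) y v = _
  rw [this]; rfl

lemma hasFDerivAt_exp_inner (y η : RSpace n) :
    HasFDerivAt (fun η : RSpace n => Complex.exp (-(Complex.I * ((inner ℝ η y : ℝ) : ℂ))))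
      (Complex.exp (-(Complex.I * ((inner ℝ η y : ℝ) : ℂ))) •
        (-(Complex.I • (Complex.ofRealCLM ∘L (innerSL ℝ y))))) η := by
  have h1 : HasFDerivAt (fun η : RSpace n => ((inner ℝ η y : ℝ) : ℂ))
      (Complex.ofRealCLM ∘L (innerSL ℝ y)) η := by
    have := (Complex.ofRealCLM ∘L (innerSL ℝ y)).hasFDerivAt (x := η)
    refine this.congr_of_eventuallyEq (Eventually.of_forall fun w => ?_)
    simp [real_inner_comm]
  exact ((h1.const_mul Complex.I).neg).cexp

lemma fourierHat_fderiv {u : RSpace n → ℂ} (hu : Differentiable ℝ u) (hi : Integrable u)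
    (j : Fin n) (hi' : Integrable fun η => fderiv ℝ u η (EuclideanSpace.single j 1))
    (y : RSpace n) :
    fourierHat (fun η => fderiv ℝ u η (EuclideanSpace.single j 1)) y =
      Complex.I * (y j : ℂ) * fourierHat u y := by
  have hE : ∀ η : RSpace n, fderiv ℝ (fun η : RSpace n =>
      Complex.exp (-(Complex.I * ((inner ℝ η y : ℝ) : ℂ)))) η (EuclideanSpace.single j 1) =
      -(Complex.I * (y j : ℂ)) * Complex.exp (-(Complex.I * ((inner ℝ η y : ℝ) : ℂ))) := by
    intro η
    rw [(hasFDerivAt_exp_inner y η).fderiv]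
    simp [EuclideanSpace.inner_single_right]
    ring
  have key := integral_mul_fderiv_eq_neg_fderiv_mul_of_integrable (μ := volume)
    (f := fun η : RSpace n => Complex.exp (-(Complex.I * ((inner ℝ η y : ℝ) : ℂ))))
    (g := u) (v := EuclideanSpace.single j 1)
    (by
      simp only [hE, mul_assoc]
      exact (integrable_exp_mul hi y).const_mul _)
    (integrable_exp_mul hi' y) (integrable_exp_mul hi y)
    (fun η _ => (hasFDerivAt_exp_inner y η).differentiableAt) (fun η _ => hu η)
  simp only [hE] at key
  simp only [fourierHat]
  rw [key, ← integral_neg, ← integral_const_mul]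
  congr 1; funext η; ring

lemma fourierHat_partialXi {m : ℝ} (hf : Symb m f) (hm : m < -(n : ℝ)) (x y : RSpace n)
    (j : Fin n) :
    fourierHat (fun η => partialXi j f (x, η)) y =
      Complex.I * (y j : ℂ) * fourierHat (fun η => f (x, η)) y := by
  have hF : (fun η => partialXi j f (x, η)) =
      fun η => fderiv ℝ (fun η => f (x, η)) η (EuclideanSpace.single j 1) :=
    funext fun η => (fderiv_slice_snd hf.differentiable x η _).symm
  have hi' := (hf.partialXi j).integrable (by linarith) x
  rw [hF] at hi' ⊢
  exact fourierHat_fderiv (hf.differentiable.comp (by fun_prop)) (hf.integrable hm x) j hi' y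

lemma norm_le_sum_abs (y : RSpace n) : ‖y‖ ≤ ∑ j, |y j| := by
  have h : ∑ j, y j • EuclideanSpace.single j (1 : ℝ) = y := by
    have := (EuclideanSpace.basisFun (Fin n) ℝ).sum_repr y
    simpa using this
  calc ‖y‖ = ‖∑ j, y j • EuclideanSpace.single j (1 : ℝ)‖ := by rw [h]
    _ ≤ ∑ j, ‖y j • EuclideanSpace.single j (1 : ℝ)‖ := norm_sum_le _ _
    _ = _ := by simp [norm_smul]

/-- Multiplication by a coordinate amounts to differentiation of the symbol, which lowers the order,
so that integrability is never lost. -/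
lemma abs_coord_pow_mul_fourierHat_le (N : ℕ) {m A : ℝ} (hs : Symb m f)
    (hm : m ≤ -((n : ℝ) + 1)) (hf : SymB N m A f) (x y : RSpace n) (j : Fin n) :
    |y j| ^ N * ‖fourierHat (fun η => f (x, η)) y‖ ≤
      A * ∫ η : RSpace n, bracket η ^ (-((n : ℝ) + 1)) := by
  induction N generalizing m f with
  | zero =>
    rw [pow_zero, one_mul, ← integral_const_mul]
    exact norm_fourierHat_le ((bracket_decay_integrable n).const_mul A)
      (fun η => (hf (x, η)).bound.trans
        (mul_le_mul_of_nonneg_left (bracket_rpow_le hm _) hf.nonneg)) y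
  | succ N ih =>
    have h1 := ih (hs.partialXi j) (by linarith) ((symB_succ.1 hf).2.2 j)
    rw [fourierHat_partialXi hs (by linarith) x y j] at h1
    refine le_trans (le_of_eq ?_) h1
    simp [pow_succ]
    ring

/-- A symbol of order `-(n+1)` has a fibre Fourier transform that decays like `⟨y⟩ ^ (-(n+1))`,
uniformly in the base point. -/
lemma exists_fourierHat_decay (n : ℕ) : ∃ C : ℝ, 0 ≤ C ∧ ∀ {f : Phase n → ℂ} {m A : ℝ}, Symb m f →
    m ≤ -((n : ℝ) + 1) → SymB (n + 1) m A f → ∀ x y : RSpace n,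
    ‖fourierHat (fun η => f (x, η)) y‖ ≤ C * A * bracket y ^ (-((n : ℝ) + 1)) := by
  set c := ∫ η : RSpace n, bracket η ^ (-((n : ℝ) + 1)) with hc
  have hc0 : 0 ≤ c := integral_nonneg fun η => (bracket_rpow_pos _ _).le
  refine ⟨2 ^ (n + 1) * (1 + (n : ℝ) ^ n * n) * c, by positivity, ?_⟩
  intro f m A hs hm hf x y
  set F := ‖fourierHat (fun η => f (x, η)) y‖ with hF
  have hF0 : 0 ≤ F := norm_nonneg _
  have h0 : F ≤ A * c := by
    rw [hc, ← integral_const_mul]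
    exact norm_fourierHat_le ((bracket_decay_integrable n).const_mul A)
      (fun η => (hf (x, η)).bound.trans
        (mul_le_mul_of_nonneg_left (bracket_rpow_le hm _) hf.nonneg)) y
  have h1 : ∀ j, |y j| ^ (n + 1) * F ≤ A * c := fun j =>
    abs_coord_pow_mul_fourierHat_le (n + 1) hs hm hf x y j
  have h2 : bracket y ^ (n + 1) ≤ 2 ^ (n + 1) * (1 + (n : ℝ) ^ n * ∑ j, |y j| ^ (n + 1)) := by
    have a1 : bracket y ≤ 1 + ∑ j, |y j| :=
      (bracket_le_one_add_norm y).trans (by linarith [norm_le_sum_abs y])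
    have a2 : (∑ j, |y j|) ^ (n + 1) ≤ (n : ℝ) ^ n * ∑ j, |y j| ^ (n + 1) := by
      have := pow_sum_div_card_le_sum_pow (s := Finset.univ) (f := fun j => |y j|)
        (fun i _ => abs_nonneg _) n
      rcases Nat.eq_zero_or_pos n with hn | hn
      · subst hn; simp
      · have hn' : (0 : ℝ) < (n : ℝ) ^ n := by positivity
        rw [div_le_iff₀ (by simpa using hn')] at this
        simpa [mul_comm] using this
    have hS : 0 ≤ ∑ j, |y j| := Finset.sum_nonneg fun _ _ => abs_nonneg _
    calc bracket y ^ (n + 1) ≤ (1 + ∑ j, |y j|) ^ (n + 1) :=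
          pow_le_pow_left₀ (bracket_pos y).le a1 _
      _ ≤ 2 ^ (n + 1 - 1) * (1 ^ (n + 1) + (∑ j, |y j|) ^ (n + 1)) :=
          add_pow_le zero_le_one hS _
      _ ≤ 2 ^ (n + 1) * (1 + (n : ℝ) ^ n * ∑ j, |y j| ^ (n + 1)) := by
          rw [one_pow]
          gcongr
          · exact one_le_two
          · omega
  have h3 : bracket y ^ (n + 1) * F ≤ 2 ^ (n + 1) * (1 + (n : ℝ) ^ n * n) * c * A := by
    calc bracket y ^ (n + 1) * F ≤
          2 ^ (n + 1) * (1 + (n : ℝ) ^ n * ∑ j, |y j| ^ (n + 1)) * F := by gcongr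
      _ = 2 ^ (n + 1) * (F + (n : ℝ) ^ n * ∑ j, |y j| ^ (n + 1) * F) := by
          rw [← Finset.sum_mul]; ring
      _ ≤ 2 ^ (n + 1) * (A * c + (n : ℝ) ^ n * ∑ _j : Fin n, A * c) := by
          have hs := Finset.sum_le_sum fun j (_ : j ∈ Finset.univ) => h1 j
          gcongr
      _ = _ := by simp; ring
  rw [Real.rpow_neg (bracket_pos y).le, ← div_eq_mul_inv, le_div_iff₀ (bracket_rpow_pos _ _)]
  have e : bracket y ^ ((n : ℝ) + 1) = bracket y ^ (n + 1) := by
    rw [← Real.rpow_natCast]; push_cast; rfl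
  rw [e, mul_comm]; exact h3

/-! ### Coordinates and weights -/

/-- The coordinate function `(x, ξ) ↦ ξ_j`. -/
def coordXi (j : Fin n) : Phase n → ℂ := fun z => (z.2 j : ℂ)

/-- The coordinate `ξ_j` as a continuous real-linear map. -/
def coordXiCLM (j : Fin n) : Phase n →L[ℝ] ℂ :=
  Complex.ofRealCLM ∘L (EuclideanSpace.proj j ∘L ContinuousLinearMap.snd ℝ (RSpace n) (RSpace n))

lemma dirD_coordXi (v : Phase n) (j : Fin n) : dirD v (coordXi j) = fun _ => (v.2 j : ℂ) := by
  funext z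
  have : HasFDerivAt (coordXi j) (coordXiCLM j) z := (coordXiCLM j).hasFDerivAt
  simp only [dirD]; rw [this.fderiv]; rfl

lemma symb_coordXi (j : Fin n) : Symb 1 (coordXi (n := n) j) := by
  refine ⟨(coordXiCLM j).contDiff, fun N => ⟨1, fun z => ?_⟩⟩
  have h : ‖coordXi j z‖ ≤ 1 * bracket z.2 ^ (1 : ℝ) := by
    rw [Real.rpow_one, one_mul]
    simp only [coordXi, Complex.norm_real]
    exact (PiLp.norm_apply_le z.2 j).trans (norm_le_bracket _)
  cases N with
  | zero => exact h
  | succ N =>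
    refine ⟨h, fun k => ?_, fun k => ?_⟩
    · rw [partialX_eq, dirD_coordXi]
      simpa using symAt_zero N 1 zero_le_one z
    · rw [partialXi_eq, dirD_coordXi, sub_self]
      refine (symAt_const N _ z).mono ?_ le_rfl
      by_cases hk : j = k <;> simp [hk]

/-- The symbol `⟨ξ⟩²`. -/
def bracketSq : Phase n → ℂ := fun z => ((bracket z.2 ^ 2 : ℝ) : ℂ)

lemma bracketSq_eq : (bracketSq : Phase n → ℂ) = fun z => 1 + ∑ j, coordXi j z * coordXi j z := by
  funext z
  simp only [bracketSq, coordXi, bracket_sq]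
  rw [EuclideanSpace.norm_sq_eq]
  push_cast
  simp [sq, ← Complex.ofReal_mul]

lemma symb_bracketSq : Symb 2 (bracketSq : Phase n → ℂ) := by
  rw [bracketSq_eq]
  refine ((Symb.const 1).mono (by norm_num)).add (Symb.sum _ fun j _ => ?_)
  have := (symb_coordXi (n := n) j).mul (symb_coordXi j)
  exact this.mono (by norm_num)

lemma bracketSq_ne_zero (z : Phase n) : bracketSq z ≠ 0 := by
  have := bracket_pos z.2
  simp only [bracketSq, ne_eq, Complex.ofReal_eq_zero]
  positivity

/-- The weight `⟨ξ⟩ ^ (-2K)`. -/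
def wgt (K : ℕ) : Phase n → ℂ := fun z => ((bracketSq z)⁻¹) ^ K

lemma wgt_succ (K : ℕ) : (wgt (K + 1) : Phase n → ℂ) = fun z => wgt K z * (bracketSq z)⁻¹ := by
  funext z; simp [wgt, pow_succ]

lemma bracketSq_mul_wgt_succ (K : ℕ) (z : Phase n) : bracketSq z * wgt (K + 1) z = wgt K z := by
  have := bracketSq_ne_zero z
  rw [wgt_succ]; field_simp

lemma symb_inv_bracketSq : Symb (-2) (fun z : Phase n => (bracketSq z)⁻¹) := by
  refine ⟨symb_bracketSq.1.inv bracketSq_ne_zero, fun N => ?_⟩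
  obtain ⟨A, hA⟩ := (symb_bracketSq (n := n)).2 N
  obtain ⟨C, _, k, h⟩ := symB_inv (n := n) N
  refine ⟨_, h (le_max_left 1 A) le_rfl symb_bracketSq.1 (hA.mono (le_max_right _ _) le_rfl) ?_⟩
  intro z
  have := bracket_pos z.2
  simp [bracketSq, abs_of_pos this]

lemma symb_wgt (K : ℕ) : Symb (-2 * K) (wgt K : Phase n → ℂ) := by
  induction K with
  | zero =>
    have : (wgt 0 : Phase n → ℂ) = fun _ => 1 := by funext z; simp [wgt]
    rw [this]; simpa using Symb.const (n := n) 1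
  | succ K ih =>
    rw [wgt_succ]
    have := ih.mul symb_inv_bracketSq
    refine this.mono (le_of_eq ?_)
    push_cast; ring

/-! ### Differentiation under the integral sign -/

/-- Differentiation of an integral with respect to a parameter in phase space. The domination is
only required of the partial derivatives. -/
lemma differentiable_integral_param {F : Phase n → RSpace n → ℂ}
    (hd : ∀ y, Differentiable ℝ fun z => F z y) (hi : ∀ z, Integrable (F z))
    (hX : ∀ j z, Continuous fun y => partialX j (fun z => F z y) z)
    (hXi : ∀ j z, Continuous fun y => partialXi j (fun z => F z y) z)
    (hb : ∀ z₀, ∃ b : RSpace n → ℝ, Integrable b ∧ ∀ z ∈ Metric.ball z₀ 1, ∀ y,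
      (∀ j, ‖partialX j (fun z => F z y) z‖ ≤ b y) ∧ ∀ j, ‖partialXi j (fun z => F z y) z‖ ≤ b y) :
    Differentiable ℝ (fun z => ∫ y, F z y) ∧
      ∀ v, dirD v (fun z => ∫ y, F z y) = fun z => ∫ y, dirD v (fun z => F z y) z := by
  have hmeas : ∀ z, AEStronglyMeasurable (fun y => fderiv ℝ (fun z => F z y) z) volume := by
    intro z
    have : (fun y => fderiv ℝ (fun z => F z y) z) = fun y => _ :=
      funext fun y => fderiv_eq_sum (fun z => F z y) z
    rw [this]
    refine Continuous.aestronglyMeasurable (Continuous.add (continuous_finsetSum _ fun j _ => ?_)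
      (continuous_finsetSum _ fun j _ => ?_))
    · exact (ContinuousLinearMap.smulRightL ℝ _ _ _).continuous.comp (hX j z)
    · exact (ContinuousLinearMap.smulRightL ℝ _ _ _).continuous.comp (hXi j z)
  have hbound : ∀ z₀, ∃ b : RSpace n → ℝ, Integrable b ∧ ∀ z ∈ Metric.ball z₀ 1, ∀ y,
      ‖fderiv ℝ (fun z => F z y) z‖ ≤ b y := by
    intro z₀
    obtain ⟨b, hbi, hb⟩ := hb z₀
    refine ⟨fun y => 2 * n * b y, hbi.const_mul _, fun z hz y => ?_⟩
    refine (norm_fderiv_le _ z).trans ?_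
    have h1 := Finset.sum_le_sum fun j (_ : j ∈ (Finset.univ : Finset (Fin n))) =>
      (hb z hz y).1 j
    have h2 := Finset.sum_le_sum fun j (_ : j ∈ (Finset.univ : Finset (Fin n))) =>
      (hb z hz y).2 j
    simp at h1 h2
    linarith
  have key : ∀ z, HasFDerivAt (fun z => ∫ y, F z y) (∫ y, fderiv ℝ (fun z => F z y) z) z := by
    intro z
    obtain ⟨b, hbi, hb⟩ := hbound z
    exact hasFDerivAt_integral_of_dominated_of_fderiv_le (Metric.ball_mem_nhds z one_pos)
      (Eventually.of_forall fun z => (hi z).aestronglyMeasurable) (hi z) (hmeas z)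
      (Eventually.of_forall fun y z hz => hb z hz y) hbi
      (Eventually.of_forall fun y z _ => (hd y z).hasFDerivAt)
  refine ⟨fun z => (key z).differentiableAt, fun v => funext fun z => ?_⟩
  obtain ⟨b, hbi, hb⟩ := hbound z
  have hint : Integrable (fun y => fderiv ℝ (fun z => F z y) z) :=
    hbi.mono' (hmeas z) (Eventually.of_forall fun y => hb z (Metric.mem_ball_self one_pos) y)
  simp only [dirD]
  rw [(key z).fderiv, ContinuousLinearMap.integral_apply hint]

/-! ### The kernel of an amplitude -/

/-- The function `y ↦ ∫ exp (-i y·η) ⟨η⟩ ^ (-2K) p (x, ξ + η) dη` for `z = (x, ξ)`. -/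
def ampKer (K : ℕ) (p : Phase n → ℂ) (z : Phase n) (y : RSpace n) : ℂ :=
  fourierHat (fun η => wgt K (0, η) * p (z + (0, η))) y

/-- `K` is large enough for the weight `⟨η⟩ ^ (-2K)` to make amplitudes of order `m` integrable,
even after the loss caused by a translation. -/
def Adm (n K : ℕ) (m : ℝ) : Prop := 3 * ((n : ℝ) + 1) + |m| ≤ 2 * K

lemma Adm.le {K : ℕ} {m : ℝ} (h : Adm n K m) : -2 * (K : ℝ) + m ≤ -((n : ℝ) + 1) := by
  unfold Adm at h
  have := le_abs_self m
  have : (0 : ℝ) ≤ n := n.cast_nonneg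
  linarith

lemma amp_eq (K : ℕ) (p : Phase n → ℂ) (z : Phase n) (η : RSpace n) :
    wgt K (0, η) * p (z + (0, η)) = (fun ζ => wgt K ζ * p (ζ + (0, z.2))) (z.1, η) := by
  have : z + (0, η) = (z.1, η) + (0, z.2) := by ext1 <;> simp [add_comm]
  simp only [this]; rfl

lemma symb_amp (K : ℕ) {m : ℝ} {p : Phase n → ℂ} (hp : Symb m p) (ξ : RSpace n) :
    Symb (-2 * K + m) (fun ζ => wgt K ζ * p (ζ + (0, ξ))) :=
  (symb_wgt K).mul (hp.translate ξ)

lemma ampKer_eq (K : ℕ) (p : Phase n → ℂ) (z : Phase n) (y : RSpace n) :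
    ampKer K p z y = fourierHat (fun η => (fun ζ => wgt K ζ * p (ζ + (0, z.2))) (z.1, η)) y := by
  unfold ampKer; congr 1; funext η; exact amp_eq K p z η

lemma integrable_amp {K : ℕ} {m : ℝ} {p : Phase n → ℂ} (hp : Symb m p) (hK : Adm n K m)
    (z : Phase n) : Integrable fun η => wgt K (0, η) * p (z + (0, η)) := by
  simp only [amp_eq]
  exact (symb_amp K hp z.2).integrable (by have := hK.le; linarith) z.1

lemma continuous_ampKer {K : ℕ} {m : ℝ} {p : Phase n → ℂ} (hp : Symb m p) (hK : Adm n K m)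
    (z : Phase n) : Continuous (ampKer K p z) :=
  continuous_fourierHat (integrable_amp hp hK z)

/-- The kernel of a symbol of order `m` at `(x, ξ)` is `O(⟨ξ⟩ ^ m)` and integrable in `y`, with
constants given by finitely many seminorms. -/
lemma exists_ampKer_bound {K : ℕ} {m : ℝ} (hK : Adm n K m) : ∃ C : ℝ, 0 ≤ C ∧
    ∀ {p : Phase n → ℂ} {A : ℝ}, Symb m p → SymB (n + 1) m A p → ∀ z y,
    ‖ampKer K p z y‖ ≤ C * A * bracket z.2 ^ m * bracket y ^ (-((n : ℝ) + 1)) := by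
  obtain ⟨C, hC0, hC⟩ := exists_fourierHat_decay n
  obtain ⟨W, hW⟩ := (symb_wgt (n := n) K).2 (n + 1)
  have hW0 := hW.nonneg
  refine ⟨C * (2 ^ (n + 1) * (W * 2 ^ (|m| + (n + 1 : ℕ)))), by positivity, ?_⟩
  intro p A hs hp z y
  have h1 := hp.translate (s := |m| + 2 * (n + 1 : ℕ)) le_rfl z.2
  have h2 : SymB (n + 1) (-2 * K + (|m| + 2 * (n + 1 : ℕ))) _
      (fun ζ => wgt K ζ * p (ζ + (0, z.2))) := fun ζ =>
    (hW ζ).mul (h1 ζ) (symb_wgt K).1 (hs.translate z.2).1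
  rw [ampKer_eq]
  unfold Adm at hK
  have h3 := hC ((symb_amp K hs z.2).mono (m₂ := -2 * K + (|m| + 2 * (n + 1 : ℕ))) ?_) ?_ h2 z.1 y
  · refine h3.trans (le_of_eq ?_); ring
  · have := le_abs_self m
    have : (0 : ℝ) ≤ (n + 1 : ℕ) := Nat.cast_nonneg _
    linarith
  · push_cast; linarith

lemma Symb.exists_bound {m : ℝ} (hf : Symb m f) :
    ∃ C, 0 ≤ C ∧ ∀ z, ‖f z‖ ≤ C * bracket z.2 ^ m :=
  let ⟨A, hA⟩ := hf.2 0
  ⟨A, hA.nonneg, fun z => hA z⟩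

lemma Symb.exists_partial_bound {m : ℝ} (hf : Symb m f) : ∃ C, 0 ≤ C ∧ ∀ z,
    (∀ j, ‖_root_.partialX j f z‖ ≤ C * bracket z.2 ^ m) ∧
      ∀ j, ‖_root_.partialXi j f z‖ ≤ C * bracket z.2 ^ m := by
  obtain ⟨A, hA⟩ := hf.2 1
  rw [symB_succ] at hA
  have h0 : 0 ≤ A := SymB.nonneg (N := 0) (f := f) (m := m) fun z => hA.1 z
  exact ⟨A, h0, fun z => ⟨fun j => hA.2.1 j z, fun j => (hA.2.2 j z).trans
    (mul_le_mul_of_nonneg_left (bracket_rpow_le (by linarith) _) h0)⟩⟩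

lemma bracket_le_of_mem_ball {z z₀ : Phase n} (hz : z ∈ Metric.ball z₀ 1) :
    bracket z.2 ≤ 2 + ‖z₀‖ := by
  have h1 := bracket_le_one_add_norm z.2
  have h2 : ‖z.2‖ ≤ ‖z‖ := norm_snd_le z
  have h3 : ‖z‖ ≤ ‖z - z₀‖ + ‖z₀‖ := by simpa using norm_add_le (z - z₀) z₀
  rw [Metric.mem_ball, dist_eq_norm] at hz
  linarith

lemma bracket_rpow_le_of_mem_ball {z z₀ : Phase n} (hz : z ∈ Metric.ball z₀ 1) (m : ℝ) :
    bracket z.2 ^ m ≤ (2 + ‖z₀‖) ^ |m| :=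
  (bracket_rpow_le (le_abs_self m) _).trans
    (Real.rpow_le_rpow (bracket_pos _).le (bracket_le_of_mem_ball hz) (abs_nonneg m))

/-- The kernel is differentiable in `z`, with the derivative acting on the amplitude. -/
lemma differentiable_ampKer {K : ℕ} {m : ℝ} {p : Phase n → ℂ} (hp : Symb m p) (hK : Adm n K m)
    (y : RSpace n) : Differentiable ℝ (fun z => ampKer K p z y) ∧
      ∀ v, dirD v (fun z => ampKer K p z y) = fun z => ampKer K (dirD v p) z y := by
  have hw : Continuous (wgt K : Phase n → ℂ) := (symb_wgt K).continuous
  have hD : ∀ v η, dirD v (fun z : Phase n =>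
      Complex.exp (-(Complex.I * ((inner ℝ η y : ℝ) : ℂ))) * (wgt K (0, η) * p (z + (0, η)))) =
      fun z => Complex.exp (-(Complex.I * ((inner ℝ η y : ℝ) : ℂ))) *
        (wgt K (0, η) * dirD v p (z + (0, η))) := by
    intro v η
    have hd : Differentiable ℝ fun z : Phase n => p (z + (0, η)) :=
      hp.differentiable.comp (by fun_prop)
    rw [dirD_const_mul _ _ (hd.const_mul _), dirD_const_mul _ _ hd, dirD_comp_add_right]
  have hcont : ∀ v z, Continuous fun η : RSpace n =>
      Complex.exp (-(Complex.I * ((inner ℝ η y : ℝ) : ℂ))) *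
        (wgt K (0, η) * dirD v p (z + (0, η))) := by
    intro v z
    have h1 : Continuous (dirD v p) := (smooth_dirD v hp.1).continuous
    fun_prop
  have key := differentiable_integral_param (F := fun z η =>
    Complex.exp (-(Complex.I * ((inner ℝ η y : ℝ) : ℂ))) * (wgt K (0, η) * p (z + (0, η))))
    (fun η => ?_) (fun z => integrable_exp_mul (integrable_amp hp hK z) y) ?_ ?_ ?_
  · refine ⟨key.1, fun v => ?_⟩
    have h2 := key.2 v
    simp only [hD] at h2
    exact h2
  · exact ((hp.differentiable.comp (by fun_prop)).const_mul _).const_mul _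
  · intro j z; simp only [partialX_eq, hD]; exact hcont _ z
  · intro j z; simp only [partialXi_eq, hD]; exact hcont _ z
  · intro z₀
    obtain ⟨C, hC0, hC⟩ := hp.exists_partial_bound
    obtain ⟨W, hW0, hW⟩ := (symb_wgt (n := n) K).exists_bound
    have hKm : -2 * (K : ℝ) + |m| < -(n : ℝ) := by
      unfold Adm at hK
      have : (0 : ℝ) ≤ n := n.cast_nonneg
      linarith
    refine ⟨fun η => W * C * (2 ^ |m| * (2 + ‖z₀‖) ^ |m|) * bracket η ^ (-2 * (K : ℝ) + |m|),
      (integrable_bracket_rpow hKm).const_mul _, fun z hz η => ?_⟩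
    have hle : ∀ t : ℂ, ‖t‖ ≤ C * bracket (z + (0, η)).2 ^ m →
        ‖Complex.exp (-(Complex.I * ((inner ℝ η y : ℝ) : ℂ))) * (wgt K (0, η) * t)‖ ≤
        W * C * (2 ^ |m| * (2 + ‖z₀‖) ^ |m|) * bracket η ^ (-2 * (K : ℝ) + |m|) := by
      intro t ht
      rw [norm_mul, norm_exp_neg_I_inner, one_mul, norm_mul]
      have h1 := bracket_add_rpow_le m z.2 η
      have h2 := bracket_rpow_le_of_mem_ball hz m
      have h3 := hW (0, η)
      have h4 := bracket_rpow_pos η |m|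
      have h5 := bracket_rpow_pos η (-2 * (K : ℝ))
      have h6 : ‖t‖ ≤ C * (2 ^ |m| * (2 + ‖z₀‖) ^ |m| * bracket η ^ |m|) := by
        refine ht.trans ?_
        have : (z + (0, η)).2 = z.2 + η := rfl
        rw [this]
        gcongr
        exact h1.trans (by gcongr)
      calc ‖wgt K (0, η)‖ * ‖t‖ ≤ (W * bracket η ^ (-2 * (K : ℝ))) *
            (C * (2 ^ |m| * (2 + ‖z₀‖) ^ |m| * bracket η ^ |m|)) := by gcongr
        _ = _ := by rw [bracket_rpow_add]; ring
    refine ⟨fun j => ?_, fun j => ?_⟩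
    · rw [partialX_eq, hD]; exact hle _ ((hC _).1 j)
    · rw [partialXi_eq, hD]; exact hle _ ((hC _).2 j)

/-! ### The regularized composition -/

/-- The normalizing factor `(2π) ^ (-n)`. -/
def cNorm (n : ℕ) : ℂ := (((2 * Real.pi) ^ n : ℝ) : ℂ)⁻¹

/-- The absolutely convergent form `(2π) ^ (-n) ∫ ampKer K p (x, ξ) y * b (x + y, ξ) dy` of an
oscillatory integral. With `b = (1 - Δ_x) ^ K a` it is the symbol of the product of `p(x,D)` and
`a(x,D)`. -/
def bil (K : ℕ) (p b : Phase n → ℂ) (z : Phase n) : ℂ :=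
  cNorm n * ∫ y, ampKer K p z y * b (z + (y, 0))

section bil

variable {K : ℕ} {m₁ m₂ : ℝ} {p b : Phase n → ℂ}

lemma norm_ampKer_mul_le (hp : Symb m₁ p) (hb : Symb m₂ b) (hK : Adm n K m₁) :
    ∃ C, 0 ≤ C ∧ ∀ z y, ‖ampKer K p z y * b (z + (y, 0))‖ ≤
      C * bracket z.2 ^ (m₁ + m₂) * bracket y ^ (-((n : ℝ) + 1)) := by
  obtain ⟨C, hC0, hC⟩ := exists_ampKer_bound hK
  obtain ⟨A, hA⟩ := hp.2 (n + 1)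
  obtain ⟨B, hB0, hB⟩ := hb.exists_bound
  have hA0 := hA.nonneg
  refine ⟨C * A * B, by positivity, fun z y => ?_⟩
  have h1 := hC hp hA z y
  have h2 := hB (z + (y, 0))
  have e : (z + (y, 0)).2 = z.2 := by simp
  rw [e] at h2
  have h4 := bracket_rpow_pos z.2 m₁
  have h5 := bracket_rpow_pos y (-((n : ℝ) + 1))
  have h6 := bracket_rpow_pos z.2 m₂
  rw [norm_mul]
  calc _ ≤ (C * A * bracket z.2 ^ m₁ * bracket y ^ (-((n : ℝ) + 1))) *
        (B * bracket z.2 ^ m₂) := by gcongr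
    _ = _ := by rw [bracket_rpow_add]; ring

lemma continuous_ampKer_mul (hp : Symb m₁ p) (hb : Continuous b) (hK : Adm n K m₁) (z : Phase n) :
    Continuous fun y => ampKer K p z y * b (z + (y, 0)) :=
  (continuous_ampKer hp hK z).mul (hb.comp (by fun_prop))

lemma integrable_ampKer_mul (hp : Symb m₁ p) (hb : Symb m₂ b) (hK : Adm n K m₁) (z : Phase n) :
    Integrable fun y => ampKer K p z y * b (z + (y, 0)) := by
  obtain ⟨C, _, hC⟩ := norm_ampKer_mul_le hp hb hK
  exact ((bracket_decay_integrable n).const_mul _).mono'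
    (continuous_ampKer_mul hp hb.continuous hK z).aestronglyMeasurable
    (Eventually.of_forall fun y => hC z y)

/-- The composition integral is differentiable and satisfies the Leibniz rule. -/
lemma differentiable_bil (hp : Symb m₁ p) (hb : Symb m₂ b) (hK : Adm n K m₁) :
    Differentiable ℝ (bil K p b) ∧
      (∀ j, partialX j (bil K p b) = fun z => bil K (partialX j p) b z +
        bil K p (partialX j b) z) ∧
      ∀ j, partialXi j (bil K p b) = fun z => bil K (partialXi j p) b z +
        bil K p (partialXi j b) z := by
  have hdb : ∀ y : RSpace n, Differentiable ℝ fun z : Phase n => b (z + (y, 0)) := fun y =>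
    hb.differentiable.comp (by fun_prop)
  have hD : ∀ v y, dirD v (fun z : Phase n => ampKer K p z y * b (z + (y, 0))) =
      fun z => ampKer K (dirD v p) z y * b (z + (y, 0)) +
        ampKer K p z y * dirD v b (z + (y, 0)) := by
    intro v y
    rw [dirD_mul v (differentiable_ampKer hp hK y).1 (hdb y), (differentiable_ampKer hp hK y).2,
      dirD_comp_add_right]
  have hpX : ∀ j, Symb m₁ (partialX j p) := fun j => hp.partialX j
  have hpXi : ∀ j, Symb m₁ (partialXi j p) := fun j => (hp.partialXi j).mono (by linarith)
  have hbX : ∀ j, Symb m₂ (partialX j b) := fun j => hb.partialX j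
  have hbXi : ∀ j, Symb m₂ (partialXi j b) := fun j => (hb.partialXi j).mono (by linarith)
  have key := differentiable_integral_param (F := fun z y => ampKer K p z y * b (z + (y, 0)))
    (fun y => (differentiable_ampKer hp hK y).1.mul (hdb y))
    (fun z => integrable_ampKer_mul hp hb hK z) ?_ ?_ ?_
  · have hdir : ∀ v, Symb m₁ (dirD v p) → Symb m₂ (dirD v b) → dirD v (bil K p b) =
        fun z => bil K (dirD v p) b z + bil K p (dirD v b) z := by
      intro v h1 h2
      have h3 := key.2 v
      change dirD v (fun z => cNorm n * ∫ y, ampKer K p z y * b (z + (y, 0))) = _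
      rw [dirD_const_mul _ _ key.1, h3]
      funext z
      simp only [hD, bil]
      rw [integral_add (integrable_ampKer_mul h1 hb hK z) (integrable_ampKer_mul hp h2 hK z),
        mul_add]
    exact ⟨key.1.const_mul _, fun j => hdir _ (hpX j) (hbX j), fun j => hdir _ (hpXi j) (hbXi j)⟩
  · intro j z; simp only [partialX_eq, hD]
    exact (continuous_ampKer_mul (hpX j) hb.continuous hK z).add
      (continuous_ampKer_mul hp (hbX j).continuous hK z)
  · intro j z; simp only [partialXi_eq, hD]
    exact (continuous_ampKer_mul (hpXi j) hb.continuous hK z).add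
      (continuous_ampKer_mul hp (hbXi j).continuous hK z)
  · intro z₀
    choose C₁ hC₁ h₁ using fun j => norm_ampKer_mul_le (hpX j) hb hK
    choose C₂ hC₂ h₂ using fun j => norm_ampKer_mul_le hp (hbX j) hK
    choose C₃ hC₃ h₃ using fun j => norm_ampKer_mul_le (hpXi j) hb hK
    choose C₄ hC₄ h₄ using fun j => norm_ampKer_mul_le hp (hbXi j) hK
    set T : ℝ := (2 + ‖z₀‖) ^ |m₁ + m₂|
    set S : ℝ := ∑ j, (C₁ j + C₂ j + C₃ j + C₄ j)
    have hS : ∀ j, C₁ j + C₂ j + C₃ j + C₄ j ≤ S := fun j =>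
      Finset.single_le_sum (f := fun j => C₁ j + C₂ j + C₃ j + C₄ j)
        (fun j _ => by have := hC₁ j; have := hC₂ j; have := hC₃ j; have := hC₄ j; positivity)
        (Finset.mem_univ j)
    refine ⟨fun y => S * T * bracket y ^ (-((n : ℝ) + 1)),
      (bracket_decay_integrable n).const_mul _, fun z hz y => ?_⟩
    have hT := bracket_rpow_le_of_mem_ball hz (m₁ + m₂)
    have hpos := bracket_rpow_pos z.2 (m₁ + m₂)
    have hy := bracket_rpow_pos y (-((n : ℝ) + 1))
    have gen : ∀ (s t : ℂ) (c d : ℝ), 0 ≤ c → 0 ≤ d → c + d ≤ S →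
        ‖s‖ ≤ c * bracket z.2 ^ (m₁ + m₂) * bracket y ^ (-((n : ℝ) + 1)) →
        ‖t‖ ≤ d * bracket z.2 ^ (m₁ + m₂) * bracket y ^ (-((n : ℝ) + 1)) →
        ‖s + t‖ ≤ S * T * bracket y ^ (-((n : ℝ) + 1)) := by
      intro s t c d hc hd hcd hs ht
      calc ‖s + t‖ ≤ (c + d) * bracket z.2 ^ (m₁ + m₂) * bracket y ^ (-((n : ℝ) + 1)) := by
            refine (norm_add_le _ _).trans ((add_le_add hs ht).trans (le_of_eq ?_)); ring
        _ ≤ _ := by gcongr; exact (add_nonneg hc hd).trans hcd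
    refine ⟨fun j => ?_, fun j => ?_⟩
    · rw [partialX_eq, hD]
      exact gen _ _ _ _ (hC₁ j) (hC₂ j) (by linarith [hS j, hC₃ j, hC₄ j]) (h₁ j z y) (h₂ j z y)
    · rw [partialXi_eq, hD]
      exact gen _ _ _ _ (hC₃ j) (hC₄ j) (by linarith [hS j, hC₁ j, hC₂ j]) (h₃ j z y) (h₄ j z y)

lemma smooth_bil (hp : Symb m₁ p) (hb : Symb m₂ b) (hK : Adm n K m₁) :
    ContDiff ℝ ∞ (bil K p b) := by
  have h : ∀ k : ℕ, ContDiff ℝ k (bil K p b) := by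
    intro k
    induction k generalizing p b with
    | zero => simpa using (differentiable_bil hp hb hK).1.continuous
    | succ k ih =>
      obtain ⟨h1, h2, h3⟩ := differentiable_bil hp hb hK
      refine contDiff_succ_of_partials h1 (fun j => ?_) fun j => ?_
      · rw [h2]
        exact (ih (hp.partialX j) hb).add (ih hp (hb.partialX j))
      · rw [h3]
        exact (ih ((hp.partialXi j).mono (by linarith)) hb).add
          (ih hp ((hb.partialXi j).mono (by linarith)))
  exact contDiff_infty.2 h

end bil

/-! ### Integration by parts in the regularized composition -/

/-- The operator `∂_{x_j} + i t ξ_j`. -/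
def shiftD (t : ℝ) (j : Fin n) (a : Phase n → ℂ) : Phase n → ℂ :=
  fun z => partialX j a z + Complex.I * t * (coordXi j z * a z)

/-- The operator `1 - ∑_j (∂_{x_j} + i t ξ_j)²`. For `t = 0` it is `1 - Δ_x`, and for `t = 1` it is
the conjugate of `1 - Δ_x` by `exp (i x·ξ)`. -/
def shiftT (t : ℝ) (a : Phase n → ℂ) : Phase n → ℂ :=
  fun z => a z - ∑ j, shiftD t j (shiftD t j a) z

lemma smooth_shiftD (t : ℝ) (j : Fin n) (hf : ContDiff ℝ ∞ f) : ContDiff ℝ ∞ (shiftD t j f) :=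
  (smooth_partialX j hf).add (contDiff_const.mul ((symb_coordXi j).1.mul hf))

lemma Symb.shiftD {m : ℝ} (hf : Symb m f) (t : ℝ) (j : Fin n) : Symb (m + 1) (shiftD t j f) := by
  refine ((hf.partialX j).mono (by linarith)).add (Symb.const_mul _ ?_)
  exact ((symb_coordXi j).mul hf).mono (by linarith)

lemma Symb.shiftT {m : ℝ} (hf : Symb m f) (t : ℝ) : Symb (m + 2) (shiftT t f) :=
  (hf.mono (by linarith)).sub (Symb.sum _ fun j _ =>
    ((hf.shiftD t j).shiftD t j).mono (by linarith))

lemma Symb.iterate_shiftT {m : ℝ} (hf : Symb m f) (t : ℝ) (k : ℕ) :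
    Symb (m + 2 * k) ((_root_.shiftT t)^[k] f) := by
  induction k with
  | zero => simpa using hf
  | succ k ih =>
    rw [Function.iterate_succ_apply']
    exact (ih.shiftT t).mono (by push_cast; linarith)

lemma partialX_coordXi_mul (i j : Fin n) (hf : Differentiable ℝ f) :
    partialX i (fun z => coordXi j z * f z) = fun z => coordXi j z * partialX i f z := by
  rw [partialX_eq, dirD_mul _ (symb_coordXi j).differentiable hf, dirD_coordXi]
  simp [partialX_eq]

lemma shiftD_comm (s t : ℝ) (i j : Fin n) (hf : ContDiff ℝ ∞ f) :
    shiftD s i (shiftD t j f) = shiftD t j (shiftD s i f) := by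
  have key : ∀ (s t : ℝ) (i j : Fin n), shiftD s i (shiftD t j f) = fun z =>
      partialX i (partialX j f) z + Complex.I * t * (coordXi j z * partialX i f z) +
      Complex.I * s * (coordXi i z * partialX j f z) +
      (Complex.I * s) * (Complex.I * t) * (coordXi i z * coordXi j z * f z) := by
    intro s t i j
    have h1 : Differentiable ℝ fun z => coordXi j z * f z :=
      (symb_coordXi j).differentiable.mul (smooth_differentiable hf)
    have h2 : partialX i (shiftD t j f) = fun z => partialX i (partialX j f) z +
        Complex.I * t * (coordXi j z * partialX i f z) := by
      have h3 := dirD_add (dirX i) (smooth_differentiable (smooth_partialX j hf))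
        (h1.const_mul (Complex.I * t))
      have h4 := dirD_const_mul (dirX i) (Complex.I * t) h1
      have h5 := partialX_coordXi_mul i j (smooth_differentiable hf)
      rw [partialX_eq] at h5
      rw [h4, h5] at h3
      exact h3
    funext z
    unfold shiftD at h2 ⊢
    rw [h2]
    ring
  rw [key, key, partialX_eq, partialX_eq, partialX_eq, dirD_comm _ _ hf]
  funext z; simp only [partialX_eq]; ring

lemma shiftD_sub (t : ℝ) (i : Fin n) (hf : ContDiff ℝ ∞ f) (hg : ContDiff ℝ ∞ g) :
    shiftD t i (fun z => f z - g z) = fun z => shiftD t i f z - shiftD t i g z := by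
  funext z
  simp only [shiftD, partialX_eq]
  rw [dirD_sub _ (smooth_differentiable hf) (smooth_differentiable hg)]
  ring

lemma shiftD_sum (t : ℝ) (i : Fin n) {F : Fin n → Phase n → ℂ} (hF : ∀ j, ContDiff ℝ ∞ (F j)) :
    shiftD t i (fun z => ∑ j, F j z) = fun z => ∑ j, shiftD t i (F j) z := by
  funext z
  simp only [shiftD, partialX_eq]
  rw [dirD_sum _ _ fun j _ => smooth_differentiable (hF j)]
  simp only [Finset.sum_add_distrib, Finset.mul_sum]

lemma shiftT_comm (s t : ℝ) (hf : ContDiff ℝ ∞ f) :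
    shiftT s (shiftT t f) = shiftT t (shiftT s f) := by
  have h2 : ∀ t j {f : Phase n → ℂ}, ContDiff ℝ ∞ f → ContDiff ℝ ∞ (shiftD t j (shiftD t j f)) :=
    fun t j f hf => smooth_shiftD t j (smooth_shiftD t j hf)
  have key : ∀ s t : ℝ, shiftT s (shiftT t f) = fun z =>
      f z - ∑ j, shiftD t j (shiftD t j f) z - ∑ i, shiftD s i (shiftD s i f) z +
      ∑ i, ∑ j, shiftD s i (shiftD s i (shiftD t j (shiftD t j f))) z := by
    intro s t
    have hs : ContDiff ℝ ∞ fun z => ∑ j, shiftD t j (shiftD t j f) z :=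
      ContDiff.sum fun j _ => h2 t j hf
    have h3 : ∀ i, shiftD s i (shiftD s i (shiftT t f)) = fun z => shiftD s i (shiftD s i f) z -
        ∑ j, shiftD s i (shiftD s i (shiftD t j (shiftD t j f))) z := by
      intro i
      unfold shiftT
      rw [shiftD_sub s i hf hs, shiftD_sum s i fun j => h2 t j hf,
        shiftD_sub s i (smooth_shiftD s i hf)
          (ContDiff.sum fun j _ => smooth_shiftD s i (h2 t j hf)),
        shiftD_sum s i fun j => smooth_shiftD s i (h2 t j hf)]
    funext z
    have h4 : shiftT s (shiftT t f) z = shiftT t f z -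
        ∑ i, shiftD s i (shiftD s i (shiftT t f)) z := rfl
    rw [h4]
    simp only [h3, Finset.sum_sub_distrib]
    simp only [shiftT]
    ring
  rw [key, key]
  funext z
  rw [Finset.sum_comm]
  have : ∀ i j, shiftD s i (shiftD s i (shiftD t j (shiftD t j f))) =
      shiftD t j (shiftD t j (shiftD s i (shiftD s i f))) := by
    intro i j
    rw [shiftD_comm s t i j (smooth_shiftD t j hf), shiftD_comm s t i j hf,
      shiftD_comm s t i j (smooth_shiftD t j (smooth_shiftD s i hf)),
      shiftD_comm s t i j (smooth_shiftD s i hf)]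
  simp only [this]
  ring

lemma smooth_shiftT (t : ℝ) (hf : ContDiff ℝ ∞ f) : ContDiff ℝ ∞ (shiftT t f) :=
  hf.sub (ContDiff.sum fun j _ => smooth_shiftD t j (smooth_shiftD t j hf))

lemma smooth_iterate_shiftT (t : ℝ) (k : ℕ) (hf : ContDiff ℝ ∞ f) :
    ContDiff ℝ ∞ ((shiftT t)^[k] f) := by
  induction k with
  | zero => exact hf
  | succ k ih => rw [Function.iterate_succ_apply']; exact smooth_shiftT t ih

lemma iterate_shiftT_comm (s t : ℝ) (k l : ℕ) (hf : ContDiff ℝ ∞ f) :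
    (shiftT s)^[k] ((shiftT t)^[l] f) = (shiftT t)^[l] ((shiftT s)^[k] f) := by
  have h1 : ∀ l {f : Phase n → ℂ}, ContDiff ℝ ∞ f →
      shiftT s ((shiftT t)^[l] f) = (shiftT t)^[l] (shiftT s f) := by
    intro l
    induction l with
    | zero => intro f _; rfl
    | succ l ih =>
      intro f hf
      rw [Function.iterate_succ_apply, ih (smooth_shiftT t hf), shiftT_comm s t hf,
        ← Function.iterate_succ_apply]
  induction k with
  | zero => rfl
  | succ k ih =>
    rw [Function.iterate_succ_apply', ih, h1 l (smooth_iterate_shiftT s k hf),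
      ← Function.iterate_succ_apply' (shiftT s)]

/-- A fibre Fourier transform is differentiable if the symbol has a moment to spare. -/
lemma differentiable_fourierHat_slice {m : ℝ} (hf : Symb m f) (hm : m + 1 < -(n : ℝ))
    (x : RSpace n) : Differentiable ℝ (fourierHat fun η => f (x, η)) ∧
      ∀ y j, fderiv ℝ (fourierHat fun η => f (x, η)) y (EuclideanSpace.single j 1) =
        -Complex.I * fourierHat (fun η => coordXi j (x, η) * f (x, η)) y := by
  have h1 : ∀ (η : RSpace n) (z : Phase n), HasFDerivAt
      (fun z : Phase n => ((inner ℝ η z.1 : ℝ) : ℂ))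
      (Complex.ofRealCLM ∘L (innerSL ℝ η) ∘L ContinuousLinearMap.fst ℝ (RSpace n) (RSpace n)) z :=
    fun η z => (Complex.ofRealCLM ∘L (innerSL ℝ η) ∘L
      ContinuousLinearMap.fst ℝ (RSpace n) (RSpace n)).hasFDerivAt.congr_of_eventuallyEq
        (Eventually.of_forall fun w => by simp)
  have hE : ∀ (η : RSpace n) (v : Phase n), dirD v (fun z : Phase n =>
      Complex.exp (-(Complex.I * ((inner ℝ η z.1 : ℝ) : ℂ))) * f (x, η)) = fun z =>
      Complex.exp (-(Complex.I * ((inner ℝ η z.1 : ℝ) : ℂ))) *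
        (-(Complex.I * ((inner ℝ η v.1 : ℝ) : ℂ)) * f (x, η)) := by
    intro η v
    funext z
    have h2 := (((h1 η z).const_mul Complex.I).neg.cexp.mul_const (f (x, η))).fderiv
    refine (congrArg (fun T : Phase n →L[ℝ] ℂ => T v) h2).trans ?_
    simp
    ring
  have hc : Continuous f := hf.continuous
  have hi := hf.integrable (by linarith) x
  have key := differentiable_integral_param (F := fun z η =>
    Complex.exp (-(Complex.I * ((inner ℝ η z.1 : ℝ) : ℂ))) * f (x, η))
    (fun η z => ((h1 η z).const_mul Complex.I).neg.cexp.differentiableAt.mul_const _)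
    (fun z => integrable_exp_mul hi z.1) ?_ ?_ ?_
  · have hΦ : (fourierHat fun η => f (x, η)) = fun y => (fun z : Phase n =>
        ∫ η, Complex.exp (-(Complex.I * ((inner ℝ η z.1 : ℝ) : ℂ))) * f (x, η)) (0 + y, 0) := by
      funext y; simp [fourierHat]
    refine ⟨?_, fun y j => ?_⟩
    · rw [hΦ]; exact key.1.comp (by fun_prop)
    · rw [hΦ, fderiv_slice_fst key.1]
      change dirD (dirX j) _ _ = _
      rw [key.2]
      simp only [hE, zero_add]
      rw [fourierHat, ← integral_const_mul]
      congr 1; funext η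
      simp [coordXi, EuclideanSpace.inner_single_right]
      ring
  · intro j z; simp only [partialX_eq, hE]; fun_prop
  · intro j z; simp only [partialXi_eq, hE]; fun_prop
  · intro z₀
    obtain ⟨C, hC0, hC⟩ := hf.exists_bound
    refine ⟨fun η => C * bracket η ^ (m + 1), (integrable_bracket_rpow hm).const_mul _,
      fun z _ η => ⟨fun j => ?_, fun j => ?_⟩⟩
    · rw [partialX_eq, hE, norm_mul, norm_exp_neg_I_inner, one_mul, norm_mul]
      have h1 : ‖-(Complex.I * ((inner ℝ η (dirX j).1 : ℝ) : ℂ))‖ ≤ bracket η := by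
        simp only [norm_neg, norm_mul, Complex.norm_I, one_mul, Complex.norm_real]
        simp only [EuclideanSpace.inner_single_right]
        simpa using (PiLp.norm_apply_le η j).trans (norm_le_bracket η)
      have h2 := hC (x, η)
      have h3 := bracket_pos η
      calc _ ≤ bracket η * (C * bracket η ^ m) := by gcongr
        _ = C * bracket η ^ (m + 1) := by rw [bracket_rpow_add, Real.rpow_one]; ring
    · rw [partialXi_eq, hE]
      have := bracket_rpow_pos η (m + 1)
      simp
      positivity

lemma integrable_fourierHat_mul {m m₂ : ℝ} {a : Phase n → ℂ} (hf : Symb m f)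
    (hm : m ≤ -((n : ℝ) + 1)) (ha : Symb m₂ a) (x : RSpace n) (z : Phase n) :
    Integrable fun y => fourierHat (fun η => f (x, η)) y * a (z + (y, 0)) := by
  obtain ⟨C, hC0, hC⟩ := exists_fourierHat_decay n
  obtain ⟨A, hA⟩ := hf.2 (n + 1)
  obtain ⟨B, hB0, hB⟩ := ha.exists_bound
  have hA0 := hA.nonneg
  have hi := hf.integrable (by linarith) x
  refine ((bracket_decay_integrable n).const_mul (C * A * (B * bracket z.2 ^ m₂))).mono'
    ((continuous_fourierHat hi).mul
      (ha.continuous.comp (by fun_prop))).aestronglyMeasurable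
    (Eventually.of_forall fun y => ?_)
  have h1 := hC hf hm hA x y
  have h2 := hB (z + (y, 0))
  have e : (z + (y, 0)).2 = z.2 := by simp
  rw [e] at h2
  have h5 := bracket_rpow_pos y (-((n : ℝ) + 1))
  rw [norm_mul]
  calc _ ≤ (C * A * bracket y ^ (-((n : ℝ) + 1))) * (B * bracket z.2 ^ m₂) := by gcongr
    _ = _ := by ring

section ibp

variable {m m₂ : ℝ} {a : Phase n → ℂ}

/-- Integration by parts: a factor `t ξ_j + η_j` under the fibre Fourier transform becomes the
operator `-i (∂_{x_j} + i t ξ_j)` on the other factor. -/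
lemma integral_fourierHat_coord_mul (hf : Symb m f) (hm : m + 1 ≤ -((n : ℝ) + 1))
    (ha : Symb m₂ a) (t : ℝ) (x : RSpace n) (z : Phase n) (j : Fin n) :
    ∫ y, fourierHat (fun η => ((t * z.2 j : ℝ) + coordXi j (x, η)) * f (x, η)) y * a (z + (y, 0)) =
      -Complex.I * ∫ y, fourierHat (fun η => f (x, η)) y * shiftD t j a (z + (y, 0)) := by
  have hcf : Symb (m + 1) fun ζ => coordXi j ζ * f ζ :=
    ((symb_coordXi j).mul hf).mono (by linarith)
  have hn : (0 : ℝ) ≤ n := n.cast_nonneg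
  obtain ⟨hd, hd'⟩ := differentiable_fourierHat_slice hf (by linarith) x
  have hA : ∀ y, fderiv ℝ (fun y => a (z + (y, 0))) y (EuclideanSpace.single j 1) =
      partialX j a (z + (y, 0)) := by
    intro y
    have h1 := fderiv_slice_fst ha.differentiable z.1 z.2 y (EuclideanSpace.single j 1)
    have e : ∀ y : RSpace n, z + (y, 0) = (z.1 + y, z.2) := fun y => by ext1 <;> simp
    simp only [e]; exact h1
  have i1 := integrable_fourierHat_mul hf (by linarith) ha x z
  have i2 := integrable_fourierHat_mul hf (by linarith) (ha.partialX j) x z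
  have i3 := integrable_fourierHat_mul hcf (by linarith) ha x z
  have key := integral_mul_fderiv_eq_neg_fderiv_mul_of_integrable (μ := volume)
    (f := fourierHat fun η => f (x, η)) (g := fun y => a (z + (y, 0)))
    (v := EuclideanSpace.single j 1)
    (by simp only [hd', mul_assoc]; exact i3.const_mul _)
    (by simp only [hA]; exact i2) i1 (fun y _ => hd y)
    (fun y _ => (ha.differentiable.comp (by fun_prop)) y)
  simp only [hA, hd', mul_assoc] at key
  rw [integral_const_mul] at key
  have hL : ∀ y, fourierHat (fun η => ((t * z.2 j : ℝ) + coordXi j (x, η)) * f (x, η)) y *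
      a (z + (y, 0)) = ((t * z.2 j : ℝ) : ℂ) * (fourierHat (fun η => f (x, η)) y * a (z + (y, 0))) +
      fourierHat (fun η => coordXi j (x, η) * f (x, η)) y * a (z + (y, 0)) := by
    intro y
    have h1 := hf.integrable (by linarith) x
    have h2 := hcf.integrable (by linarith) x
    simp only [add_mul]
    rw [fourierHat_add (h1.const_mul _) h2, fourierHat_const_mul]
    ring
  have hR : ∀ y, fourierHat (fun η => f (x, η)) y * shiftD t j a (z + (y, 0)) =
      fourierHat (fun η => f (x, η)) y * partialX j a (z + (y, 0)) +
      Complex.I * (t * z.2 j : ℝ) * (fourierHat (fun η => f (x, η)) y * a (z + (y, 0))) := by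
    intro y
    simp [shiftD, coordXi]; ring
  simp only [hL, hR]
  rw [integral_add (i1.const_mul _) i3, integral_add i2 (i1.const_mul _), integral_const_mul,
    integral_const_mul, key]
  have hI : Complex.I * Complex.I = -1 := Complex.I_mul_I
  linear_combination ((∫ y, fourierHat (fun η => coordXi j (x, η) * f (x, η)) y *
      a (z + (y, 0))) + ((t * z.2 j : ℝ) : ℂ) *
      ∫ y, fourierHat (fun η => f (x, η)) y * a (z + (y, 0))) * hI

lemma symb_const_add_coordXi (c : ℂ) (j : Fin n) : Symb 1 fun ζ : Phase n => c + coordXi j ζ :=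
  ((Symb.const c).mono zero_le_one).add (symb_coordXi j)

/-- Integration by parts: a factor `⟨t ξ + η⟩²` under the fibre Fourier transform becomes the
operator `shiftT t` on the other factor. -/
lemma integral_fourierHat_bracketSq_mul (hf : Symb m f) (hm : m + 2 ≤ -((n : ℝ) + 1))
    (ha : Symb m₂ a) (t : ℝ) (x : RSpace n) (z : Phase n) :
    ∫ y, fourierHat (fun η => bracketSq ((x, η) + (0, t • z.2)) * f (x, η)) y * a (z + (y, 0)) =
      ∫ y, fourierHat (fun η => f (x, η)) y * shiftT t a (z + (y, 0)) := by
  have hn : (0 : ℝ) ≤ n := n.cast_nonneg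
  set L : Fin n → Phase n → ℂ := fun j ζ => ((t * z.2 j : ℝ) : ℂ) + coordXi j ζ with hL
  have hLs : ∀ j, Symb 1 (L j) := fun j => symb_const_add_coordXi _ j
  have h1 : ∀ j, Symb (m + 1) fun ζ => L j ζ * f ζ := fun j => ((hLs j).mul hf).mono (by linarith)
  have h2 : ∀ j, Symb (m + 2) fun ζ => L j ζ * (L j ζ * f ζ) := fun j =>
    ((hLs j).mul (h1 j)).mono (by linarith)
  have hb : ∀ η, bracketSq ((x, η) + (0, t • z.2)) * f (x, η) =
      f (x, η) + ∑ j, L j (x, η) * (L j (x, η) * f (x, η)) := by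
    intro η
    rw [bracketSq_eq, hL]
    simp only [coordXi, add_mul, one_mul, Finset.sum_mul]
    congr 1
    refine Finset.sum_congr rfl fun j _ => ?_
    simp; ring
  have i0 := integrable_fourierHat_mul hf (by linarith) ha x z
  have i2 := fun j => integrable_fourierHat_mul (h2 j) hm ha x z
  have hF : ∀ y, fourierHat (fun η => bracketSq ((x, η) + (0, t • z.2)) * f (x, η)) y *
      a (z + (y, 0)) = fourierHat (fun η => f (x, η)) y * a (z + (y, 0)) +
      ∑ j, fourierHat (fun η => L j (x, η) * (L j (x, η) * f (x, η))) y * a (z + (y, 0)) := by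
    intro y
    simp only [hb]
    rw [fourierHat_add (hf.integrable (by linarith) x)
      (integrable_finsetSum _ fun j _ => (h2 j).integrable (by linarith) x),
      fourierHat_sum _ fun j _ => (h2 j).integrable (by linarith) x, add_mul, Finset.sum_mul]
  have hstep : ∀ j, ∫ y, fourierHat (fun η => L j (x, η) * (L j (x, η) * f (x, η))) y *
      a (z + (y, 0)) =
      -∫ y, fourierHat (fun η => f (x, η)) y * shiftD t j (shiftD t j a) (z + (y, 0)) := by
    intro j
    have s1 := integral_fourierHat_coord_mul (h1 j) (by linarith) ha t x z j
    have s2 := integral_fourierHat_coord_mul hf (by linarith) (ha.shiftD t j) t x z j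
    simp only [hL] at s1 ⊢
    rw [s1, s2, ← mul_assoc]
    simp
  have i3 := fun j => integrable_fourierHat_mul hf (by linarith)
    ((ha.shiftD t j).shiftD t j) x z
  simp only [hF]
  rw [integral_add i0 (integrable_finsetSum _ fun j _ => i2 j),
    integral_finsetSum _ fun j _ => i2 j]
  simp only [hstep, shiftT, mul_sub, Finset.mul_sum]
  rw [integral_sub i0 (integrable_finsetSum _ fun j _ => i3 j),
    integral_finsetSum _ fun j _ => i3 j, Finset.sum_neg_distrib, sub_eq_add_neg]

end ibp

/-- The regularized composition does not depend on the regularization parameter `K`. -/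
lemma bil_succ_shiftT_zero {K : ℕ} {m₁ m₂ : ℝ} {p b : Phase n → ℂ} (hp : Symb m₁ p)
    (hb : Symb m₂ b) (hK : -2 * (K : ℝ) + m₁ ≤ -((n : ℝ) + 1)) :
    bil (K + 1) p (shiftT 0 b) = bil K p b := by
  funext z
  have h := integral_fourierHat_bracketSq_mul (symb_amp (K + 1) hp z.2)
    (by push_cast; linarith) hb 0 z.1 z
  simp only [bil, ampKer_eq]
  rw [← h]
  congr 2; funext y; congr 2; funext η
  simp only [zero_smul, Prod.mk_zero_zero, add_zero]
  rw [← mul_assoc, bracketSq_mul_wgt_succ]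

/-- With `t = 1` the integration by parts produces the factor `⟨ξ + η⟩²`, the inverse of a weight at
the translated point, at which the amplitude is evaluated. -/
lemma bil_wgt_succ_shiftT_one {K : ℕ} (M : ℕ) {m₁ m₂ : ℝ} {p b : Phase n → ℂ} (hp : Symb m₁ p)
    (hb : Symb m₂ b) (hK : -2 * (K : ℝ) + m₁ ≤ -((n : ℝ) + 1)) :
    bil K (fun ζ => wgt (M + 1) ζ * p ζ) (shiftT 1 b) = bil K (fun ζ => wgt M ζ * p ζ) b := by
  funext z
  have hM : (0 : ℝ) ≤ M := M.cast_nonneg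
  have hs : Symb (m₁ - 2) (fun ζ => wgt (M + 1) ζ * p ζ) :=
    ((symb_wgt (M + 1)).mul hp).mono (by push_cast; linarith)
  have h := integral_fourierHat_bracketSq_mul (symb_amp K hs z.2) (by linarith) hb 1 z.1 z
  simp only [bil, ampKer_eq]
  rw [← h]
  congr 2; funext y; congr 2; funext η
  rw [one_smul, ← bracketSq_mul_wgt_succ M]
  ring

lemma bil_iterate_zero {K : ℕ} (k : ℕ) {m₁ m₂ : ℝ} {p b : Phase n → ℂ} (hp : Symb m₁ p)
    (hb : Symb m₂ b) (hK : -2 * (K : ℝ) + m₁ ≤ -((n : ℝ) + 1)) :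
    bil (K + k) p ((shiftT 0)^[k] b) = bil K p b := by
  induction k with
  | zero => rfl
  | succ k ih =>
    rw [Function.iterate_succ_apply', ← add_assoc, bil_succ_shiftT_zero hp (hb.iterate_shiftT 0 k),
      ih]
    push_cast; have : (0 : ℝ) ≤ k := k.cast_nonneg
    linarith

lemma bil_iterate_one {K : ℕ} (M : ℕ) {m₁ m₂ : ℝ} {p b : Phase n → ℂ} (hp : Symb m₁ p)
    (hb : Symb m₂ b) (hK : -2 * (K : ℝ) + m₁ ≤ -((n : ℝ) + 1)) :
    bil K (fun ζ => wgt M ζ * p ζ) ((shiftT 1)^[M] b) = bil K p b := by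
  induction M with
  | zero => congr 1; funext ζ; simp [wgt]
  | succ M ih =>
    rw [Function.iterate_succ_apply', bil_wgt_succ_shiftT_one M hp (hb.iterate_shiftT 1 M) hK, ih]

/-- The symbol of the product of `p(x,D)` and `a(x,D)`, with the regularization parameter `K`. It is
meaningful when `-2K` plus the order of `p` is at most `-(n+1)`. -/
def sharp (K : ℕ) (p a : Phase n → ℂ) : Phase n → ℂ := bil K p ((shiftT 0)^[K] a)

lemma sharp_eq_of_le {K K' : ℕ} {m₁ m₂ : ℝ} {p a : Phase n → ℂ} (hp : Symb m₁ p) (ha : Symb m₂ a)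
    (hK : -2 * (K : ℝ) + m₁ ≤ -((n : ℝ) + 1)) (h : K ≤ K') : sharp K' p a = sharp K p a := by
  obtain ⟨k, rfl⟩ := Nat.exists_eq_add_of_le h
  unfold sharp
  rw [add_comm K k, Function.iterate_add_apply, add_comm k K]
  exact bil_iterate_zero k hp (ha.iterate_shiftT 0 K) hK

/-- An alternative form of the product symbol, in which the amplitude has negative order and the
kernel needs no further regularization. -/
lemma sharp_eq_bil_zero {K M : ℕ} {m₁ m₂ : ℝ} {p a : Phase n → ℂ} (hp : Symb m₁ p) (ha : Symb m₂ a)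
    (hK : -2 * (K : ℝ) + m₁ ≤ -((n : ℝ) + 1)) (hM : -2 * (M : ℝ) + m₁ ≤ -((n : ℝ) + 1)) :
    sharp K p a = bil 0 (fun ζ => wgt M ζ * p ζ) ((shiftT 1)^[M] a) := by
  have h1 := bil_iterate_one M hp (ha.iterate_shiftT 0 K) hK
  have h2 := bil_iterate_zero (K := 0) K ((symb_wgt M).mul hp) (ha.iterate_shiftT 1 M)
    (by push_cast; linarith)
  -- The weights of both kinds can be present at once, since the operators that compensate them
  -- commute.
  rw [iterate_shiftT_comm 0 1 K M ha.1, zero_add] at h2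
  rw [← h2, h1]; rfl

/-! ### Fourier transforms of Schwartz functions as symbols -/

lemma fourierHat_eq_fourier (u : RSpace n → ℂ) (ξ : RSpace n) :
    fourierHat u ξ = FourierTransform.fourier u ((2 * Real.pi)⁻¹ • ξ) := by
  rw [Real.fourier_eq']
  simp only [fourierHat, smul_eq_mul]
  congr 1; funext y; congr 2
  rw [inner_smul_right]
  have : -2 * Real.pi * ((2 * Real.pi)⁻¹ * (inner ℝ y ξ : ℝ)) = -(inner ℝ y ξ : ℝ) := by
    have := Real.pi_pos; field_simp
  rw [this]; push_cast; ring

/-- The dilation `ξ ↦ (2π)⁻¹ ξ`. -/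
def dilation (n : ℕ) : RSpace n ≃L[ℝ] RSpace n :=
  ContinuousLinearEquiv.smulLeft (Units.mk0 ((2 * Real.pi)⁻¹) (by positivity))

lemma dilation_apply (ξ : RSpace n) : dilation n ξ = (2 * Real.pi)⁻¹ • ξ := rfl

/-- The Fourier transform preserves the Schwartz space. -/
lemma exists_schwartz_fourierHat (u : 𝓢(RSpace n, ℂ)) :
    ∃ h : 𝓢(RSpace n, ℂ), ∀ ξ, fourierHat (fun y => u y) ξ = h ξ := by
  refine ⟨SchwartzMap.compCLMOfContinuousLinearEquiv ℂ (dilation n) (FourierTransform.fourier u),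
    fun ξ => ?_⟩
  rw [fourierHat_eq_fourier]; rfl

/-- The Fourier transform is surjective on the Schwartz space. -/
lemma exists_fourierHat_eq_schwartz (h : 𝓢(RSpace n, ℂ)) :
    ∃ u : 𝓢(RSpace n, ℂ), ∀ ξ, fourierHat (fun y => u y) ξ = h ξ := by
  refine ⟨FourierTransformInv.fourierInv
    (SchwartzMap.compCLMOfContinuousLinearEquiv ℂ (dilation n).symm h), fun ξ => ?_⟩
  rw [fourierHat_eq_fourier]
  have h1 := FourierTransform.fourier_fourierInv_eq (F := 𝓢(RSpace n, ℂ))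
    (SchwartzMap.compCLMOfContinuousLinearEquiv ℂ (dilation n).symm h)
  have h2 := congrArg (fun g : 𝓢(RSpace n, ℂ) => g ((2 * Real.pi)⁻¹ • ξ)) h1
  refine Eq.trans ?_ (h2.trans ?_)
  · rfl
  · rw [← dilation_apply]
    simp

/-- A Schwartz function of `ξ` is a symbol of every order. -/
lemma symb_schwartz (h : 𝓢(RSpace n, ℂ)) (s : ℝ) : Symb s (fun z : Phase n => h z.2) := by
  have hb : ∀ (h : 𝓢(RSpace n, ℂ)) (s : ℝ), ∃ C, 0 ≤ C ∧
      ∀ z : Phase n, ‖h z.2‖ ≤ C * bracket z.2 ^ s := by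
    intro h s
    obtain ⟨k, hk⟩ := exists_nat_ge (-s)
    have h1 := fun x => SchwartzMap.one_add_le_sup_seminorm_apply (𝕜 := ℝ) (m := (k, 0)) (k := k)
      (n := 0) le_rfl le_rfl h x
    simp only [norm_iteratedFDeriv_zero] at h1
    set C := 2 ^ k * ((Finset.Iic (k, 0)).sup fun m : ℕ × ℕ => SchwartzMap.seminorm ℝ m.1 m.2) h
    refine ⟨C, by positivity, fun z => ?_⟩
    have h2 : bracket z.2 ^ (-s) * ‖h z.2‖ ≤ C := by
      refine le_trans ?_ (h1 z.2)
      gcongr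
      calc bracket z.2 ^ (-s) ≤ bracket z.2 ^ (k : ℝ) := bracket_rpow_le hk _
        _ = bracket z.2 ^ k := Real.rpow_natCast _ _
        _ ≤ _ := pow_le_pow_left₀ (bracket_pos _).le (bracket_le_one_add_norm _) _
    calc ‖h z.2‖ = (bracket z.2 ^ (-s) * ‖h z.2‖) * bracket z.2 ^ s := by
          rw [mul_right_comm, ← bracket_rpow_add]; simp
      _ ≤ _ := by
          have := bracket_rpow_pos z.2 s
          gcongr
  have hD : ∀ (h : 𝓢(RSpace n, ℂ)) (v : Phase n), dirD v (fun z : Phase n => h z.2) =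
      fun z => LineDeriv.lineDerivOp v.2 h z.2 := by
    intro h v; funext z
    have h1 : HasFDerivAt (fun z : Phase n => h z.2)
        ((fderiv ℝ h z.2) ∘L ContinuousLinearMap.snd ℝ _ _) z :=
      (h.differentiableAt.hasFDerivAt).comp z hasFDerivAt_snd
    simp only [dirD]
    rw [h1.fderiv, SchwartzMap.lineDerivOp_apply_eq_fderiv]; rfl
  refine ⟨(h.smooth ⊤).comp contDiff_snd, fun N => ?_⟩
  induction N generalizing h s with
  | zero => obtain ⟨C, _, hC⟩ := hb h s; exact ⟨C, hC⟩
  | succ N ih =>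
    obtain ⟨C, hC0, hC⟩ := hb h s
    choose A hA using fun j : Fin n => ih (LineDeriv.lineDerivOp (dirX j).2 h) s
    choose B hB using fun j : Fin n => ih (LineDeriv.lineDerivOp (dirXi j).2 h) (s - 1)
    have hA0 := fun j => (hA j).nonneg
    have hB0 := fun j => (hB j).nonneg
    have hSA := Finset.sum_nonneg fun j (_ : j ∈ Finset.univ) => hA0 j
    have hSB := Finset.sum_nonneg fun j (_ : j ∈ Finset.univ) => hB0 j
    have hA1 := fun j => Finset.single_le_sum (fun j _ => hA0 j) (Finset.mem_univ j)
    have hB1 := fun j => Finset.single_le_sum (fun j _ => hB0 j) (Finset.mem_univ j)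
    refine ⟨C + ∑ j, A j + ∑ j, B j, symB_succ.2 ⟨fun z => ?_, fun j => ?_, fun j => ?_⟩⟩
    · refine (hC z).trans ?_
      have := bracket_rpow_pos z.2 s
      gcongr; linarith
    · rw [partialX_eq, hD]
      exact (hA j).mono (by linarith [hA1 j]) le_rfl
    · rw [partialXi_eq, hD]
      exact (hB j).mono (by linarith [hB1 j]) le_rfl

/-! ### Pseudodifferential operators on Schwartz functions -/

/-- The Fourier transform of a function `u`, as a function on phase space. -/
def hatSymb (u : RSpace n → ℂ) : Phase n → ℂ := fun z => fourierHat u z.2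

lemma symb_hatSymb (u : 𝓢(RSpace n, ℂ)) (s : ℝ) : Symb s (hatSymb fun y => u y) := by
  obtain ⟨h, hh⟩ := exists_schwartz_fourierHat u
  have : (hatSymb fun y => u y) = fun z : Phase n => h z.2 := funext fun z => hh z.2
  rw [this]; exact symb_schwartz h s

lemma Symb.mul_hatSymb {m : ℝ} (hf : Symb m f) (u : 𝓢(RSpace n, ℂ)) (s : ℝ) :
    Symb s (fun z => f z * hatSymb (fun y => u y) z) := by
  have := hf.mul (symb_hatSymb u (s - m))
  simpa using this

lemma dirD_hatSymb (u : 𝓢(RSpace n, ℂ)) (j : Fin n) :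
    partialX j (hatSymb fun y => u y) = fun _ => 0 := by
  funext z
  have hs := (symb_hatSymb u 0).differentiable
  have h1 := fderiv_slice_fst hs z.1 z.2 0 (EuclideanSpace.single j 1)
  simp only [add_zero, Prod.mk.eta] at h1
  rw [partialX, ← h1]
  simp [hatSymb]

lemma shiftD_mul_hatSymb (u : 𝓢(RSpace n, ℂ)) (t : ℝ) (j : Fin n) (hf : Differentiable ℝ f) :
    shiftD t j (fun z => f z * hatSymb (fun y => u y) z) =
      fun z => shiftD t j f z * hatSymb (fun y => u y) z := by
  have h1 := dirD_mul (dirX j) hf (symb_hatSymb u 0).differentiable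
  rw [← partialX_eq, ← partialX_eq, ← partialX_eq, dirD_hatSymb] at h1
  funext z
  simp only [shiftD]
  rw [h1]; ring

lemma shiftT_mul_hatSymb (u : 𝓢(RSpace n, ℂ)) (t : ℝ) (hf : ContDiff ℝ ∞ f) :
    shiftT t (fun z => f z * hatSymb (fun y => u y) z) =
      fun z => shiftT t f z * hatSymb (fun y => u y) z := by
  funext z
  simp only [shiftT]
  have : ∀ j, shiftD t j (shiftD t j (fun z => f z * hatSymb (fun y => u y) z)) =
      fun z => shiftD t j (shiftD t j f) z * hatSymb (fun y => u y) z := by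
    intro j
    rw [shiftD_mul_hatSymb u t j (smooth_differentiable hf),
      shiftD_mul_hatSymb u t j (smooth_differentiable (smooth_shiftD t j hf))]
  simp only [this, sub_mul, Finset.sum_mul]

lemma iterate_shiftT_mul_hatSymb (u : 𝓢(RSpace n, ℂ)) (t : ℝ) (k : ℕ) (hf : ContDiff ℝ ∞ f) :
    (shiftT t)^[k] (fun z => f z * hatSymb (fun y => u y) z) =
      fun z => (shiftT t)^[k] f z * hatSymb (fun y => u y) z := by
  induction k with
  | zero => rfl
  | succ k ih =>
    rw [Function.iterate_succ_apply', ih, shiftT_mul_hatSymb u t (smooth_iterate_shiftT t k hf),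
      Function.iterate_succ_apply']

/-- The integral `∫ exp (i x·ξ) f (x, ξ) dξ` as a function of `x`. -/
def opInt (f : Phase n → ℂ) (x : RSpace n) : ℂ :=
  ∫ ξ, Complex.exp (Complex.I * ((inner ℝ x ξ : ℝ) : ℂ)) * f (x, ξ)

lemma pseudoOp_eq_opInt (a : Phase n → ℂ) (u : RSpace n → ℂ) (x : RSpace n) :
    pseudoOp a u x = cNorm n * opInt (fun z => a z * hatSymb u z) x := by
  simp only [pseudoOp, opInt, cNorm, hatSymb, mul_assoc]

lemma opInt_eq_fourierHat (f : Phase n → ℂ) (x : RSpace n) :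
    opInt f x = fourierHat (fun ξ => f (x, ξ)) (-x) := by
  simp only [opInt, fourierHat]
  congr 1; funext ξ
  simp [real_inner_comm]

lemma integrable_exp_I_mul {u : RSpace n → ℂ} (hu : Integrable u) (x : RSpace n) :
    Integrable fun ξ => Complex.exp (Complex.I * ((inner ℝ x ξ : ℝ) : ℂ)) * u ξ := by
  refine (integrable_exp_mul hu (-x)).congr (Eventually.of_forall fun ξ => ?_)
  simp [real_inner_comm]

lemma exists_opInt_bound {m : ℝ} (hf : Symb m f) (hm : m ≤ -((n : ℝ) + 1)) :
    ∃ C, 0 ≤ C ∧ ∀ x, ‖opInt f x‖ ≤ C * bracket x ^ (-((n : ℝ) + 1)) := by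
  obtain ⟨C, hC0, hC⟩ := exists_fourierHat_decay n
  obtain ⟨A, hA⟩ := hf.2 (n + 1)
  have := hA.nonneg
  refine ⟨C * A, by positivity, fun x => ?_⟩
  rw [opInt_eq_fourierHat, ← bracket_neg]
  exact hC hf hm hA x (-x)

lemma differentiable_opInt {m : ℝ} (hf : Symb m f) (hm : m + 1 < -(n : ℝ)) :
    Differentiable ℝ (opInt f) ∧
      ∀ x j, fderiv ℝ (opInt f) x (EuclideanSpace.single j 1) = opInt (shiftD 1 j f) x := by
  have h1 : ∀ (ξ : RSpace n) (z : Phase n), HasFDerivAt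
      (fun z : Phase n => ((inner ℝ z.1 ξ : ℝ) : ℂ))
      (Complex.ofRealCLM ∘L (innerSL ℝ ξ) ∘L ContinuousLinearMap.fst ℝ (RSpace n) (RSpace n)) z :=
    fun ξ z => (Complex.ofRealCLM ∘L (innerSL ℝ ξ) ∘L
      ContinuousLinearMap.fst ℝ (RSpace n) (RSpace n)).hasFDerivAt.congr_of_eventuallyEq
        (Eventually.of_forall fun w => by simp [real_inner_comm])
  have h2 : ∀ (ξ : RSpace n) (z : Phase n), HasFDerivAt (fun z : Phase n => f (z.1, ξ))
      ((fderiv ℝ f (z.1, ξ)) ∘L (ContinuousLinearMap.inl ℝ _ _) ∘L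
        (ContinuousLinearMap.fst ℝ _ _)) z := fun ξ z =>
    (hf.differentiable (z.1, ξ)).hasFDerivAt.comp z
      (HasFDerivAt.comp z (g := fun x : RSpace n => ((x, ξ) : Phase n))
        (hasFDerivAt_prodMk_left z.1 ξ) hasFDerivAt_fst)
  have hE : ∀ (ξ : RSpace n) (v : Phase n), dirD v (fun z : Phase n =>
      Complex.exp (Complex.I * ((inner ℝ z.1 ξ : ℝ) : ℂ)) * f (z.1, ξ)) = fun z =>
      Complex.exp (Complex.I * ((inner ℝ z.1 ξ : ℝ) : ℂ)) *
        (dirD (v.1, 0) f (z.1, ξ) + Complex.I * ((inner ℝ ξ v.1 : ℝ) : ℂ) * f (z.1, ξ)) := by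
    intro ξ v
    funext z
    have h3 := (((h1 ξ z).const_mul Complex.I).cexp.mul (h2 ξ z)).fderiv
    refine (congrArg (fun T : Phase n →L[ℝ] ℂ => T v) h3).trans ?_
    simp [dirD]
    ring
  have hX : ∀ (ξ : RSpace n) (j : Fin n), partialX j (fun z : Phase n =>
      Complex.exp (Complex.I * ((inner ℝ z.1 ξ : ℝ) : ℂ)) * f (z.1, ξ)) = fun z =>
      Complex.exp (Complex.I * ((inner ℝ z.1 ξ : ℝ) : ℂ)) * shiftD 1 j f (z.1, ξ) := by
    intro ξ j
    rw [partialX_eq, hE]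
    funext z
    simp [shiftD, coordXi, partialX_eq, EuclideanSpace.inner_single_right, mul_assoc]
  have hXi : ∀ (ξ : RSpace n) (j : Fin n), partialXi j (fun z : Phase n =>
      Complex.exp (Complex.I * ((inner ℝ z.1 ξ : ℝ) : ℂ)) * f (z.1, ξ)) = fun z => 0 := by
    intro ξ j
    rw [partialXi_eq, hE]
    funext z
    have : ((0, 0) : Phase n) = 0 := rfl
    simp [dirD, this]
  have key := differentiable_integral_param (F := fun z ξ =>
      Complex.exp (Complex.I * ((inner ℝ z.1 ξ : ℝ) : ℂ)) * f (z.1, ξ))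
    (fun ξ z => (((h1 ξ z).const_mul Complex.I).cexp.mul (h2 ξ z)).differentiableAt)
    (fun z => integrable_exp_I_mul (hf.integrable (by linarith) z.1) z.1) ?_ ?_ ?_
  · have hΦ : opInt f = fun y => (fun z : Phase n => ∫ ξ,
        Complex.exp (Complex.I * ((inner ℝ z.1 ξ : ℝ) : ℂ)) * f (z.1, ξ)) (0 + y, 0) := by
      funext y; simp [opInt]
    refine ⟨?_, fun y j => ?_⟩
    · rw [hΦ]; exact key.1.comp (by fun_prop)
    · rw [hΦ, fderiv_slice_fst key.1]
      change dirD (dirX j) _ _ = _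
      rw [key.2]
      simp only [← partialX_eq, hX, zero_add, opInt]
  · intro j z; simp only [hX]
    have := (hf.shiftD 1 j).continuous
    fun_prop
  · intro _ z; simp only [hXi]; exact continuous_const
  · intro z₀
    choose C hC0 hC using fun j => (hf.shiftD 1 j).exists_bound
    refine ⟨fun ξ => (∑ j, C j) * bracket ξ ^ (m + 1), (integrable_bracket_rpow hm).const_mul _,
      fun z _ ξ => ⟨fun j => ?_, fun j => ?_⟩⟩
    · rw [hX, norm_mul, norm_exp_I_inner, one_mul]
      refine (hC j (z.1, ξ)).trans ?_
      exact mul_le_mul_of_nonneg_right (Finset.single_le_sum (fun j _ => hC0 j)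
        (Finset.mem_univ j)) (bracket_rpow_pos ξ (m + 1)).le
    · rw [hXi]
      have := bracket_rpow_pos ξ (m + 1)
      have := Finset.sum_nonneg fun j (_ : j ∈ Finset.univ) => hC0 j
      simp only [norm_zero]
      positivity

lemma integrable_opInt {m : ℝ} (hf : Symb m f) (hm : m + 1 ≤ -((n : ℝ) + 1)) :
    Integrable (opInt f) := by
  obtain ⟨C, _, hC⟩ := exists_opInt_bound hf (by linarith)
  exact ((bracket_decay_integrable n).const_mul C).mono'
    (differentiable_opInt hf (by linarith)).1.continuous.aestronglyMeasurable
    (Eventually.of_forall hC)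

lemma fourierHat_opInt_shiftD {m : ℝ} (hf : Symb m f) (hm : m + 2 ≤ -((n : ℝ) + 1)) (j : Fin n)
    (ζ : RSpace n) : fourierHat (opInt (shiftD 1 j f)) ζ =
      Complex.I * (ζ j : ℂ) * fourierHat (opInt f) ζ := by
  obtain ⟨h1, h2⟩ := differentiable_opInt hf (by linarith)
  have h3 : (fun x => fderiv ℝ (opInt f) x (EuclideanSpace.single j 1)) = opInt (shiftD 1 j f) :=
    funext fun x => h2 x j
  have h4 := fourierHat_fderiv h1 (integrable_opInt hf (by linarith)) j
    (by rw [h3]; exact integrable_opInt (hf.shiftD 1 j) (by linarith)) ζ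
  rwa [h3] at h4

lemma opInt_shiftT {m : ℝ} (hf : Symb m f) (hm : m + 2 < -(n : ℝ)) (x : RSpace n) :
    opInt (shiftT 1 f) x = opInt f x - ∑ j, opInt (shiftD 1 j (shiftD 1 j f)) x := by
  simp only [opInt, shiftT, mul_sub, Finset.mul_sum]
  have h2 : ∀ j, Symb (m + 2) (shiftD 1 j (shiftD 1 j f)) := fun j =>
    ((hf.shiftD 1 j).shiftD 1 j).mono (by linarith)
  have i2 := fun j => integrable_exp_I_mul ((h2 j).integrable hm x) x
  rw [integral_sub (integrable_exp_I_mul (hf.integrable (by linarith) x) x)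
    (integrable_finsetSum _ fun j _ => i2 j), integral_finsetSum _ fun j _ => i2 j]

lemma fourierHat_opInt_shiftT {m : ℝ} (hf : Symb m f) (hm : m + 3 ≤ -((n : ℝ) + 1))
    (ζ : RSpace n) : fourierHat (opInt (shiftT 1 f)) ζ =
      bracketSq (0, ζ) * fourierHat (opInt f) ζ := by
  have h0 : opInt (shiftT 1 f) = fun x => opInt f x - ∑ j, opInt (shiftD 1 j (shiftD 1 j f)) x :=
    funext fun x => opInt_shiftT hf (by linarith) x
  have i2 : ∀ j, Integrable (opInt (shiftD 1 j (shiftD 1 j f))) := fun j =>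
    integrable_opInt ((hf.shiftD 1 j).shiftD 1 j) (by linarith)
  rw [h0, fourierHat_sub (integrable_opInt hf (by linarith))
    (integrable_finsetSum _ fun j _ => i2 j),
    fourierHat_sum _ fun j _ => i2 j]
  have h1 : ∀ j, fourierHat (opInt (shiftD 1 j (shiftD 1 j f))) ζ =
      -((ζ j : ℂ) * (ζ j : ℂ) * fourierHat (opInt f) ζ) := by
    intro j
    rw [fourierHat_opInt_shiftD (hf.shiftD 1 j) (by linarith),
      fourierHat_opInt_shiftD hf (by linarith)]
    linear_combination (ζ j : ℂ) * (ζ j : ℂ) * fourierHat (opInt f) ζ * Complex.I_mul_I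
  simp only [h1, bracketSq_eq, coordXi, Finset.sum_neg_distrib, add_mul, Finset.sum_mul]
  ring

/-- Since `1 - Δ` maps `opInt f` to `opInt (shiftT 1 f)`, the Fourier transform of `opInt f` decays
like any negative power of `⟨ζ⟩`. -/
lemma fourierHat_opInt_eq (M : ℕ) (hf : ∀ s, Symb s f) (ζ : RSpace n) :
    fourierHat (opInt f) ζ = wgt M (0, ζ) * fourierHat (opInt ((shiftT 1)^[M] f)) ζ := by
  induction M with
  | zero => simp [wgt]
  | succ M ih =>
    rw [Function.iterate_succ_apply',
      fourierHat_opInt_shiftT ((hf (-((n : ℝ) + 1) - 3 - 2 * M)).iterate_shiftT 1 M)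
      (by linarith), ih, ← bracketSq_mul_wgt_succ]
    ring

lemma exists_norm_fourierHat_opInt_le (hf : ∀ s, Symb s f) (s : ℝ) :
    ∃ C, 0 ≤ C ∧ ∀ ζ, ‖fourierHat (opInt f) ζ‖ ≤ C * bracket ζ ^ s := by
  obtain ⟨M, hM⟩ := exists_nat_ge (-s)
  obtain ⟨W, hW0, hW⟩ := (symb_wgt (n := n) M).exists_bound
  have hM0 : (0 : ℝ) ≤ M := M.cast_nonneg
  have hi := integrable_opInt ((hf (-((n : ℝ) + 1) - 1 - 2 * M)).iterate_shiftT 1 M) (by linarith)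
  refine ⟨W * ∫ x, ‖opInt ((shiftT 1)^[M] f) x‖, mul_nonneg hW0
    (integral_nonneg fun _ => norm_nonneg _), fun ζ => ?_⟩
  rw [fourierHat_opInt_eq M hf, norm_mul]
  have h1 := norm_fourierHat_le hi.norm (fun x => le_rfl) ζ
  have h2 := hW (0, ζ)
  have h3 : bracket ζ ^ (-2 * (M : ℝ)) ≤ bracket ζ ^ s := bracket_rpow_le (by linarith) _
  have := bracket_rpow_pos ζ (-2 * (M : ℝ))
  calc _ ≤ (W * bracket ζ ^ (-2 * (M : ℝ))) * ∫ x, ‖opInt ((shiftT 1)^[M] f) x‖ := by gcongr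
    _ ≤ (W * bracket ζ ^ s) * ∫ x, ‖opInt ((shiftT 1)^[M] f) x‖ := by
      have : 0 ≤ ∫ x, ‖opInt ((shiftT 1)^[M] f) x‖ := integral_nonneg fun _ => norm_nonneg _
      gcongr
    _ = _ := by ring

/-! ### The regularized composition is the symbol of the product -/

/-- Without the weight, the translation of the amplitude in `ξ` becomes a phase factor. -/
lemma ampKer_zero_eq (q : Phase n → ℂ) (x ξ y : RSpace n) :
    ampKer 0 q (x, ξ) y = Complex.exp (Complex.I * ((inner ℝ y ξ : ℝ) : ℂ)) *
      fourierHat (fun η => q (x, η)) y := by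
  simp only [ampKer, fourierHat, wgt, pow_zero, one_mul]
  have h := integral_add_left_eq_self (μ := volume) (fun η : RSpace n =>
    Complex.exp (-(Complex.I * ((inner ℝ η y : ℝ) : ℂ))) * q (x, η)) ξ
  rw [← h, ← integral_const_mul]
  congr 1; funext η
  simp only [Prod.mk_add_mk, add_zero]
  rw [← mul_assoc, ← Complex.exp_add]
  congr 2
  rw [inner_add_left, real_inner_comm ξ y]
  push_cast; ring

/-- The parallel formula of the Fourier transform, translated by `x`. -/
lemma integral_mul_fourierHat {q v : RSpace n → ℂ} (hq : Integrable q) (hv : Integrable v)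
    (x : RSpace n) :
    ∫ ζ, Complex.exp (Complex.I * ((inner ℝ x ζ : ℝ) : ℂ)) * (q ζ * fourierHat v ζ) =
      ∫ y, fourierHat q y * v (x + y) := by
  have hi : Integrable (fun p : RSpace n × RSpace n =>
      Complex.exp (Complex.I * ((inner ℝ (x - p.2) p.1 : ℝ) : ℂ)) * (q p.1 * v p.2))
      (volume.prod volume) := by
    refine (hq.mul_prod hv).bdd_mul (c := 1) ?_
      (Eventually.of_forall fun p => (norm_exp_I_inner _ _).le)
    exact (by fun_prop : Continuous fun p : RSpace n × RSpace n =>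
      Complex.exp (Complex.I * ((inner ℝ (x - p.2) p.1 : ℝ) : ℂ))).aestronglyMeasurable
  have h1 : ∀ ζ, Complex.exp (Complex.I * ((inner ℝ x ζ : ℝ) : ℂ)) * (q ζ * fourierHat v ζ) =
      ∫ y, Complex.exp (Complex.I * ((inner ℝ (x - y) ζ : ℝ) : ℂ)) * (q ζ * v y) := by
    intro ζ
    simp only [fourierHat]
    rw [← mul_assoc, ← integral_const_mul]
    congr 1; funext y
    rw [inner_sub_left]
    push_cast
    rw [mul_sub, sub_eq_add_neg, Complex.exp_add]
    ring
  simp only [h1]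
  rw [integral_integral_swap hi, ← integral_add_left_eq_self _ x]
  congr 1; funext y
  simp only [fourierHat]
  rw [← integral_mul_const]
  congr 1; funext ζ
  have : x - (x + y) = -y := by abel
  rw [this, inner_neg_left, real_inner_comm]
  push_cast; ring_nf

/-- The composition formula when the left factor has negative order. -/
lemma pseudoOp_comp_of_neg {m₁ m₂ : ℝ} {q b : Phase n → ℂ} (hq : Symb m₁ q)
    (hm : m₁ ≤ -((n : ℝ) + 1)) (hb : Symb m₂ b) (u : 𝓢(RSpace n, ℂ)) (x : RSpace n) :
    pseudoOp q (pseudoOp b fun y => u y) x = pseudoOp (bil 0 q b) (fun y => u y) x := by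
  set F : Phase n → ℂ := fun z => b z * hatSymb (fun y => u y) z with hF
  have hFs : ∀ s, Symb s F := fun s => hb.mul_hatSymb u s
  have hv : (pseudoOp b fun y => u y) = fun y => cNorm n * opInt F y :=
    funext fun y => pseudoOp_eq_opInt b _ y
  have hvi : Integrable fun y => cNorm n * opInt F y :=
    (integrable_opInt (hFs (-((n : ℝ) + 2))) (by linarith)).const_mul _
  have hqi := hq.integrable (by linarith) x
  have h1 := integral_mul_fourierHat hqi hvi x
  have hL : pseudoOp q (pseudoOp b fun y => u y) x = cNorm n *
      ∫ y, fourierHat (fun η => q (x, η)) y * (cNorm n * opInt F (x + y)) := by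
    rw [← h1, hv, pseudoOp_eq_opInt]; rfl
  obtain ⟨C, hC0, hC⟩ := exists_fourierHat_decay n
  obtain ⟨A, hA⟩ := hq.2 (n + 1)
  obtain ⟨B, hB0, hB⟩ := (hFs (-((n : ℝ) + 1))).exists_bound
  have hA0 := hA.nonneg
  have hi : Integrable (fun p : RSpace n × RSpace n =>
      Complex.exp (Complex.I * ((inner ℝ (x + p.1) p.2 : ℝ) : ℂ)) *
        (fourierHat (fun η => q (x, η)) p.1 * F (x + p.1, p.2))) (volume.prod volume) := by
    refine (((bracket_decay_integrable n).const_mul (C * A)).mul_prod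
      ((bracket_decay_integrable n).const_mul B)).mono' ?_ (Eventually.of_forall fun p => ?_)
    · have c1 := continuous_fourierHat hqi
      have c2 := (hFs 0).continuous
      exact (by fun_prop : Continuous fun p : RSpace n × RSpace n =>
        Complex.exp (Complex.I * ((inner ℝ (x + p.1) p.2 : ℝ) : ℂ)) *
        (fourierHat (fun η => q (x, η)) p.1 * F (x + p.1, p.2))).aestronglyMeasurable
    · rw [norm_mul, norm_exp_I_inner, one_mul, norm_mul]
      have h2 := hC hq hm hA x p.1
      have h3 := hB (x + p.1, p.2)
      have := bracket_rpow_pos p.1 (-((n : ℝ) + 1))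
      gcongr
  have hR : pseudoOp (bil 0 q b) (fun y => u y) x = cNorm n * (cNorm n * ∫ ξ, ∫ y,
      Complex.exp (Complex.I * ((inner ℝ (x + y) ξ : ℝ) : ℂ)) *
        (fourierHat (fun η => q (x, η)) y * F (x + y, ξ))) := by
    rw [pseudoOp_eq_opInt]
    congr 1
    rw [opInt, ← integral_const_mul]
    congr 1; funext ξ
    simp only [bil]
    have h2 : ∀ y, Complex.exp (Complex.I * ((inner ℝ (x + y) ξ : ℝ) : ℂ)) *
        (fourierHat (fun η => q (x, η)) y * F (x + y, ξ)) =
        (Complex.exp (Complex.I * ((inner ℝ x ξ : ℝ) : ℂ)) * hatSymb (fun y => u y) (x, ξ)) *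
          (ampKer 0 q (x, ξ) y * b ((x, ξ) + (y, 0))) := by
      intro y
      rw [ampKer_zero_eq, inner_add_left, hF]
      simp only [Prod.mk_add_mk, add_zero, hatSymb]
      push_cast
      rw [mul_add, Complex.exp_add]
      ring
    simp only [h2]
    rw [integral_const_mul]
    ring
  rw [hL, hR]
  congr 1
  rw [integral_integral_swap (f := fun ξ y =>
      Complex.exp (Complex.I * ((inner ℝ (x + y) ξ : ℝ) : ℂ)) *
        (fourierHat (fun η => q (x, η)) y * F (x + y, ξ))) hi.swap, ← integral_const_mul]
  congr 1; funext y
  rw [mul_left_comm]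
  congr 1
  rw [opInt, ← integral_const_mul]
  congr 1; funext ξ
  ring

/-- The function `sharp K p a` is the symbol of the product of `p(x,D)` and `a(x,D)`. -/
theorem isSharp_sharp {K : ℕ} {m₁ m₂ : ℝ} {p a : Phase n → ℂ} (hp : Symb m₁ p) (ha : Symb m₂ a)
    (hK : -2 * (K : ℝ) + m₁ ≤ -((n : ℝ) + 1)) : IsSharp p a (sharp K p a) := by
  intro u x
  obtain ⟨M, hM⟩ := exists_nat_ge (m₁ + ((n : ℝ) + 1))
  have hM0 : (0 : ℝ) ≤ M := M.cast_nonneg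
  rw [sharp_eq_bil_zero (M := M) hp ha hK (by linarith),
    ← pseudoOp_comp_of_neg ((symb_wgt M).mul hp) (by linarith) (ha.iterate_shiftT 1 M) u x]
  -- The weight `⟨ζ⟩ ^ (-2M)` from the Fourier transform of `a(x,D) u` is given to `p`.
  have hhat : ∀ ζ, fourierHat (pseudoOp a fun y => u y) ζ =
      wgt M (0, ζ) * fourierHat (pseudoOp ((shiftT 1)^[M] a) fun y => u y) ζ := by
    intro ζ
    have h1 : ∀ b : Phase n → ℂ, (pseudoOp b fun y => u y) =
        fun y => cNorm n * opInt (fun z => b z * hatSymb (fun y => u y) z) y := fun b =>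
      funext fun y => pseudoOp_eq_opInt b _ y
    rw [h1, h1, fourierHat_const_mul, fourierHat_const_mul,
      fourierHat_opInt_eq M (fun s => ha.mul_hatSymb u s), iterate_shiftT_mul_hatSymb u 1 M ha.1]
    ring
  simp only [pseudoOp, hhat]
  congr 2; funext ζ
  have : wgt M (x, ζ) = wgt M (0, ζ) := rfl
  rw [this]; ring

/-- The Fourier inversion formula, in the normalization of `fourierHat`. -/
lemma fourierHat_inversion {v : RSpace n → ℂ} (hc : Continuous v) (hi : Integrable v)
    (hi' : Integrable (fourierHat v)) (x : RSpace n) :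
    cNorm n * ∫ ζ, Complex.exp (Complex.I * ((inner ℝ x ζ : ℝ) : ℂ)) * fourierHat v ζ = v x := by
  have hpi : (2 * Real.pi) ≠ 0 := by positivity
  have hF : FourierTransform.fourier v = fun w => fourierHat v ((2 * Real.pi) • w) := by
    funext w
    rw [fourierHat_eq_fourier, smul_smul, inv_mul_cancel₀ hpi, one_smul]
  have hFi : Integrable (FourierTransform.fourier v) := by
    rw [hF]; exact hi'.comp_smul hpi
  have h1 := hi.fourierInv_fourier_eq hFi hc.continuousAt (v := x)
  rw [← h1, Real.fourierInv_eq', hF]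
  have h2 := Measure.integral_comp_smul (volume : Measure (RSpace n)) (fun ζ =>
    Complex.exp (Complex.I * ((inner ℝ x ζ : ℝ) : ℂ)) * fourierHat v ζ) (2 * Real.pi)
  have h3 : ∀ w : RSpace n, Complex.exp (((2 * Real.pi * inner ℝ w x : ℝ) : ℂ) * Complex.I) •
      fourierHat v ((2 * Real.pi) • w) =
      Complex.exp (Complex.I * ((inner ℝ x ((2 * Real.pi) • w) : ℝ) : ℂ)) *
        fourierHat v ((2 * Real.pi) • w) := by
    intro w
    rw [smul_eq_mul, inner_smul_right, real_inner_comm, mul_comm Complex.I]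
  simp only [h3]
  rw [h2, abs_of_pos (by positivity), cNorm]
  simp

/-- The identity operator: `1 # a = a`. -/
lemma isSharp_one {m : ℝ} {a : Phase n → ℂ} (ha : Symb m a) : IsSharp (fun _ => 1) a a := by
  intro u x
  set F : Phase n → ℂ := fun z => a z * hatSymb (fun y => u y) z with hF
  have hFs : ∀ s, Symb s F := fun s => ha.mul_hatSymb u s
  have hv : (pseudoOp a fun y => u y) = fun y => cNorm n * opInt F y :=
    funext fun y => pseudoOp_eq_opInt a _ y
  have hc : Continuous fun y => cNorm n * opInt F y :=
    continuous_const.mul (differentiable_opInt (hFs (-((n : ℝ) + 2))) (by linarith)).1.continuous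
  have hi : Integrable fun y => cNorm n * opInt F y :=
    (integrable_opInt (hFs (-((n : ℝ) + 2))) (by linarith)).const_mul _
  obtain ⟨C, hC0, hC⟩ := exists_norm_fourierHat_opInt_le hFs (-((n : ℝ) + 1))
  have hi' : Integrable (fourierHat fun y => cNorm n * opInt F y) := by
    have : (fourierHat fun y => cNorm n * opInt F y) = fun ζ => cNorm n * fourierHat (opInt F) ζ :=
      funext fun ζ => fourierHat_const_mul _ _ ζ
    rw [this]
    refine Integrable.const_mul ?_ _
    exact ((bracket_decay_integrable n).const_mul C).mono'
      (continuous_fourierHat (integrable_opInt (hFs (-((n : ℝ) + 2)))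
        (by linarith))).aestronglyMeasurable (Eventually.of_forall hC)
  have h1 := fourierHat_inversion hc hi hi' x
  rw [hv]
  refine Eq.trans ?_ h1
  rw [pseudoOp, cNorm]
  simp

/-- A continuous symbol is determined by its operator on Schwartz functions. -/
lemma eq_of_pseudoOp_eq {c d : Phase n → ℂ} (hc : Continuous c) (hd : Continuous d)
    (h : ∀ (u : 𝓢(RSpace n, ℂ)) (x : RSpace n),
      pseudoOp c (fun y => u y) x = pseudoOp d (fun y => u y) x) : c = d := by
  funext z
  obtain ⟨x, ξ₀⟩ := z
  set e : RSpace n → ℂ := fun ξ => Complex.exp (Complex.I * ((inner ℝ x ξ : ℝ) : ℂ)) with he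
  have hec : Continuous e := by fun_prop
  have h1 : Continuous fun ξ => e ξ * c (x, ξ) := by fun_prop
  have h2 : Continuous fun ξ => e ξ * d (x, ξ) := by fun_prop
  have key : ∀ᵐ ξ, e ξ * c (x, ξ) = e ξ * d (x, ξ) := by
    refine ae_eq_of_integral_contDiff_smul_eq h1.locallyIntegrable h2.locallyIntegrable
      fun g hg hgs => ?_
    have hgs' : HasCompactSupport fun ξ => (g ξ : ℂ) := hgs.comp_left (g := Complex.ofReal) rfl
    have hg' : ContDiff ℝ ∞ fun ξ => (g ξ : ℂ) := Complex.ofRealCLM.contDiff.comp hg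
    obtain ⟨u, hu⟩ := exists_fourierHat_eq_schwartz (hgs'.toSchwartzMap hg')
    have h3 := h u x
    simp only [pseudoOp, hu] at h3
    have h4 : (((2 * Real.pi) ^ n : ℝ) : ℂ)⁻¹ ≠ 0 := by
      have := Real.pi_pos
      simp [this.ne']
    have h5 := mul_left_cancel₀ h4 h3
    have h6 : ∀ ξ, (hgs'.toSchwartzMap hg') ξ = (g ξ : ℂ) := fun ξ => rfl
    simp only [h6] at h5
    refine Eq.trans ?_ (h5.trans ?_)
    · congr 1; funext ξ; rw [Complex.real_smul, mul_comm]
    · congr 1; funext ξ; rw [Complex.real_smul, mul_comm]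
  have h7 := congrFun (Continuous.ae_eq_iff_eq volume h1 h2 |>.1 key) ξ₀
  exact mul_left_cancel₀ (Complex.exp_ne_zero _) h7

lemma Adm.le' {K : ℕ} {m : ℝ} (h : Adm n K m) : Adm n K 0 := by
  unfold Adm at *
  have := abs_nonneg m
  simp; linarith

lemma sharp_one {K : ℕ} {m : ℝ} {a : Phase n → ℂ} (ha : Symb m a) (hK : Adm n K 0) :
    sharp K (fun _ => 1) a = a := by
  have h1 := Symb.const (n := n) 1
  refine eq_of_pseudoOp_eq (smooth_bil h1 (ha.iterate_shiftT 0 K) hK).continuous ha.continuous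
    fun u x => ?_
  -- Both sides are symbols of the product of the identity and `a(x,D)`.
  rw [← isSharp_one ha u x, isSharp_sharp h1 ha hK.le u x]

/-! ### The remainder of the composition -/

/-- A symbol varies in `ξ` at the rate of its `ξ`-derivatives, which gain one order. -/
lemma norm_sub_translate_le {m A : ℝ} {p : Phase n → ℂ} (hs : ContDiff ℝ ∞ p)
    (hp : ∀ j z, ‖partialXi j p z‖ ≤ A * bracket z.2 ^ (m - 1)) (hA : 0 ≤ A)
    (z : Phase n) (η : RSpace n) :
    ‖p (z + (0, η)) - p z‖ ≤
      n * 2 ^ |m - 1| * A * bracket z.2 ^ (m - 1) * bracket η ^ (|m - 1| + 1) := by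
  set h : ℝ → ℂ := fun t => p (z + t • (0, η)) with hh
  have hd : ∀ t, HasDerivAt h (fderiv ℝ p (z + t • (0, η)) (0, η)) t := by
    intro t
    have h1 : HasDerivAt (fun t : ℝ => z + t • ((0, η) : Phase n)) (0, η) t := by
      simpa using ((hasDerivAt_id t).smul_const ((0, η) : Phase n)).const_add z
    exact ((smooth_differentiable hs _).hasFDerivAt.comp_hasDerivAt t h1)
  have hz := bracket_rpow_pos z.2 (m - 1)
  have hη := bracket_rpow_pos η |m - 1|
  have hb : ∀ t ∈ Set.Ico (0 : ℝ) 1, ‖fderiv ℝ p (z + t • (0, η)) (0, η)‖ ≤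
      n * 2 ^ |m - 1| * A * bracket z.2 ^ (m - 1) * bracket η ^ (|m - 1| + 1) := by
    intro t ht
    have ht1 : bracket (t • η) ≤ bracket η := by
      unfold bracket
      have : ‖t • η‖ ≤ ‖η‖ := by
        rw [norm_smul, Real.norm_of_nonneg ht.1]
        exact mul_le_of_le_one_left (norm_nonneg _) ht.2.le
      gcongr
    have h2 : ∀ j, ‖partialXi j p (z + t • (0, η))‖ ≤
        A * (2 ^ |m - 1| * bracket z.2 ^ (m - 1) * bracket η ^ |m - 1|) := by
      intro j
      refine (hp j _).trans (mul_le_mul_of_nonneg_left ?_ hA)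
      have e : (z + t • ((0, η) : Phase n)).2 = z.2 + t • η := by simp
      rw [e]
      refine (bracket_add_rpow_le _ _ _).trans (mul_le_mul_of_nonneg_left ?_ (by positivity))
      exact Real.rpow_le_rpow (bracket_pos _).le ht1 (abs_nonneg _)
    rw [fderiv_eq_sum]
    simp only [add_apply, sum_apply,
      ContinuousLinearMap.smulRight_apply, ContinuousLinearMap.comp_apply,
      ContinuousLinearMap.coe_fst', ContinuousLinearMap.coe_snd', map_zero, zero_smul,
      Finset.sum_const_zero, zero_add]
    refine (norm_sum_le _ _).trans ?_
    have h3 : ∀ j ∈ (Finset.univ : Finset (Fin n)),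
        ‖(EuclideanSpace.proj j : RSpace n →L[ℝ] ℝ) η • partialXi j p (z + t • (0, η))‖ ≤
        bracket η * (A * (2 ^ |m - 1| * bracket z.2 ^ (m - 1) * bracket η ^ |m - 1|)) := by
      intro j _
      rw [norm_smul]
      refine mul_le_mul ?_ (h2 j) (norm_nonneg _) (bracket_pos _).le
      exact (PiLp.norm_apply_le η j).trans (norm_le_bracket η)
    refine (Finset.sum_le_sum h3).trans (le_of_eq ?_)
    rw [bracket_rpow_add, Real.rpow_one]
    simp; ring
  have := norm_image_sub_le_of_norm_deriv_le_segment_01' (f := h)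
    (fun t _ => (hd t).hasDerivWithinAt) hb
  simpa only [hh, one_smul, zero_smul, add_zero] using this

/-- The increment of `p` in `ξ`, based at the frequency `ξ₀`. -/
def xiDiff (ξ₀ : RSpace n) (p : Phase n → ℂ) (ζ : Phase n) : ℂ := p (ζ + (0, ξ₀)) - p (ζ.1, ξ₀)

lemma dirD_freeze (ξ₀ : RSpace n) (v : Phase n) (hf : ContDiff ℝ ∞ f) :
    dirD v (fun ζ => f (ζ.1, ξ₀)) = fun ζ => dirD (v.1, 0) f (ζ.1, ξ₀) := by
  funext ζ
  have h : HasFDerivAt (fun ζ : Phase n => f (ζ.1, ξ₀))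
      ((fderiv ℝ f (ζ.1, ξ₀)) ∘L (ContinuousLinearMap.inl ℝ _ _) ∘L
        (ContinuousLinearMap.fst ℝ _ _)) ζ :=
    (smooth_differentiable hf (ζ.1, ξ₀)).hasFDerivAt.comp ζ
      (HasFDerivAt.comp ζ (g := fun x : RSpace n => ((x, ξ₀) : Phase n))
        (hasFDerivAt_prodMk_left ζ.1 ξ₀) hasFDerivAt_fst)
  unfold dirD
  rw [h.fderiv]
  rfl

/-- A symbol at a fixed frequency is a symbol of order `0`. -/
lemma Symb.freeze {m : ℝ} (hf : Symb m f) (ξ₀ : RSpace n) : Symb 0 (fun ζ => f (ζ.1, ξ₀)) := by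
  refine ⟨hf.1.comp (contDiff_fst.prodMk contDiff_const), fun N => ?_⟩
  obtain ⟨A, hA⟩ := hf.2 N
  have hA0 := hA.nonneg
  have := bracket_rpow_pos ξ₀ m
  refine ⟨A * bracket ξ₀ ^ m, ?_⟩
  have hs := hf.1
  clear hf
  induction N generalizing f with
  | zero => intro z; simpa [SymAt] using hA (z.1, ξ₀)
  | succ N ih =>
    rw [symB_succ] at hA ⊢
    refine ⟨fun z => by simpa using hA.1 (z.1, ξ₀), fun j => ?_, fun j => ?_⟩
    · rw [partialX_eq, dirD_freeze _ _ hs]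
      exact ih (hA.2.1 j) (smooth_partialX j hs)
    · rw [partialXi_eq, dirD_freeze _ _ hs]
      have : (fun ζ : Phase n => dirD ((dirXi j : Phase n).1, 0) f (ζ.1, ξ₀)) = fun _ => 0 := by
        funext ζ
        exact map_zero (fderiv ℝ f (ζ.1, ξ₀))
      rw [this]
      exact symAt_zero N _ (by positivity)

lemma dirD_xiDiff (ξ₀ : RSpace n) (v : Phase n) (hf : ContDiff ℝ ∞ f) :
    dirD v (xiDiff ξ₀ f) =
      fun ζ => dirD v f (ζ + (0, ξ₀)) - dirD (v.1, 0) f (ζ.1, ξ₀) := by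
  have h1 : Differentiable ℝ fun ζ : Phase n => f (ζ + (0, ξ₀)) :=
    (smooth_differentiable hf).comp (by fun_prop)
  have h2 : Differentiable ℝ fun ζ : Phase n => f (ζ.1, ξ₀) :=
    (smooth_differentiable hf).comp (by fun_prop)
  change dirD v (fun ζ => f (ζ + (0, ξ₀)) - f (ζ.1, ξ₀)) = _
  rw [dirD_sub v h1 h2, dirD_comp_add_right, dirD_freeze _ _ hf]

lemma Symb.xiDiff {m : ℝ} (hf : Symb m f) (ξ₀ : RSpace n) : Symb |m| (xiDiff ξ₀ f) :=
  ((hf.translate ξ₀).mono (le_abs_self m)).sub ((hf.freeze ξ₀).mono (abs_nonneg m))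

/-- The increment from `ξ₀` is `O(⟨ξ₀⟩ ^ (m - 1))`, one order better than `p` itself. -/
lemma symB_xiDiff {N : ℕ} {m s A : ℝ} (hf : SymB (N + 1) m A f) (hs : ContDiff ℝ ∞ f)
    (hm : |m - 1| + 2 * N + 1 ≤ s) (ξ₀ : RSpace n) :
    SymB N s ((n + 1) * 2 ^ (|m - 1| + N) * A * bracket ξ₀ ^ (m - 1)) (xiDiff ξ₀ f) := by
  have hA := hf.nonneg
  have hb := bracket_rpow_pos ξ₀ (m - 1)
  have hn : (0 : ℝ) ≤ n := n.cast_nonneg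
  have key : ∀ {N : ℕ} {f : Phase n → ℂ}, SymB (N + 1) m A f → ContDiff ℝ ∞ f →
      |m - 1| + 2 * N + 1 ≤ s → ∀ z, ‖_root_.xiDiff ξ₀ f z‖ ≤
        (n + 1) * 2 ^ (|m - 1| + N) * A * bracket ξ₀ ^ (m - 1) * bracket z.2 ^ s := by
    intro N f hf hs hm z
    have h1 := norm_sub_translate_le hs (fun j w => ((symB_succ.1 hf).2.2 j).bound w) hA
      (z.1, ξ₀) z.2
    have e : ((z.1, ξ₀) : Phase n) + (0, z.2) = z + (0, ξ₀) := by
      ext1 <;> simp [add_comm]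
    rw [e] at h1
    have hN : (0 : ℝ) ≤ N := N.cast_nonneg
    refine h1.trans (mul_le_mul ?_ (bracket_rpow_le (by linarith) _) (bracket_rpow_pos _ _).le
      (by positivity))
    have : (2 : ℝ) ^ |m - 1| ≤ 2 ^ (|m - 1| + N) :=
      Real.rpow_le_rpow_of_exponent_le one_le_two (by linarith)
    gcongr
    linarith
  induction N generalizing f s with
  | zero => exact key hf hs hm
  | succ N ih =>
    have hN : (0 : ℝ) ≤ N := N.cast_nonneg
    push_cast at hm
    have hf' := symB_succ.1 hf
    rw [symB_succ]
    refine ⟨key hf hs (by push_cast; exact hm), fun j => ?_, fun j => ?_⟩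
    · have e : partialX j (_root_.xiDiff ξ₀ f) = _root_.xiDiff ξ₀ (partialX j f) := by
        rw [partialX_eq, dirD_xiDiff _ _ hs]; rfl
      rw [e]
      refine (ih (hf'.2.1 j) (smooth_partialX j hs) (s := s) (by linarith) key).mono ?_ le_rfl
      have : (2 : ℝ) ^ (|m - 1| + N) ≤ 2 ^ (|m - 1| + (N + 1 : ℕ)) :=
        Real.rpow_le_rpow_of_exponent_le one_le_two (by push_cast; linarith)
      gcongr
    · have e : partialXi j (_root_.xiDiff ξ₀ f) = fun ζ => partialXi j f (ζ + (0, ξ₀)) := by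
        rw [partialXi_eq, dirD_xiDiff _ _ hs]
        funext ζ
        have : dirD ((dirXi j : Phase n).1, 0) f (ζ.1, ξ₀) = 0 := map_zero (fderiv ℝ f (ζ.1, ξ₀))
        rw [this, sub_zero]; rfl
      rw [e]
      refine (((hf'.2.2 j).of_le (Nat.le_succ N)).translate (s := s - 1) (by linarith) ξ₀).mono
        ?_ le_rfl
      have : (2 : ℝ) ^ (|m - 1| + N) ≤ 2 ^ (|m - 1| + (N + 1 : ℕ)) :=
        Real.rpow_le_rpow_of_exponent_le one_le_two (by push_cast; linarith)
      calc 2 ^ (|m - 1| + N) * A * bracket ξ₀ ^ (m - 1)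
          ≤ 1 * 2 ^ (|m - 1| + (N + 1 : ℕ)) * A * bracket ξ₀ ^ (m - 1) := by rw [one_mul]; gcongr
        _ ≤ _ := by gcongr; linarith


/-- The kernel of the remainder is one order better than the kernel of `p`. -/
lemma exists_ampKer_sub_bound {K : ℕ} {m : ℝ} (hK : Adm n K (|m| + 2)) : ∃ C : ℝ, 0 ≤ C ∧
    ∀ {p : Phase n → ℂ} {A : ℝ}, Symb m p → SymB (n + 2) m A p → ∀ z y,
    ‖ampKer K p z y - p z * ampKer K (fun _ => 1) z y‖ ≤
      C * A * bracket z.2 ^ (m - 1) * bracket y ^ (-((n : ℝ) + 1)) := by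
  obtain ⟨C, hC0, hC⟩ := exists_fourierHat_decay n
  obtain ⟨W, hW⟩ := (symb_wgt (n := n) K).2 (n + 1)
  have hW0 := hW.nonneg
  unfold Adm at hK
  rw [abs_of_nonneg (by positivity : 0 ≤ |m| + 2)] at hK
  have hn : (0 : ℝ) ≤ n := n.cast_nonneg
  have hm1 : |m - 1| ≤ |m| + 1 := by simpa using abs_sub m 1
  have hK1 : Adm n K m := by unfold Adm; linarith
  refine ⟨C * (2 ^ (n + 1) * (W * ((n + 1) * 2 ^ (|m - 1| + (n + 1 : ℕ))))), by positivity, ?_⟩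
  intro p A hs hp z y
  have h1 := symB_xiDiff (s := |m| + 2 * (n + 1 : ℕ) + 2) hp hs.1 (by linarith) z.2
  have hsd := hs.xiDiff z.2
  have h2 : SymB (n + 1) (-2 * K + (|m| + 2 * (n + 1 : ℕ) + 2)) _
      (fun ζ => wgt K ζ * xiDiff z.2 p ζ) := fun ζ =>
    (hW ζ).mul (h1 ζ) (symb_wgt K).1 hsd.1
  have h3 := hC (((symb_wgt K).mul hsd).mono (m₂ := -2 * K + (|m| + 2 * (n + 1 : ℕ) + 2)) ?_) ?_ h2
    z.1 y
  · have e : ampKer K p z y - p z * ampKer K (fun _ => 1) z y =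
        fourierHat (fun η => wgt K (z.1, η) * xiDiff z.2 p (z.1, η)) y := by
      have hi1 := integrable_amp hs hK1 z
      have hi2 := integrable_amp (Symb.const 1) (K := K) hK1.le' z
      rw [ampKer, ampKer, ← fourierHat_const_mul, ← fourierHat_sub hi1 (hi2.const_mul _)]
      congr 1
      funext η
      have e1 : z + (0, η) = (z.1, η) + (0, z.2) := by ext1 <;> simp [add_comm]
      have e2 : (wgt K (z.1, η) : ℂ) = wgt K (0, η) := rfl
      rw [xiDiff, ← e1, e2]
      ring
    rw [e]
    refine h3.trans (le_of_eq ?_); ring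
  · have : (0 : ℝ) ≤ (n + 1 : ℕ) := Nat.cast_nonneg _
    linarith
  · push_cast; linarith

/-- The error of replacing `p` in the composition integral by its value at `z`. For
`b = (1 - Δ_x) ^ K a` it is `p # a - p a`, see `rem_iterate`. -/
def rem (K : ℕ) (p b : Phase n → ℂ) (z : Phase n) : ℂ :=
  bil K p b z - p z * bil K (fun _ => 1) b z

section linear

variable {K : ℕ} {m m₁ m₂ : ℝ} {p q b : Phase n → ℂ}

lemma bil_sub (hp : Symb m₁ p) (hq : Symb m₁ q) (hb : Symb m₂ b) (hK : Adm n K m₁) (z : Phase n) :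
    bil K (fun z => p z - q z) b z = bil K p b z - bil K q b z := by
  unfold bil
  rw [← mul_sub, ← integral_sub (integrable_ampKer_mul hp hb hK z)
    (integrable_ampKer_mul hq hb hK z)]
  congr 2
  funext y
  rw [← sub_mul, ampKer, ampKer, ampKer, ← fourierHat_sub (integrable_amp hp hK z)
    (integrable_amp hq hK z)]
  simp only [mul_sub]

lemma bil_zero_left : bil K (fun _ => 0) b = fun _ => 0 := by
  funext z; simp [bil, ampKer, fourierHat]

lemma rem_eq (hp : Symb m₁ p) (hb : Symb m₂ b) (hK : Adm n K m₁) (z : Phase n) : rem K p b z =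
    cNorm n * ∫ y, (ampKer K p z y - p z * ampKer K (fun _ => 1) z y) * b (z + (y, 0)) := by
  have h1 := integrable_ampKer_mul hp hb hK z
  have h2 := integrable_ampKer_mul (Symb.const 1) hb hK.le' z
  rw [rem, bil, bil, mul_left_comm, ← mul_sub, ← integral_const_mul,
    ← integral_sub h1 (h2.const_mul _)]
  congr 2; funext y; ring

lemma exists_rem_bound (hK : Adm n K (|m₁| + 2)) : ∃ C : ℝ, 0 ≤ C ∧ ∀ {p b : Phase n → ℂ}
    {A B m₂ : ℝ}, Symb m₁ p → Symb m₂ b → SymB (n + 2) m₁ A p →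
    (∀ z, ‖b z‖ ≤ B * bracket z.2 ^ m₂) → ∀ z,
    ‖rem K p b z‖ ≤ C * A * B * bracket z.2 ^ (m₁ + m₂ - 1) := by
  obtain ⟨C, hC0, hC⟩ := exists_ampKer_sub_bound hK
  set c := ∫ η : RSpace n, bracket η ^ (-((n : ℝ) + 1)) with hc
  have hc0 : 0 ≤ c := integral_nonneg fun η => (bracket_rpow_pos _ _).le
  have hK1 : Adm n K m₁ := by
    unfold Adm at hK ⊢
    rw [abs_of_nonneg (by positivity : 0 ≤ |m₁| + 2)] at hK
    linarith
  refine ⟨‖cNorm n‖ * C * c, by positivity, ?_⟩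
  intro p b A B m₂ hp hb hA hB z
  rw [rem_eq hp hb hK1, norm_mul]
  have hA0 := hA.nonneg
  have hz1 := bracket_rpow_pos z.2 (m₁ - 1)
  have h : ‖∫ y, (ampKer K p z y - p z * ampKer K (fun _ => 1) z y) * b (z + (y, 0))‖ ≤
      ∫ y : RSpace n, (C * A * B * bracket z.2 ^ (m₁ + m₂ - 1)) * bracket y ^ (-((n : ℝ) + 1)) := by
    refine norm_integral_le_of_norm_le ((bracket_decay_integrable n).const_mul _)
      (Eventually.of_forall fun y => ?_)
    have h2 := hB (z + (y, 0))
    have e : (z + (y, 0)).2 = z.2 := by simp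
    rw [e] at h2
    rw [norm_mul]
    have hy := bracket_rpow_pos y (-((n : ℝ) + 1))
    calc _ ≤ (C * A * bracket z.2 ^ (m₁ - 1) * bracket y ^ (-((n : ℝ) + 1))) *
          (B * bracket z.2 ^ m₂) :=
          mul_le_mul (hC hp hA z y) h2 (norm_nonneg _) (by positivity)
      _ = _ := by
        rw [show m₁ + m₂ - 1 = (m₁ - 1) + m₂ by ring, bracket_rpow_add]; ring
  rw [integral_const_mul] at h
  refine (mul_le_mul_of_nonneg_left h (norm_nonneg _)).trans (le_of_eq ?_)
  ring

/-- The Leibniz rule for the remainder. -/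
lemma differentiable_rem (hp : Symb m₁ p) (hb : Symb m₂ b) (hK : Adm n K m₁) :
    ContDiff ℝ ∞ (rem K p b) ∧
      (∀ j, partialX j (rem K p b) = fun z => rem K (partialX j p) b z +
        rem K p (partialX j b) z) ∧
      ∀ j, partialXi j (rem K p b) = fun z => rem K (partialXi j p) b z +
        rem K p (partialXi j b) z := by
  have h1 := Symb.const (n := n) 1
  have s1 := smooth_bil hp hb hK
  have s2 := smooth_bil h1 hb hK.le'
  obtain ⟨-, hX, hXi⟩ := differentiable_bil hp hb hK
  obtain ⟨-, gX, gXi⟩ := differentiable_bil h1 hb hK.le'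
  have step : ∀ {v : Phase n},
      dirD v (bil K p b) = (fun z => bil K (dirD v p) b z + bil K p (dirD v b) z) →
      dirD v (bil K (fun _ => 1) b) = (fun z => bil K (dirD v fun _ => 1) b z +
        bil K (fun _ => 1) (dirD v b) z) →
      dirD v (rem K p b) = fun z => rem K (dirD v p) b z + rem K p (dirD v b) z := by
    intro v e1 e2
    rw [dirD_const, bil_zero_left] at e2
    change dirD v (fun z => bil K p b z - p z * bil K (fun _ => 1) b z) = _
    have hd : Differentiable ℝ fun z => p z * bil K (fun _ => 1) b z :=
      (smooth_differentiable hp.1).mul (smooth_differentiable s2)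
    rw [dirD_sub v (smooth_differentiable s1) hd,
      dirD_mul v (smooth_differentiable hp.1) (smooth_differentiable s2), e1, e2]
    funext z
    simp only [rem]
    ring
  refine ⟨s1.sub (hp.1.mul s2), fun j => ?_, fun j => ?_⟩
  · exact step (hX j) (gX j)
  · exact step (hXi j) (gXi j)

/-- The remainder of the composition has the order of the product lowered by one, with seminorms
bounded by the products of the seminorms of the factors. -/
lemma exists_symB_rem (N : ℕ) {m₁ : ℝ} (hK : Adm n K (|m₁| + N + 2)) : ∃ C : ℝ, 0 ≤ C ∧
    ∀ {p b : Phase n → ℂ} {A B m₂ : ℝ}, Symb m₁ p → Symb m₂ b → SymB (N + n + 2) m₁ A p →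
    SymB N m₂ B b → SymB N (m₁ + m₂ - 1) (C * A * B) (rem K p b) := by
  unfold Adm at hK
  rw [abs_of_nonneg (by positivity : 0 ≤ |m₁| + N + 2)] at hK
  have hN : (0 : ℝ) ≤ N := N.cast_nonneg
  obtain ⟨C₀, hC₀, h₀⟩ := exists_rem_bound (n := n) (K := K) (m₁ := m₁) (by
    unfold Adm; rw [abs_of_nonneg (by positivity : 0 ≤ |m₁| + 2)]; linarith)
  have hK1 : Adm n K m₁ := by unfold Adm; linarith
  induction N generalizing m₁ C₀ with
  | zero =>
    refine ⟨C₀, hC₀, fun hp hb hA hB z => h₀ hp hb (hA.of_le (by omega)) hB z⟩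
  | succ N ih =>
    have hN' : (0 : ℝ) ≤ N := N.cast_nonneg
    push_cast at hK
    have hm1 : |m₁ - 1| ≤ |m₁| + 1 := by simpa using abs_sub m₁ 1
    obtain ⟨C₁, hC₁, h₁⟩ := ih (m₁ := m₁) (by linarith) hN' C₀ hC₀ h₀ hK1
    obtain ⟨C₂, hC₂, h₂⟩ := exists_rem_bound (n := n) (K := K) (m₁ := m₁ - 1) (by
      unfold Adm; rw [abs_of_nonneg (by positivity : 0 ≤ |m₁ - 1| + 2)]; linarith)
    obtain ⟨C₃, hC₃, h₃⟩ := ih (m₁ := m₁ - 1) (by linarith) hN' C₂ hC₂ h₂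
      (by unfold Adm; linarith)
    refine ⟨C₀ + (C₁ + C₁) + (C₃ + C₁), by positivity, ?_⟩
    intro p b A B m₂ hp hb hA hB
    have hA0 := hA.nonneg
    have hB0 := hB.nonneg
    have hA' := (show SymB ((N + n + 2) + 1) m₁ A p from hA.of_le (by omega))
    have hA'' := symB_succ.1 hA'
    have hB' := symB_succ.1 hB
    obtain ⟨-, hX, hXi⟩ := differentiable_rem hp hb hK1
    have smX : ∀ j, ContDiff ℝ ∞ (rem K (partialX j p) b) ∧ ContDiff ℝ ∞ (rem K p (partialX j b)) :=
      fun j => ⟨(differentiable_rem (hp.partialX j) hb hK1).1,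
        (differentiable_rem hp (hb.partialX j) hK1).1⟩
    have smXi : ∀ j, ContDiff ℝ ∞ (rem K (partialXi j p) b) ∧
        ContDiff ℝ ∞ (rem K p (partialXi j b)) :=
      fun j => ⟨(differentiable_rem ((hp.partialXi j).mono (by linarith)) hb hK1).1,
        (differentiable_rem hp (hb.partialXi j) hK1).1⟩
    rw [symB_succ]
    refine ⟨fun z => ?_, fun j => ?_, fun j => ?_⟩
    · refine (h₀ hp hb (hA.of_le (by omega)) hB.bound z).trans ?_
      have := bracket_rpow_pos z.2 (m₁ + m₂ - 1)
      gcongr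
      linarith
    · rw [hX]
      refine SymB.mono (A := C₁ * A * B + C₁ * A * B) (fun z =>
        (h₁ (hp.partialX j) hb (hA''.2.1 j) (hB.of_le (Nat.le_succ N)) z).add
        (h₁ hp (hb.partialX j) (hA'.of_le (Nat.le_succ _)) (hB'.2.1 j) z) (smX j).1 (smX j).2)
        ?_ le_rfl
      nlinarith [mul_nonneg hC₀ (mul_nonneg hA0 hB0), mul_nonneg hC₁ (mul_nonneg hA0 hB0),
        mul_nonneg hC₃ (mul_nonneg hA0 hB0)]
    · rw [hXi]
      refine SymB.mono (A := C₃ * A * B + C₁ * A * B) (m := m₁ + m₂ - 1 - 1) (fun z =>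
        ((h₃ (hp.partialXi j) hb (hA''.2.2 j) (hB.of_le (Nat.le_succ N)) z).mono le_rfl
          (by linarith)).add
        ((h₁ hp (hb.partialXi j) (hA'.of_le (Nat.le_succ _)) (hB'.2.2 j) z).mono le_rfl
          (by linarith)) (smXi j).1 (smXi j).2) ?_ le_rfl
      nlinarith [mul_nonneg hC₀ (mul_nonneg hA0 hB0), mul_nonneg hC₁ (mul_nonneg hA0 hB0),
        mul_nonneg hC₃ (mul_nonneg hA0 hB0)]

/-- The operator `(1 - Δ_x) ^ k` preserves the order, since derivatives in `x` do; only `2k`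
derivatives are lost. -/
lemma symB_iterate_shiftT_zero (k : ℕ) {N : ℕ} {B : ℝ} (hb : SymB (N + 2 * k) m B b)
    (hs : ContDiff ℝ ∞ b) : SymB N m ((1 + n) ^ k * B) ((shiftT 0)^[k] b) := by
  have hone : ∀ {N : ℕ} {B : ℝ} {b : Phase n → ℂ}, SymB (N + 2) m B b → ContDiff ℝ ∞ b →
      SymB N m ((1 + n) * B) (shiftT 0 b) := by
    intro N B b hb hs z
    have h1 : ∀ j, SymB N m B (partialX j (partialX j b)) := fun j =>
      (symB_succ.1 ((symB_succ.1 hb).2.1 j)).2.1 j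
    have h2 : ∀ s : Finset (Fin n), SymAt N m (s.card * B)
        (fun z => ∑ j ∈ s, partialX j (partialX j b) z) z := by
      intro s
      induction s using Finset.induction_on with
      | empty => simpa using symAt_zero N m le_rfl z
      | insert a s ha ih =>
        simp only [Finset.sum_insert ha, Finset.card_insert_of_notMem ha]
        refine ((h1 a z).add ih (smooth_partialX a (smooth_partialX a hs))
          (ContDiff.sum fun j _ => smooth_partialX j (smooth_partialX j hs))).mono ?_ le_rfl
        push_cast; linarith
    have e : shiftT 0 b = fun z => b z + -∑ j, partialX j (partialX j b) z := by
      funext z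
      have : ∀ (j : Fin n) (g : Phase n → ℂ), shiftD 0 j g = partialX j g := by
        intro j g; funext z; simp [shiftD]
      simp [shiftT, this, sub_eq_add_neg]
    rw [e]
    refine ((hb.of_le (by omega) z).add (h2 Finset.univ).neg hs
      (ContDiff.sum fun j _ => smooth_partialX j (smooth_partialX j hs)).neg).mono ?_ le_rfl
    simp; linarith
  induction k generalizing N with
  | zero => simpa using hb
  | succ k ih =>
    rw [Function.iterate_succ_apply']
    refine (hone (ih (N := N + 2) (hb.of_le (by omega))) (smooth_iterate_shiftT 0 k hs)).mono
      ?_ le_rfl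
    rw [pow_succ]
    linarith

lemma Symb.iterate_shiftT_zero (k : ℕ) (hb : Symb m b) : Symb m ((_root_.shiftT 0)^[k] b) :=
  ⟨smooth_iterate_shiftT 0 k hb.1, fun N => let ⟨_, hB⟩ := hb.2 (N + 2 * k)
    ⟨_, symB_iterate_shiftT_zero k hB hb.1⟩⟩

lemma rem_iterate (ha : Symb m₂ b) (hK : Adm n K m₁) (z : Phase n) :
    rem K p ((shiftT 0)^[K] b) z = sharp K p b z - p z * b z := by
  have := congrFun (sharp_one ha hK.le') z
  rw [← this]; rfl

/-- The leading term of the product symbol: `p # a - p a` has the order of `p a` lowered by one,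
and its seminorms of order at most `N` are bounded by the products of finitely many seminorms of
`p` and of `a`. -/
lemma exists_symB_sharp_sub (N : ℕ) {m₁ : ℝ} (hK : -2 * (K : ℝ) + m₁ ≤ -((n : ℝ) + 1)) :
    ∃ C : ℝ, 0 ≤ C ∧ ∃ L : ℕ,
    ∀ {p a : Phase n → ℂ} {A B m₂ : ℝ}, Symb m₁ p → Symb m₂ a → SymB L m₁ A p → SymB L m₂ B a →
    SymB N (m₁ + m₂ - 1) (C * A * B) (fun z => sharp K p a z - p z * a z) := by
  -- Estimates of more derivatives need more regularization; the product symbol does not change.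
  obtain ⟨k, hk⟩ := exists_nat_ge (3 * ((n : ℝ) + 1) + (|m₁| + N + 2))
  have hk' : Adm n (K + k) (|m₁| + N + 2) := by
    unfold Adm
    rw [abs_of_nonneg (by positivity : 0 ≤ |m₁| + N + 2)]
    push_cast
    have : (0 : ℝ) ≤ K := K.cast_nonneg
    have : (0 : ℝ) ≤ k := k.cast_nonneg
    linarith
  have hk1 : Adm n (K + k) m₁ := by
    unfold Adm at hk' ⊢
    rw [abs_of_nonneg (by positivity : 0 ≤ |m₁| + N + 2)] at hk'
    have : (0 : ℝ) ≤ N := N.cast_nonneg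
    linarith
  obtain ⟨C, hC0, hC⟩ := exists_symB_rem N hk'
  refine ⟨C * (1 + n) ^ (K + k), by positivity, max (N + n + 2) (N + 2 * (K + k)), ?_⟩
  intro p a A B m₂ hp ha hA hB
  have h1 := hC hp (ha.iterate_shiftT_zero (K + k)) (hA.of_le (le_max_left _ _))
    (symB_iterate_shiftT_zero (K + k) (hB.of_le (le_max_right _ _)) ha.1)
  have e : rem (K + k) p ((shiftT 0)^[K + k] a) = fun z => sharp K p a z - p z * a z := by
    funext z
    rw [rem_iterate ha hk1, sharp_eq_of_le hp ha hK (Nat.le_add_right K k)]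
  rw [e] at h1
  exact h1.mono (le_of_eq (by ring)) le_rfl

lemma smooth_sharp {a : Phase n → ℂ} (hp : Symb m₁ p) (ha : Symb m₂ a)
    (hK : -2 * (K : ℝ) + m₁ ≤ -((n : ℝ) + 1)) : ContDiff ℝ ∞ (sharp K p a) := by
  obtain ⟨k, hk⟩ := exists_nat_ge (3 * ((n : ℝ) + 1) + |m₁|)
  have hk' : Adm n (K + k) m₁ := by
    unfold Adm
    push_cast
    have : (0 : ℝ) ≤ K := K.cast_nonneg
    have : (0 : ℝ) ≤ k := k.cast_nonneg
    linarith
  rw [← sharp_eq_of_le hp ha hK (Nat.le_add_right K k)]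
  exact smooth_bil hp (ha.iterate_shiftT_zero _) hk'

lemma sharp_sub {a : Phase n → ℂ} (hp : Symb m₁ p) (hq : Symb m₁ q) (ha : Symb m₂ a)
    (hK : Adm n K m₁) (z : Phase n) :
    sharp K (fun z => p z - q z) a z = sharp K p a z - sharp K q a z :=
  bil_sub hp hq (ha.iterate_shiftT_zero K) hK z

end linear

/-! ### Logarithmic slow scale nets -/

/-- `log (1/ε)` as a function on the parameter set. -/
def logInv (ε : EpsIndex) : ℝ := Real.log (1 / (ε : ℝ))

/-- A net all of whose powers are `O(log (1/ε))`. In contrast to `IsLscNet` there is no lower bound,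
and the interval on which the bound holds may depend on the power. -/
def Moderate (w : EpsIndex → ℝ) : Prop := ∀ k : ℕ, (fun ε => w ε ^ k) =O[atBot] logInv

lemma eventually_log_two_le : ∀ᶠ ε : EpsIndex in atBot, Real.log 2 ≤ logInv ε := by
  refine eventually_atBot.2 ⟨⟨1 / 2, by norm_num, by norm_num⟩, fun ε hε => ?_⟩
  have h1 : (ε : ℝ) ≤ 1 / 2 := hε
  have h2 : 0 < (ε : ℝ) := ε.2.1
  refine Real.log_le_log two_pos ?_
  rw [le_div_iff₀ h2]; linarith

namespace Moderate

variable {v w : EpsIndex → ℝ}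

lemma of_le (hw : Moderate w) (h : ∀ᶠ ε in atBot, |v ε| ≤ |w ε|) : Moderate v := fun k =>
  (Asymptotics.IsBigO.of_bound 1 (h.mono fun ε hε => by
    simp only [norm_pow, Real.norm_eq_abs, one_mul]; gcongr)).trans (hw k)

lemma congr (hw : Moderate w) (h : ∀ᶠ ε in atBot, v ε = w ε) : Moderate v :=
  hw.of_le (h.mono fun ε hε => by rw [hε])

lemma const (c : ℝ) : Moderate fun _ => c := fun k => by
  refine Asymptotics.IsBigO.of_bound (|c ^ k| / Real.log 2)
    (eventually_log_two_le.mono fun ε hε => ?_)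
  have h2 : 0 < Real.log 2 := Real.log_pos one_lt_two
  rw [Real.norm_eq_abs, Real.norm_of_nonneg (h2.le.trans hε), div_mul_eq_mul_div, le_div_iff₀ h2]
  gcongr

lemma mul (hv : Moderate v) (hw : Moderate w) : Moderate fun ε => v ε * w ε := fun k => by
  have h := ((hv (2 * k)).norm_left).add ((hw (2 * k)).norm_left)
  refine (Asymptotics.IsBigO.of_bound 1 (Eventually.of_forall fun ε => ?_)).trans h
  have e : ∀ x : ℝ, ‖x ^ (2 * k)‖ = |x| ^ k * |x| ^ k := fun x => by
    rw [norm_pow, Real.norm_eq_abs, two_mul, pow_add]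
  rw [e, e, mul_pow, norm_mul, norm_pow, norm_pow, Real.norm_eq_abs, Real.norm_eq_abs, one_mul,
    Real.norm_of_nonneg (by positivity)]
  nlinarith [sq_nonneg (|v ε| ^ k - |w ε| ^ k), mul_nonneg (pow_nonneg (abs_nonneg (v ε)) k)
    (pow_nonneg (abs_nonneg (w ε)) k)]

lemma add (hv : Moderate v) (hw : Moderate w) : Moderate fun ε => v ε + w ε := fun k => by
  have h := (((hv k).norm_left).add ((hw k).norm_left)).const_mul_left ((2 : ℝ) ^ (k - 1))
  refine (Asymptotics.IsBigO.of_bound 1 (Eventually.of_forall fun ε => ?_)).trans h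
  rw [norm_pow, one_mul, norm_mul, norm_pow, norm_pow, norm_pow, Real.norm_two,
    Real.norm_of_nonneg (by positivity : 0 ≤ ‖v ε‖ ^ k + ‖w ε‖ ^ k)]
  exact (pow_le_pow_left₀ (norm_nonneg _) (norm_add_le _ _) k).trans
    (add_pow_le (norm_nonneg _) (norm_nonneg _) k)

lemma abs (hw : Moderate w) : Moderate fun ε => |w ε| :=
  hw.of_le (Eventually.of_forall fun ε => by rw [abs_abs])

lemma const_mul (c : ℝ) (hw : Moderate w) : Moderate fun ε => c * w ε := (const c).mul hw

lemma pow (hw : Moderate w) (j : ℕ) : Moderate fun ε => w ε ^ j := fun k => by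
  simpa only [← pow_mul] using hw (j * k)

lemma sum {ι : Type*} (s : Finset ι) {F : ι → EpsIndex → ℝ} (hF : ∀ i ∈ s, Moderate (F i)) :
    Moderate fun ε => ∑ i ∈ s, F i ε := by
  classical
  induction s using Finset.induction_on with
  | empty => simpa using const 0
  | insert a s ha ih =>
    simp only [Finset.sum_insert ha]
    exact (hF a (by simp)).add (ih fun i hi => hF i (by simp [hi]))

lemma comp_min (hw : Moderate w) (η : EpsIndex) : Moderate fun ε => w (min ε η) :=
  hw.congr (eventually_atBot.2 ⟨η, fun ε hε => by rw [min_eq_left hε]⟩)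

end Moderate

lemma IsLscNet.moderate {w : EpsIndex → ℝ} (hw : IsLscNet w) : Moderate w := fun k => by
  obtain ⟨-, η, h⟩ := hw
  obtain ⟨c, hc, h⟩ := h k k.cast_nonneg
  refine Asymptotics.IsBigO.of_bound c (eventually_atBot.2 ⟨η, fun ε hε => ?_⟩)
  have := h ε hε
  rw [Real.rpow_natCast] at this
  rw [norm_pow, Real.norm_eq_abs]
  exact this.trans (mul_le_mul_of_nonneg_left (le_abs_self _) hc.le)

/-- The bound for the first power holds on some interval `(0, η]`, which serves all the other
powers: their bounds hold on some smaller interval `(0, η']`, and on `[η', η]` the net is bounded.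
-/
lemma Moderate.isLscNet {w : EpsIndex → ℝ} (hw : Moderate w) (h1 : ∀ ε, 1 ≤ w ε) : IsLscNet w := by
  have hl2 : 0 < Real.log 2 := Real.log_pos one_lt_two
  obtain ⟨C₁, hC₁0, hC₁⟩ := (hw 1).exists_pos
  obtain ⟨η, hη⟩ := eventually_atBot.1 (hC₁.bound.and eventually_log_two_le)
  refine ⟨⟨η, 1, one_pos, fun ε _ => h1 ε⟩, η, fun p hp => ?_⟩
  obtain ⟨k, hk⟩ := exists_nat_ge p
  obtain ⟨C, hC0, hC⟩ := (hw k).exists_pos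
  obtain ⟨η', hη'⟩ := eventually_atBot.1 hC.bound
  set D := (C₁ * logInv η') ^ p / Real.log 2
  refine ⟨C + |D|, by positivity, fun ε hε => ?_⟩
  have hL : Real.log 2 ≤ logInv ε := (hη ε hε).2
  have hL0 : 0 < logInv ε := hl2.trans_le hL
  have hw0 : 0 < w ε := one_pos.trans_le (h1 ε)
  change |w ε| ^ p ≤ (C + |D|) * logInv ε
  rw [abs_of_pos hw0]
  rcases le_total ε η' with h | h
  · have h2 := hη' ε h
    rw [norm_pow, Real.norm_of_nonneg hw0.le, Real.norm_of_nonneg hL0.le] at h2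
    calc w ε ^ p ≤ w ε ^ (k : ℝ) := Real.rpow_le_rpow_of_exponent_le (h1 ε) hk
      _ = w ε ^ k := Real.rpow_natCast _ _
      _ ≤ C * logInv ε := h2
      _ ≤ _ := by gcongr; linarith [abs_nonneg D]
  · have h2 := (hη ε hε).1
    rw [pow_one, Real.norm_of_nonneg hw0.le, Real.norm_of_nonneg hL0.le] at h2
    have h3 : logInv ε ≤ logInv η' := by
      have h' : (η' : ℝ) ≤ ε := h
      have := η'.2.1
      have := ε.2.1
      unfold logInv
      gcongr
    have h4 : w ε ^ p ≤ (C₁ * logInv η') ^ p :=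
      Real.rpow_le_rpow hw0.le (h2.trans (by gcongr)) hp
    calc w ε ^ p ≤ D * Real.log 2 := by rw [div_mul_cancel₀ _ hl2.ne']; exact h4
      _ ≤ (C + |D|) * Real.log 2 := by gcongr; linarith [le_abs_self D]
      _ ≤ _ := by gcongr

/-! ### Nets of symbols -/

/-- Nets of symbols all of whose seminorms are bounded by moderate nets. The bounds are required for
all `ε`, which is no restriction, since a moderate net is arbitrary for large `ε`. -/
def NetSymb (m : ℝ) (a : SymbolNet n) : Prop :=
  (∀ ε, ContDiff ℝ ∞ (a ε)) ∧ ∀ N, ∃ w : EpsIndex → ℝ, Moderate w ∧ ∀ ε, SymB N m (w ε) (a ε)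

lemma IsLscSymbol.netSymb {m : ℝ} {a : SymbolNet n} (ha : IsLscSymbol m a) : NetSymb m a := by
  refine ⟨fun ε => (ha.1 ε).1, fun N => ?_⟩
  choose w hw C hC η h using ha.2
  choose A hA using fun ε => (isSymbol_iff_symb.1 (ha.1 ε)).2 N
  set s := (finite_lists_length_le n N).toFinset
  set v : EpsIndex → ℝ := fun ε => ∑ p ∈ s, |C p.1 p.2 * w p.1 p.2 ε| with hv
  have hvm : Moderate v := Moderate.sum s fun p _ => ((hw p.1 p.2).moderate.const_mul _).abs
  have hev : ∀ᶠ ε in atBot, SymB N m (v ε) (a ε) := by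
    have : ∀ᶠ ε in atBot, ∀ p ∈ s, ε ≤ η p.1 p.2 :=
      (Filter.eventually_all_finset s).2 fun p _ => eventually_le_atBot _
    refine this.mono fun ε hε z => symAt_of_mixedDeriv_le (ha.1 ε).1 fun I J hIJ => ?_
    have hmem : (I, J) ∈ s := by simpa [s] using hIJ
    refine (h I J ε (hε _ hmem) z.1 z.2).trans ?_
    have := bracket_rpow_pos z.2 (m - (I.length : ℝ))
    refine mul_le_mul_of_nonneg_right ((le_abs_self _).trans ?_) this.le
    exact Finset.single_le_sum (f := fun p : List (Fin n) × List (Fin n) =>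
      |C p.1 p.2 * w p.1 p.2 ε|) (fun _ _ => abs_nonneg _) hmem
  classical
  refine ⟨fun ε => if SymB N m (v ε) (a ε) then v ε else A ε,
    hvm.congr (hev.mono fun ε hε => if_pos hε), fun ε => ?_⟩
  beta_reduce
  split_ifs with hε
  · exact hε
  · exact hA ε

namespace NetSymb

variable {m m₁ m₂ : ℝ} {a b : SymbolNet n}

lemma symb (ha : NetSymb m a) (ε : EpsIndex) : Symb m (a ε) :=
  ⟨ha.1 ε, fun N => let ⟨w, _, h⟩ := ha.2 N; ⟨w ε, h ε⟩⟩

lemma isLscSymbol (ha : NetSymb m a) : IsLscSymbol m a := by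
  refine ⟨fun ε => isSymbol_iff_symb.2 (ha.symb ε), fun I J => ?_⟩
  obtain ⟨w, hw, h⟩ := ha.2 (I.length + J.length)
  refine ⟨fun ε => 1 + |w ε|, ((Moderate.const 1).add hw.abs).isLscNet fun ε => by
    linarith [abs_nonneg (w ε)], 1, one_pos, ⟨1, one_pos, le_rfl⟩, fun ε _ x ξ => ?_⟩
  refine ((h ε (x, ξ)).mixedDeriv_le I J le_rfl).trans ?_
  have := bracket_rpow_pos ξ (m - (I.length : ℝ))
  refine mul_le_mul_of_nonneg_right ?_ this.le
  linarith [le_abs_self (w ε)]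

lemma mono (ha : NetSymb m₁ a) (h : m₁ ≤ m₂) : NetSymb m₂ a :=
  ⟨ha.1, fun N => let ⟨w, hw, h'⟩ := ha.2 N; ⟨w, hw, fun ε => (h' ε).mono le_rfl h⟩⟩

lemma add (ha : NetSymb m a) (hb : NetSymb m b) : NetSymb m (fun ε z => a ε z + b ε z) :=
  ⟨fun ε => (ha.1 ε).add (hb.1 ε), fun N => let ⟨_, hv, h⟩ := ha.2 N; let ⟨_, hw, h'⟩ := hb.2 N
    ⟨_, hv.add hw, fun ε z => (h ε z).add (h' ε z) (ha.1 ε) (hb.1 ε)⟩⟩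

lemma neg (ha : NetSymb m a) : NetSymb m (fun ε z => -a ε z) :=
  ⟨fun ε => (ha.1 ε).neg, fun N => let ⟨v, hv, h⟩ := ha.2 N; ⟨v, hv, fun ε z => (h ε z).neg⟩⟩

lemma sub (ha : NetSymb m a) (hb : NetSymb m b) : NetSymb m (fun ε z => a ε z - b ε z) := by
  simpa only [sub_eq_add_neg] using ha.add hb.neg

lemma mul (ha : NetSymb m₁ a) (hb : NetSymb m₂ b) :
    NetSymb (m₁ + m₂) (fun ε z => a ε z * b ε z) :=
  ⟨fun ε => (ha.1 ε).mul (hb.1 ε), fun N => let ⟨_, hv, h⟩ := ha.2 N; let ⟨_, hw, h'⟩ := hb.2 N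
    ⟨_, (hv.mul hw).const_mul _, fun ε z => (h ε z).mul (h' ε z) (ha.1 ε) (hb.1 ε)⟩⟩

lemma conj (ha : NetSymb m a) : NetSymb m (fun ε z => (starRingEnd ℂ) (a ε z)) :=
  ⟨fun ε => Complex.conjCLE.contDiff.comp (ha.1 ε), fun N => let ⟨v, hv, h⟩ := ha.2 N
    ⟨v, hv, fun ε z => (h ε z).conj (ha.1 ε)⟩⟩

lemma const (c : ℂ) : NetSymb 0 (fun _ (_ : Phase n) => c) :=
  ⟨fun _ => contDiff_const, fun N => ⟨_, Moderate.const ‖c‖, fun _ z => symAt_const N c z⟩⟩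

lemma zero (m : ℝ) : NetSymb m (fun _ (_ : Phase n) => 0) :=
  ⟨fun _ => contDiff_const, fun N => ⟨_, Moderate.const 0, fun _ z => symAt_zero N m le_rfl z⟩⟩

lemma sum {ι : Type*} (s : Finset ι) {F : ι → SymbolNet n} (hF : ∀ i ∈ s, NetSymb m (F i)) :
    NetSymb m (fun ε z => ∑ i ∈ s, F i ε z) := by
  classical
  induction s using Finset.induction_on with
  | empty => simpa using zero m
  | insert a s ha ih =>
    simp only [Finset.sum_insert ha]
    exact (hF a (by simp)).add (ih fun i hi => hF i (by simp [hi]))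

lemma comp_min (ha : NetSymb m a) (η : EpsIndex) : NetSymb m (fun ε => a (min ε η)) :=
  ⟨fun _ => ha.1 _, fun N => let ⟨_, hw, h⟩ := ha.2 N; ⟨_, hw.comp_min η, fun _ => h _⟩⟩

lemma truncate (ha : NetSymb m a) (η : EpsIndex) :
    NetSymb m (fun ε => if ε ≤ η then a ε else fun _ => 0) := by
  refine ⟨fun ε => ?_, fun N => ?_⟩
  · beta_reduce
    split_ifs
    · exact ha.1 ε
    · exact contDiff_const
  · obtain ⟨w, hw, h⟩ := ha.2 N
    refine ⟨w, hw, fun ε => ?_⟩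
    beta_reduce
    split_ifs
    · exact h ε
    · exact symAt_zero N m (h ε).nonneg

/-- The product symbol is the product of the symbols up to a net of one order less. -/
lemma sharp_sub_mul {K : ℕ} (hp : NetSymb m₁ a) (hb : NetSymb m₂ b)
    (hK : -2 * (K : ℝ) + m₁ ≤ -((n : ℝ) + 1)) :
    NetSymb (m₁ + m₂ - 1) (fun ε z => sharp K (a ε) (b ε) z - a ε z * b ε z) := by
  refine ⟨fun ε => (smooth_sharp (hp.symb ε) (hb.symb ε) hK).sub ((hp.1 ε).mul (hb.1 ε)),
    fun N => ?_⟩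
  obtain ⟨C, _, L, h⟩ := exists_symB_sharp_sub (n := n) N hK
  obtain ⟨v, hv, h₁⟩ := hp.2 L
  obtain ⟨w, hw, h₂⟩ := hb.2 L
  exact ⟨_, (hv.const_mul C).mul hw, fun ε => h (hp.symb ε) (hb.symb ε) (h₁ ε) (h₂ ε)⟩

lemma sharp {K : ℕ} (hp : NetSymb m₁ a) (hb : NetSymb m₂ b)
    (hK : -2 * (K : ℝ) + m₁ ≤ -((n : ℝ) + 1)) :
    NetSymb (m₁ + m₂) (fun ε => sharp K (a ε) (b ε)) := by
  simpa using ((hp.sharp_sub_mul hb hK).mono (by linarith : _ ≤ m₁ + m₂)).add (hp.mul hb)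

/-- The reciprocal of a net whose ellipticity constants have moderate inverses. -/
lemma inv (ha : NetSymb m a) {s : EpsIndex → ℝ} (hs : Moderate s) (hs1 : ∀ ε, 1 ≤ s ε)
    (h : ∀ ε z, bracket z.2 ^ m ≤ s ε * ‖a ε z‖) : NetSymb (-m) (fun ε z => (a ε z)⁻¹) := by
  refine ⟨fun ε => (ha.1 ε).inv fun z hz => ?_, fun N => ?_⟩
  · have := h ε z
    rw [hz, norm_zero, mul_zero] at this
    exact absurd this (bracket_rpow_pos _ _).not_ge
  · obtain ⟨C, _, k, hC⟩ := symB_inv (n := n) N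
    obtain ⟨w, hw, h'⟩ := ha.2 N
    refine ⟨_, ((hs.mul ((Moderate.const 1).add hw)).pow k).const_mul C, fun ε => ?_⟩
    exact hC (by linarith [(h' ε).nonneg]) (hs1 ε) (ha.1 ε)
      ((h' ε).mono (by linarith) le_rfl) (h ε)

end NetSymb

/-! ### Cut-off functions in the frequency -/

/-- The function `ψ (ξ / R)` on phase space. -/
def dil (R : ℝ) (ψ : RSpace n → ℂ) : Phase n → ℂ := fun z => ψ (R⁻¹ • z.2)

lemma smooth_dil (R : ℝ) {ψ : RSpace n → ℂ} (hψ : ContDiff ℝ ∞ ψ) : ContDiff ℝ ∞ (dil R ψ) :=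
  hψ.comp (contDiff_snd.const_smul _)

lemma dirD_dil (R : ℝ) {ψ : RSpace n → ℂ} (hψ : ContDiff ℝ ∞ ψ) (v : Phase n) :
    dirD v (dil R ψ) = fun z => (R⁻¹ : ℂ) * dil R (fun ξ => fderiv ℝ ψ ξ v.2) z := by
  funext z
  have h : HasFDerivAt (dil R ψ) ((fderiv ℝ ψ (R⁻¹ • z.2)) ∘L
      (R⁻¹ • ContinuousLinearMap.snd ℝ (RSpace n) (RSpace n))) z :=
    ((hψ.differentiable (by simp)) _).hasFDerivAt.comp z (hasFDerivAt_snd.const_smul R⁻¹)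
  unfold dirD
  rw [h.fderiv]
  simp [dil]

lemma bracket_le_of_norm_smul_le {R : ℝ} (hR : 1 ≤ R) {ξ : RSpace n} (h : ‖R⁻¹ • ξ‖ ≤ 2) :
    bracket ξ ≤ 3 * R := by
  have h1 := bracket_le_one_add_norm ξ
  have h2 : ‖ξ‖ ≤ 2 * R := by
    rw [norm_smul, norm_inv, Real.norm_of_nonneg (by linarith : 0 ≤ R), inv_mul_le_iff₀
      (by linarith)] at h
    linarith
  linarith

lemma exists_norm_dil_le {ψ : RSpace n → ℂ} (hψ : Continuous ψ)
    (hsupp : ∀ ξ, 2 < ‖ξ‖ → ψ ξ = 0) (l : ℕ) : ∃ C : ℝ, 0 ≤ C ∧ ∀ R : ℝ, 1 ≤ R → ∀ z : Phase n,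
    ‖dil R ψ z‖ ≤ C * R ^ l * bracket z.2 ^ (-(l : ℝ)) := by
  obtain ⟨M, hM⟩ := hψ.bounded_above_of_compact_support
    (HasCompactSupport.intro (isCompact_closedBall (0 : RSpace n) 2) fun ξ hξ =>
      hsupp ξ (by simpa using hξ))
  have hM0 : 0 ≤ M := (norm_nonneg _).trans (hM 0)
  refine ⟨M * 3 ^ l, by positivity, fun R hR z => ?_⟩
  have hb := bracket_rpow_pos z.2 (-(l : ℝ))
  by_cases hz : 2 < ‖R⁻¹ • z.2‖
  · rw [dil, hsupp _ hz, norm_zero]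
    positivity
  · have h1 := bracket_le_of_norm_smul_le hR (not_lt.1 hz)
    have h2 : bracket z.2 ^ l ≤ 3 ^ l * R ^ l := by
      rw [← mul_pow]; exact pow_le_pow_left₀ (bracket_pos _).le h1 l
    have hbl : 0 < bracket z.2 ^ l := pow_pos (bracket_pos _) l
    rw [Real.rpow_neg (bracket_pos _).le, Real.rpow_natCast]
    calc ‖dil R ψ z‖ ≤ M * (bracket z.2 ^ l * (bracket z.2 ^ l)⁻¹) := by
          rw [mul_inv_cancel₀ hbl.ne', mul_one]; exact hM _
      _ ≤ M * (3 ^ l * R ^ l * (bracket z.2 ^ l)⁻¹) := by gcongr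
      _ = _ := by ring

/-- A dilated test function is a symbol of every order `-l ≤ 0`, at the price of `R ^ l`. -/
lemma exists_symB_dil (N : ℕ) {ψ : RSpace n → ℂ} (hψ : ContDiff ℝ ∞ ψ)
    (hsupp : ∀ ξ, 2 < ‖ξ‖ → ψ ξ = 0) (l : ℕ) :
    ∃ C : ℝ, 0 ≤ C ∧ ∀ R : ℝ, 1 ≤ R → SymB N (-(l : ℝ)) (C * R ^ l) (dil R ψ) := by
  induction N generalizing ψ l with
  | zero => exact exists_norm_dil_le hψ.continuous hsupp l
  | succ N ih =>
    obtain ⟨C₀, hC₀, h₀⟩ := exists_norm_dil_le hψ.continuous hsupp l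
    have hd : ∀ v : RSpace n, ContDiff ℝ ∞ fun ξ => fderiv ℝ ψ ξ v := fun v =>
      (hψ.fderiv_right (m := ∞) (by simp)).clm_apply contDiff_const
    have hds : ∀ v ξ, 2 < ‖ξ‖ → fderiv ℝ ψ ξ v = 0 := by
      intro v ξ hξ
      have : ψ =ᶠ[𝓝 ξ] fun _ => 0 := by
        filter_upwards [continuous_norm.continuousAt.eventually_const_lt hξ] with w hw
        exact hsupp w hw
      rw [this.fderiv_eq]; simp
    choose C hC h using fun j : Fin n =>
      ih (hd (EuclideanSpace.single j 1)) (hds (EuclideanSpace.single j 1)) (l + 1)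
    have hS : 0 ≤ ∑ j, C j := Finset.sum_nonneg fun j _ => hC j
    refine ⟨C₀ + ∑ j, C j, by positivity, fun R hR => ?_⟩
    have hR0 : 0 < R := by linarith
    rw [symB_succ]
    refine ⟨fun z => (h₀ R hR z).trans ?_, fun j => ?_, fun j => ?_⟩
    · have := bracket_rpow_pos z.2 (-(l : ℝ))
      gcongr
      linarith
    · rw [partialX_eq, dirD_dil R hψ]
      simp only [dil, map_zero, mul_zero]
      exact symAt_zero N _ (by positivity)
    · rw [partialXi_eq, dirD_dil R hψ]
      intro z
      refine ((h j R hR z).const_mul (R⁻¹ : ℂ) (smooth_dil R (hd _))).mono ?_ ?_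
      · have : C j ≤ ∑ j, C j := Finset.single_le_sum (fun j _ => hC j) (Finset.mem_univ j)
        rw [norm_inv, Complex.norm_real, Real.norm_of_nonneg hR0.le, pow_succ]
        have e : R⁻¹ * (C j * (R ^ l * R)) = C j * R ^ l := by field_simp
        rw [e]
        gcongr
        linarith
      · push_cast; linarith

/-- A bump function in the frequency, equal to `1` for `|ξ| ≤ 1` and to `0` for `|ξ| > 2`. -/
def bump (n : ℕ) : RSpace n → ℂ := fun ξ =>
  (((⟨1, 2, one_pos, one_lt_two⟩ : ContDiffBump (0 : RSpace n)) ξ : ℝ) : ℂ)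

lemma smooth_bump : ContDiff ℝ ∞ (bump n) :=
  Complex.ofRealCLM.contDiff.comp (ContDiffBump.contDiff _)

lemma bump_of_norm_le {ξ : RSpace n} (h : ‖ξ‖ ≤ 1) : bump n ξ = 1 := by
  unfold bump
  rw [ContDiffBump.one_of_mem_closedBall _ (by simpa using h)]; simp

lemma bump_of_lt_norm {ξ : RSpace n} (h : 2 < ‖ξ‖) : bump n ξ = 0 := by
  unfold bump
  rw [ContDiffBump.zero_of_le_dist _ (by simpa using h.le)]; simp

/-- The bump function has values in `[0, 1]`. -/
lemma exists_bump_eq (ξ : RSpace n) : ∃ t : ℝ, 0 ≤ t ∧ t ≤ 1 ∧ bump n ξ = t :=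
  ⟨_, ContDiffBump.nonneg _, ContDiffBump.le_one _, rfl⟩

/-- A cut-off to low frequencies: `1` for `|ξ| ≤ R` and `0` for `|ξ| > 2R`. -/
def cut (R : ℝ) : Phase n → ℂ := dil R (bump n)

lemma smooth_cut (R : ℝ) : ContDiff ℝ ∞ (cut R : Phase n → ℂ) := smooth_dil R smooth_bump

lemma cut_of_norm_le {R : ℝ} (hR : 0 < R) {z : Phase n} (h : ‖z.2‖ ≤ R) : cut R z = 1 := by
  refine bump_of_norm_le ?_
  rw [norm_smul, norm_inv, Real.norm_of_nonneg hR.le, inv_mul_le_iff₀ hR]; linarith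

lemma exists_symB_cut (n N l : ℕ) : ∃ C : ℝ, 0 ≤ C ∧ ∀ R : ℝ, 1 ≤ R →
    SymB N (-(l : ℝ)) (C * R ^ l) (cut R : Phase n → ℂ) :=
  exists_symB_dil N smooth_bump (fun _ => bump_of_lt_norm) l

/-- The cut-off to high frequencies is small as a symbol of order one. -/
lemma exists_symB_one_sub_cut (n N : ℕ) : ∃ C : ℝ, 0 ≤ C ∧ ∀ R : ℝ, 1 ≤ R →
    SymB N 1 (C / R) (fun z : Phase n => 1 - cut R z) := by
  have hval : ∀ R : ℝ, 1 ≤ R → ∀ z : Phase n, ‖1 - cut R z‖ ≤ 1 / R * bracket z.2 ^ (1 : ℝ) := by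
    intro R hR z
    have hR0 : 0 < R := by linarith
    rw [Real.rpow_one]
    by_cases hz : ‖z.2‖ ≤ R
    · rw [cut_of_norm_le hR0 hz, sub_self, norm_zero]
      have := bracket_pos z.2
      positivity
    · obtain ⟨t, ht0, ht1, ht⟩ := exists_bump_eq (R⁻¹ • z.2)
      have h1 : ‖1 - cut R z‖ ≤ 1 := by
        rw [cut, dil, ht, ← Complex.ofReal_one, ← Complex.ofReal_sub, Complex.norm_real,
          Real.norm_of_nonneg (by linarith)]
        linarith
      have h2 := norm_le_bracket z.2
      refine h1.trans ?_
      rw [one_div, ← div_eq_inv_mul, one_le_div hR0]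
      linarith
  cases N with
  | zero => exact ⟨1, zero_le_one, hval⟩
  | succ N =>
    have hd : ∀ v : RSpace n, ContDiff ℝ ∞ fun ξ => fderiv ℝ (bump n) ξ v := fun v =>
      (smooth_bump.fderiv_right (m := ∞) (by simp)).clm_apply contDiff_const
    have hds : ∀ v ξ, 2 < ‖ξ‖ → fderiv ℝ (bump n) ξ v = 0 := by
      intro v ξ hξ
      have : bump n =ᶠ[𝓝 ξ] fun _ => 0 := by
        filter_upwards [continuous_norm.continuousAt.eventually_const_lt hξ] with w hw
        exact bump_of_lt_norm hw
      rw [this.fderiv_eq]; simp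
    choose C hC h using fun j : Fin n => exists_symB_dil N
      (hd (EuclideanSpace.single j 1)) (hds (EuclideanSpace.single j 1)) 0
    have hS : 0 ≤ ∑ j, C j := Finset.sum_nonneg fun j _ => hC j
    refine ⟨1 + ∑ j, C j, by positivity, fun R hR => ?_⟩
    have hR0 : 0 < R := by linarith
    have hdc : ∀ v : Phase n, dirD v (fun z : Phase n => 1 - cut R z) =
        fun z => -((R⁻¹ : ℂ) * dil R (fun ξ => fderiv ℝ (bump n) ξ v.2) z) := by
      intro v
      rw [dirD_sub v (differentiable_const 1) (smooth_differentiable (smooth_cut R)), cut,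
        dirD_dil R smooth_bump, dirD_const]
      simp
    rw [symB_succ]
    refine ⟨fun z => (hval R hR z).trans ?_, fun j => ?_, fun j => ?_⟩
    · have := bracket_rpow_pos z.2 1
      gcongr
      linarith
    · rw [partialX_eq, hdc]
      simp only [dil, map_zero, mul_zero, neg_zero]
      exact symAt_zero N _ (by positivity)
    · rw [partialXi_eq, hdc]
      intro z
      refine ((h j R hR z).const_mul (R⁻¹ : ℂ) (smooth_dil R (hd _))).neg.mono ?_ (by simp)
      have : C j ≤ ∑ j, C j := Finset.single_le_sum (fun j _ => hC j) (Finset.mem_univ j)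
      rw [norm_inv, Complex.norm_real, Real.norm_of_nonneg hR0.le, pow_zero, mul_one,
        ← div_eq_inv_mul]
      gcongr
      linarith

lemma NetSymb.cut {R : EpsIndex → ℝ} (hR : Moderate R) (h1 : ∀ ε, 1 ≤ R ε) (m : ℝ) :
    NetSymb m (fun ε => (_root_.cut (R ε) : Phase n → ℂ)) := by
  obtain ⟨l, hl⟩ := exists_nat_ge (-m)
  refine ⟨fun ε => smooth_cut _, fun N => ?_⟩
  obtain ⟨C, _, h⟩ := exists_symB_cut n N l
  exact ⟨_, (hR.pow l).const_mul C, fun ε => (h (R ε) (h1 ε)).mono le_rfl (by linarith)⟩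

/-! ### Asymptotic summation -/

/-- Borel summation for nets: a sequence of nets of decreasing orders has an asymptotic sum. The
`k`-th term is cut off to the frequencies above a radius `R_k ≥ 2 ^ k`, which makes the sum locally
finite and which depends on `ε`, so that the bounds of the tails do not. -/
theorem exists_asymptotic_sum {μ : ℝ} {P : ℕ → SymbolNet n} (hP : ∀ k : ℕ, NetSymb (μ - k) (P k)) :
    ∃ p : SymbolNet n, ∀ N : ℕ,
      NetSymb (μ - N) (fun ε z => p ε z - ∑ k ∈ Finset.range N, P k ε z) := by
  choose w hw hA using fun k => (hP k).2 k
  choose C hC0 hC using fun k => exists_symB_one_sub_cut n k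
  -- With these radii the `k`-th cut-off term has its first `k` seminorms bounded by `2 ^ (-k)`.
  set R : ℕ → EpsIndex → ℝ := fun k ε => 2 ^ k * (1 + 2 ^ k * C k * w k ε) with hR
  have hw0 : ∀ k ε, 0 ≤ w k ε := fun k ε => (hA k ε).nonneg
  have hR2 : ∀ k ε, (2 : ℝ) ^ k ≤ R k ε := fun k ε => by
    have := mul_nonneg (mul_nonneg (pow_nonneg zero_le_two k) (hC0 k)) (hw0 k ε)
    exact le_mul_of_one_le_right (by positivity) (by linarith)
  have hR1 : ∀ k ε, 1 ≤ R k ε := fun k ε => (one_le_pow₀ one_le_two).trans (hR2 k ε)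
  have hRm : ∀ k, Moderate (R k) := fun k =>
    ((Moderate.const 1).add ((hw k).const_mul _)).const_mul _
  set t : ℕ → SymbolNet n := fun k ε z => (1 - cut (R k ε) z) * P k ε z with ht
  have hts : ∀ k ε, ContDiff ℝ ∞ (t k ε) := fun k ε =>
    (contDiff_const.sub (smooth_cut _)).mul ((hP k).1 ε)
  have htb : ∀ k ε, SymB k (μ - k + 1) ((1 / 2) ^ k) (t k ε) := fun k ε z => by
    refine ((hC k (R k ε) (hR1 k ε) z).mul (hA k ε z) (contDiff_const.sub (smooth_cut _))
      ((hP k).1 ε)).mono ?_ (by linarith)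
    have h2 : (0 : ℝ) < 2 ^ k := by positivity
    have h3 : 0 < R k ε := one_pos.trans_le (hR1 k ε)
    rw [div_mul_eq_mul_div, ← mul_div_assoc, div_le_iff₀ h3, hR]
    have h4 := hw0 k ε
    have h5 := hC0 k
    have e : (1 / 2 : ℝ) ^ k * (2 ^ k * (1 + 2 ^ k * C k * w k ε)) = 1 + 2 ^ k * C k * w k ε := by
      rw [← mul_assoc, ← mul_pow]; norm_num
    simp only [e]
    linarith
  have htn : ∀ k : ℕ, NetSymb (μ - k) (t k) := fun k => by
    have := (((NetSymb.const 1).sub (NetSymb.cut (n := n) (hRm k) (hR1 k) 0)).mul (hP k))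
    simpa using this
  have htz : ∀ k ε (z : Phase n), ‖z.2‖ ≤ 2 ^ k → t k ε z = 0 := fun k ε z hz => by
    simp only [ht]
    rw [cut_of_norm_le (one_pos.trans_le (hR1 k ε)) (hz.trans (hR2 k ε))]; simp
  set p : SymbolNet n := fun ε z => ∑' k, t k ε z with hp
  have hloc : ∀ (z : Phase n) (M : ℕ), ∃ K, M ≤ K ∧ ∀ ε,
      p ε =ᶠ[𝓝 z] fun z => ∑ k ∈ Finset.range K, t k ε z := by
    intro z M
    obtain ⟨k, hk⟩ := pow_unbounded_of_one_lt ‖z.2‖ one_lt_two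
    refine ⟨max M k, le_max_left _ _, fun ε => ?_⟩
    have : ∀ᶠ z' : Phase n in 𝓝 z, ‖z'.2‖ < 2 ^ k :=
      (continuous_snd.norm.continuousAt (x := z)).eventually_lt_const hk
    filter_upwards [this] with z' hz'
    refine tsum_eq_sum fun l hl => htz l ε z' (hz'.le.trans ?_)
    have : k ≤ l := (le_max_right M k).trans (by simpa using hl)
    exact pow_le_pow_right₀ one_le_two this
  have hps : ∀ ε, ContDiff ℝ ∞ (p ε) := fun ε => contDiff_iff_contDiffAt.2 fun z => by
    obtain ⟨K, -, hK⟩ := hloc z 0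
    exact (ContDiff.sum fun k _ => hts k ε).contDiffAt.congr_of_eventuallyEq (hK ε)
  have htail : ∀ M ε, SymB M (μ - M + 1) 2 (fun z => p ε z - ∑ k ∈ Finset.range M, t k ε z) := by
    intro M ε z
    obtain ⟨K, hMK, hK⟩ := hloc z M
    have h1 : ∀ L, M ≤ L → SymAt M (μ - M + 1) (∑ k ∈ Finset.Ico M L, (1 / 2 : ℝ) ^ k)
        (fun z => ∑ k ∈ Finset.Ico M L, t k ε z) z := by
      intro L hL
      induction L, hL using Nat.le_induction with
      | base => simpa using symAt_zero M _ le_rfl z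
      | succ L hL ih =>
        simp only [Finset.sum_Ico_succ_top hL]
        refine ih.add (((htb L ε z).of_le hL).mono le_rfl ?_) (ContDiff.sum fun k _ => hts k ε)
          (hts L ε)
        have : (M : ℝ) ≤ L := by exact_mod_cast hL
        linarith
    refine ((h1 K hMK).mono ?_ le_rfl).congr ?_
    · refine (Finset.sum_le_sum_of_subset_of_nonneg (t := Finset.range K) (fun k hk => ?_)
        fun _ _ _ => by positivity).trans ?_
      · simp at hk ⊢; omega
      · exact (Summable.sum_le_tsum _ (fun _ _ => by positivity)
          summable_geometric_two).trans tsum_geometric_two.le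
    · filter_upwards [hK ε] with z' hz'
      rw [hz', Finset.sum_Ico_eq_sub _ hMK]
  refine ⟨p, fun N => ⟨fun ε => (hps ε).sub (ContDiff.sum fun k _ => (hP k).1 ε), fun L => ?_⟩⟩
  -- The tail from `M ≥ L` has bounded seminorms of order `L`, for the order `μ - M + 1 ≤ μ - N`.
  set M := max (N + 1) L with hM
  have hNM : N ≤ M := by omega
  have hA1 : NetSymb (μ - N) (fun ε z => ∑ k ∈ Finset.range N, -(cut (R k ε) z * P k ε z)) :=
    NetSymb.sum _ fun k _ => ((NetSymb.cut (hRm k) (hR1 k) (-(N : ℝ))).mul (hP k)).neg.mono (by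
      have : (0 : ℝ) ≤ k := k.cast_nonneg
      linarith)
  have hA2 : NetSymb (μ - N) (fun ε z => ∑ k ∈ Finset.Ico N M, t k ε z) :=
    NetSymb.sum _ fun k hk => (htn k).mono (by
      have : (N : ℝ) ≤ k := by exact_mod_cast (Finset.mem_Ico.1 hk).1
      linarith)
  obtain ⟨v, hv, hB⟩ := (hA1.add hA2).2 L
  refine ⟨_, hv.add (Moderate.const 2), fun ε z => ?_⟩
  have hMr : (N : ℝ) + 1 ≤ M := by exact_mod_cast le_max_left (N + 1) L
  have h3 := ((htail M ε z).of_le (le_max_right (N + 1) L)).mono (m' := μ - N) le_rfl (by linarith)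
  have h4 := (hB ε z).add h3 ((hA1.add hA2).1 ε) ((hps ε).sub (ContDiff.sum fun k _ => hts k ε))
  refine h4.congr (Eventually.of_forall fun z => ?_)
  have e1 : ∀ k, t k ε z = P k ε z + -(cut (R k ε) z * P k ε z) := fun k => by
    simp only [ht]; ring
  have e2 : ∑ k ∈ Finset.range N, t k ε z =
      ∑ k ∈ Finset.range N, P k ε z + ∑ k ∈ Finset.range N, -(cut (R k ε) z * P k ε z) := by
    rw [← Finset.sum_add_distrib]; exact Finset.sum_congr rfl fun k _ => e1 k
  beta_reduce
  rw [Finset.sum_Ico_eq_sub _ hNM, e2]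
  ring

/-! ### The parametrix -/

/-- An elliptic net is inverted by a net of symbols up to an error of order `-1`. The inverse is
`conj a / (|a|² + φ)`, with a cut-off `φ` that removes the zeros of `a`. -/
lemma exists_approx_inv {m : ℝ} {a : SymbolNet n} (ha : NetSymb m a) {r s : EpsIndex → ℝ}
    (hr : Moderate r) (hr1 : ∀ ε, 1 ≤ r ε) (hs : Moderate s)
    (hell : ∀ ε z, r ε ≤ ‖z.2‖ → bracket z.2 ^ m ≤ s ε * ‖a ε z‖) :
    ∃ q : SymbolNet n, NetSymb (-m) q ∧ NetSymb (-1) (fun ε z => 1 - q ε z * a ε z) := by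
  set d : SymbolNet n := fun ε z => a ε z * (starRingEnd ℂ) (a ε z) + cut (r ε) z with hd
  have hdn : NetSymb (m + m) d := (ha.mul ha.conj).add (NetSymb.cut hr hr1 _)
  obtain ⟨J, hJ⟩ := exists_nat_ge (m + m)
  -- For `|ξ| ≥ r` this is the ellipticity of `a`; for `|ξ| ≤ r` the cut-off is `1`, and `⟨ξ⟩ ≤ 2r`.
  have hdl : ∀ ε z, bracket z.2 ^ (m + m) ≤ (1 + s ε ^ 2 + (2 * r ε) ^ J) * ‖d ε z‖ := by
    intro ε z
    obtain ⟨t, ht0, _, ht⟩ := exists_bump_eq ((r ε)⁻¹ • z.2)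
    have hdt : d ε z = ((‖a ε z‖ ^ 2 + t : ℝ) : ℂ) := by
      simp only [hd, cut, dil, ht, Complex.mul_conj, Complex.normSq_eq_norm_sq]
      push_cast; ring
    have hr0 : 0 < r ε := one_pos.trans_le (hr1 ε)
    have hJ0 : 0 ≤ (2 * r ε) ^ J := by positivity
    rw [hdt, Complex.norm_real, Real.norm_of_nonneg (by positivity)]
    have hb := bracket_rpow_pos z.2 m
    rcases le_total (r ε) ‖z.2‖ with h | h
    · have h1 := hell ε z h
      have h2 : bracket z.2 ^ (m + m) ≤ s ε ^ 2 * ‖a ε z‖ ^ 2 := by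
        rw [bracket_rpow_add, ← mul_pow, sq]
        exact mul_le_mul h1 h1 hb.le (hb.le.trans h1)
      refine h2.trans (mul_le_mul (by linarith) (by linarith) (by positivity) (by positivity))
    · have ht1 : t = 1 := by
        have := cut_of_norm_le hr0 h
        rw [cut, dil, ht] at this
        exact_mod_cast this
      have h1 : bracket z.2 ^ (m + m) ≤ (2 * r ε) ^ J := by
        have h2 : bracket z.2 ≤ 2 * r ε := by
          have := bracket_le_one_add_norm z.2
          linarith [hr1 ε]
        calc bracket z.2 ^ (m + m) ≤ bracket z.2 ^ (J : ℝ) := bracket_rpow_le hJ _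
          _ = bracket z.2 ^ J := Real.rpow_natCast _ _
          _ ≤ _ := pow_le_pow_left₀ (bracket_pos _).le h2 J
      rw [ht1]
      refine h1.trans ?_
      have h3 : 0 ≤ s ε ^ 2 := sq_nonneg _
      calc (2 * r ε) ^ J ≤ (1 + s ε ^ 2 + (2 * r ε) ^ J) * 1 := by linarith
        _ ≤ _ := by gcongr; linarith [sq_nonneg ‖a ε z‖]
  have hdi := hdn.inv (((Moderate.const 1).add (hs.pow 2)).add ((hr.const_mul 2).pow J))
    (fun ε => by
      have hr0 : 0 < r ε := one_pos.trans_le (hr1 ε)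
      have : 0 ≤ (2 * r ε) ^ J := by positivity
      linarith [sq_nonneg (s ε)]) hdl
  have hd0 : ∀ ε z, d ε z ≠ 0 := fun ε z h0 => by
    have := hdl ε z
    rw [h0, norm_zero, mul_zero] at this
    exact absurd this (bracket_rpow_pos _ _).not_ge
  refine ⟨fun ε z => (starRingEnd ℂ) (a ε z) * (d ε z)⁻¹, (ha.conj.mul hdi).mono (by linarith), ?_⟩
  have h := ((NetSymb.cut hr hr1 (m + m - 1)).mul hdi).mono (m₂ := -1) (by linarith)
  have e : (fun ε z => 1 - (starRingEnd ℂ) (a ε z) * (d ε z)⁻¹ * a ε z) =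
      fun ε z => cut (r ε) z * (d ε z)⁻¹ := by
    funext ε z
    have := hd0 ε z
    field_simp
    simp only [hd]
    ring
  rw [e]
  exact h

/-- The parametrix of a net with uniform ellipticity bounds. The successive errors satisfy
`e₀ = 1` and `e_{k+1} = e_k - (e_k q) # a`, where `q` is an inverse of `a` up to order `-1`; the
parametrix is an asymptotic sum of the `e_k q`. -/
theorem exists_parametrix {m : ℝ} {a : SymbolNet n} (ha : NetSymb m a) {r s : EpsIndex → ℝ}
    (hr : Moderate r) (hr1 : ∀ ε, 1 ≤ r ε) (hs : Moderate s)
    (hell : ∀ ε z, r ε ≤ ‖z.2‖ → bracket z.2 ^ m ≤ s ε * ‖a ε z‖) :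
    ∃ p c : SymbolNet n, NetSymb (-m) p ∧ (∀ ε, IsSharp (p ε) (a ε) (c ε)) ∧
      ∀ N : ℕ, NetSymb (-(N : ℝ)) (fun ε z => c ε z - 1) := by
  obtain ⟨q, hq, hκ⟩ := exists_approx_inv ha hr hr1 hs hell
  obtain ⟨K, hK'⟩ := exists_nat_ge (3 * ((n : ℝ) + 1) + |-m|)
  have hK : Adm n K (-m) := by
    unfold Adm
    have : (0 : ℝ) ≤ K := K.cast_nonneg
    linarith
  set E : ℕ → SymbolNet n := fun k => Nat.rec (fun _ _ => 1)
    (fun _ e ε z => e ε z - sharp K (fun z => e ε z * q ε z) (a ε) z) k with hE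
  have hE0 : E 0 = fun _ _ => 1 := rfl
  have hE1 : ∀ k ε z, E (k + 1) ε z = E k ε z - sharp K (fun z => E k ε z * q ε z) (a ε) z :=
    fun k ε z => rfl
  have hEn : ∀ k : ℕ, NetSymb (-(k : ℝ)) (E k) := by
    intro k
    induction k with
    | zero => rw [hE0]; simpa using NetSymb.const (n := n) 1
    | succ k ih =>
      have hk : (0 : ℝ) ≤ k := k.cast_nonneg
      have h1 := ih.mul hκ
      have h2 := (ih.mul hq).sharp_sub_mul ha (K := K) (by linarith [hK.le])
      have h3 := (h1.mono (m₂ := -((k + 1 : ℕ) : ℝ)) (by push_cast; linarith)).sub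
        (h2.mono (by push_cast; linarith))
      have e : (fun ε z => E k ε z * (1 - q ε z * a ε z) -
          (sharp K (fun z => E k ε z * q ε z) (a ε) z - E k ε z * q ε z * a ε z)) = E (k + 1) := by
        funext ε z
        rw [hE1]; ring
      rwa [e] at h3
  have hP : ∀ k : ℕ, NetSymb (-m - k) (fun ε z => E k ε z * q ε z) := fun k =>
    ((hEn k).mul hq).mono (by linarith)
  obtain ⟨p, hp⟩ := exists_asymptotic_sum hP
  have hp0 : NetSymb (-m) p := by simpa using hp 0
  have hP' : ∀ k ε, Symb (-m) (fun z => E k ε z * q ε z) := fun k ε =>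
    ((hP k).mono (by have : (0 : ℝ) ≤ k := k.cast_nonneg
                     linarith)).symb ε
  have hQ : ∀ N ε, Symb (-m)
      (fun z => p ε z - ∑ k ∈ Finset.range N, E k ε z * q ε z) := fun N ε =>
    ((hp N).mono (by have : (0 : ℝ) ≤ N := N.cast_nonneg
                     linarith)).symb ε
  refine ⟨p, fun ε => sharp K (p ε) (a ε), hp0, fun ε =>
    isSharp_sharp (hp0.symb ε) (ha.symb ε) hK.le, fun N => ?_⟩
  -- The partial sums telescope: `1 - (∑_{k < N} e_k q) # a = e_N`.
  have key : ∀ ε z, sharp K (p ε) (a ε) z - 1 =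
      sharp K (fun z => p ε z - ∑ k ∈ Finset.range N, E k ε z * q ε z) (a ε) z - E N ε z := by
    intro ε z
    induction N with
    | zero => simp [hE0]
    | succ N ih =>
      rw [ih, hE1]
      have h1 := sharp_sub (hQ N ε) (hP' N ε) (ha.symb ε) hK z
      simp only [Finset.sum_range_succ, ← sub_sub]
      rw [h1]
      ring
  simp only [key]
  have hN : (0 : ℝ) ≤ N := N.cast_nonneg
  exact (((hp N).sharp ha (by linarith [hK.le])).mono (by linarith)).sub (hEn N)

/-- Freezing the net for `ε ≥ η` makes it elliptic for all parameters. -/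
lemma IsLscElliptic.exists_moderate {m : ℝ} {a : SymbolNet n} (h : IsLscElliptic m a) :
    ∃ η : EpsIndex, ∃ r s : EpsIndex → ℝ, Moderate r ∧ (∀ ε, 1 ≤ r ε) ∧ Moderate s ∧
      ∀ ε z, r ε ≤ ‖z.2‖ → bracket z.2 ^ m ≤ s ε * ‖a (min ε η) z‖ := by
  obtain ⟨r, hr, s, hs, η₁, h⟩ := h
  obtain ⟨η₂, c, hc, hsc⟩ := hs.1
  set η := min η₁ η₂ with hη
  refine ⟨η, fun ε => 1 + |r (min ε η)|, fun ε => s (min ε η),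
    ((Moderate.const 1).add (hr.moderate.comp_min η).abs), fun ε => by
      linarith [abs_nonneg (r (min ε η))], hs.moderate.comp_min η, fun ε z hz => ?_⟩
  have h1 : min ε η ≤ η₁ := (min_le_right _ _).trans (min_le_left _ _)
  have h2 : min ε η ≤ η₂ := (min_le_right _ _).trans (min_le_right _ _)
  have h3 : 0 < s (min ε η) := hc.trans_le (hsc _ h2)
  have h4 := h _ h1 z.1 z.2 (by linarith [le_abs_self (r (min ε η))])
  rwa [one_div, inv_mul_le_iff₀ h3] at h4

lemma isSharp_zero (a : Phase n → ℂ) : IsSharp (fun _ => 0) a (fun _ => 0) := fun u x => by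
  simp [pseudoOp]

end

theorem theorem4p1 (n : ℕ) (m : ℝ) (a : SymbolNet n)
    (ha : IsLscSymbol m a) (hell : IsLscElliptic m a) :
    ∃ p : SymbolNet n, IsLscSymbol (-m) p ∧
      ∃ c : SymbolNet n, IsLscSymbol 0 c ∧ (∀ ε : EpsIndex, IsSharp (p ε) (a ε) (c ε)) ∧
        EqModLscSmoothing c (fun _ _ => 1) := by
  obtain ⟨η, r, s, hr, hr1, hs, h⟩ := hell.exists_moderate
  obtain ⟨p, c, hp, hpc, hc⟩ := exists_parametrix (ha.netSymb.comp_min η) hr hr1 hs h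
  have hc0 : NetSymb 0 c := by
    have h0 := (hc 0).mono (m₂ := 0) (by simp)
    simpa using h0.add (NetSymb.const 1)
  -- For `ε > η` nothing is known about `a ε`; there the zero symbol serves as `p` and as `c`.
  refine ⟨_, (hp.truncate η).isLscSymbol, _, (hc0.truncate η).isLscSymbol, fun ε => ?_,
    fun ε z => c ε z - 1, fun k => ?_, η, fun ε hε z => ?_⟩
  · split_ifs with hε
    · have := hpc ε
      rwa [min_eq_left hε] at this
    · exact isSharp_zero _
  · obtain ⟨N, hN⟩ := exists_nat_ge (-k)
    exact ((hc N).mono (by linarith)).isLscSymbol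
  · simp [hε]
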